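/- **Setting.** *Types* are generated by $A ::= 0 \mid 1 \mid A+A \mid A\times A$. The initial sum-product category $\Sigma\Pi(\emptyset)$ is the free category with finite sums and finite products on the empty category: its objects are the types, and its arrows are the formal arrows built from identities, composition, the unique arrows $0\to A$ and $A\to 1$, coprojections $\sigma_0,\sigma_1$, projections $\pi_0,\pi_1$, cotupling and tupling, modulo the least congruence that makes it a category in which $0$ is initial, $1$ is final, $+$ is a binary coproduct and $\times$ a binary product. *Cut-free terms* are: $\{\}:0\to B$; $\langle\rangle:A\to 1$; $\sigma_i(t):A\to B_0+B_1$ for $t:A\to B_i$; $\pi_j(t):A_0\times A_1\to B$ for $t:A_j\to B$; $\{t_0,t_1\}:A_0+A_1\to B$ for $t_i:A_i\to B$; $\langle t_0,t_1\rangle:A\to B_0\times B_1$ for $t_i:A\to B_i$. Each represents an arrow of $\Sigma\Pi(\emptyset)$ in the evident way ($\sigma_i(t)$ is $t$ followed by $\sigma_i$, and $\pi_j(t)$ is $\pi_j$ followed by $t$). Put $\mathsf{size}(0)=\mathsf{size}(1)=\mathsf{hgt}(0)=\mathsf{hgt}(1)=1$, $\mathsf{size}(A+B)=\mathsf{size}(A\times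 B)=1+\mathsf{size}(A)+\mathsf{size}(B)$ and $\mathsf{hgt}(A+B)=\mathsf{hgt}(A\times B)=1+\max(\mathsf{hgt}(A),\mathsf{hgt}(B))$. **Cost model.** Types and terms are given as syntax trees. Algorithms are first-order functional programs with finitely many mutually recursive functions on binary trees with labels from a finite set; making a leaf, making a pair, taking a pair apart, branching on a label, calling a function and returning from a call take one step each. **Procedure.** In $\Sigma\Pi(\emptyset)$ every type $A$ is either *pointed* (there is an arrow $1\to A$) or *copointed* (there is an arrow $A\to 0$), and not both. A term $X\to A$ is pointed if it factors through $1$, copointed if it factors through $0$, *indefinite* if it is one or the other, and otherwise *definite*. The coprojection $\sigma_i:A_i\to A_0+A_1$ is called *cancellable* unless $A_i$ is copointed and $A_{1-i}$ is pointed; the projection $\pi_j:X_0\times X_1\to X_j$ is called cancellable unless $X_j$ is pointed and $X_{1-j}$ is copointed. A preprocessing sweep annotates every subtype of the two types with a point or a copoint. Then $f,g:X\to A$ are compared as follows. 1. If $X=0$ or $A=1$, answer yes. 2. If $X=X_0+X_1$, compare the cut-free forms of $\sigma_i;f$ and $\sigma_i;g$ recursively for $i=0,1$. Otherwise, if $A=A_0\times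 A_1$, compare those of $f;\pi_i$ and $g;\pi_i$ recursively for $i=0,1$. 3. Otherwise test whether $f$ and $g$ are indefinite. If exactly one is, answer no. If both are: when $X$ is copointed and $A$ is pointed, answer yes (both are the disconnect $X\to 0\to 1\to A$); else answer whether their points (or their copoints) are syntactically equal. 4. If both are definite, then $X=X_0\times X_1$, $A=A_0+A_1$, and each of $f$, $g$ has the form $\sigma_i(-)$ or $\pi_j(-)$. * $f=\sigma_i(f')$ and $g=\sigma_k(g')$ with $i\ne k$: answer no. * $f=\sigma_i(f')$ and $g=\sigma_i(g')$: if $\sigma_i$ is cancellable, compare $f'$ and $g'$. Otherwise, for the first $j$ in $0,1$ for which one finds factorizations $f=\pi_j(f_1)$ and $g=\pi_j(g_1)$, compare $f_1$ and $g_1$; if there is no such $j$, compare $f'$ and $g'$. * $f=\pi_j(f')$ and $g=\pi_k(g')$: dually. * One of $f,g$ is $\sigma_i(u)$ and the other one is $\pi_j(w)$. If at least one of $\sigma_i$, $\pi_j$ is cancellable, choose a cancellable one (that of $g$ if both are), and look for a factorization through it of the term that is not of that form; if there is one, cancel and compare the two factors recursively, and if there is none, answer no. If neither is cancellable, answer no.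 The indefiniteness test and the search for a factorization through a given (co)projection are single recursive passes over the term. **Proposition.** This procedure is correct and runs in time $O\big((\mathsf{hgt}(A)+\mathsf{hgt}(B))\cdot\mathsf{size}(A)\cdot\mathsf{size}(B)\big)$. That is, there is a constant $C$ such that for all types $A,B$ and all cut-free terms $t_1,t_2:A\to B$, the procedure, started on the syntax trees of $A,B,t_1,t_2$, halts after at most $C\cdot(\mathsf{hgt}(A)+\mathsf{hgt}(B))\cdot\mathsf{size}(A)\cdot\mathsf{size}(B)$ steps with a truth value, and this value is "true" if and only if $t_1$ and $t_2$ represent the same arrow of $\Sigma\Pi(\emptyset)$. -/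

import Mathlib

namespace SP

/-! ## Types and cut-free terms -/

/-- The objects of the initial sum-product category: the types generated by the initial object,
the final object, binary sums and binary products, with no atoms. -/
inductive Ty : Type
  | zero : Ty
  | one : Ty
  | plus : Ty → Ty → Ty
  | times : Ty → Ty → Ty

/-- The size of a type. -/
def Ty.size : Ty → ℕ
  | .zero => 1
  | .one => 1
  | .plus A B => 1 + A.size + B.size
  | .times A B => 1 + A.size + B.size

/-- The height of a type. -/
def Ty.hgt : Ty → ℕ
  | .zero => 1
  | .one => 1
  | .plus A B => 1 + max A.hgt B.hgt
  | .times A B => 1 + max A.hgt B.hgt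

/-- Cut-free terms `A → B`: the empty cotuple `{}`, the empty tuple `⟨⟩`, the coprojections
`σ₀(t)`, `σ₁(t)`, the projections `π₀(t)`, `π₁(t)`, the cotuple `{t₀, t₁}` and the tuple
`⟨t₀, t₁⟩`. -/
inductive Tm : Ty → Ty → Type
  | cobang (B : Ty) : Tm .zero B
  | bang (A : Ty) : Tm A .one
  | inj₀ {A B₀ B₁ : Ty} : Tm A B₀ → Tm A (.plus B₀ B₁)
  | inj₁ {A B₀ B₁ : Ty} : Tm A B₁ → Tm A (.plus B₀ B₁)
  | proj₀ {A₀ A₁ B : Ty} : Tm A₀ B → Tm (.times A₀ A₁) B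
  | proj₁ {A₀ A₁ B : Ty} : Tm A₁ B → Tm (.times A₀ A₁) B
  | cotuple {A₀ A₁ B : Ty} : Tm A₀ B → Tm A₁ B → Tm (.plus A₀ A₁) B
  | tuple {A B₀ B₁ : Ty} : Tm A B₀ → Tm A B₁ → Tm A (.times B₀ B₁)

/-! ## The initial sum-product category -/

/-- Formal arrows: everything that can be built from identities, composition (in diagrammatic
order) and the structure maps of finite sums and products. -/
inductive Arr : Ty → Ty → Type
  | id (A : Ty) : Arr A A
  | comp {A B C : Ty} : Arr A B → Arr B C → Arr A C
  | cobang (A : Ty) : Arr .zero A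
  | bang (A : Ty) : Arr A .one
  | inl (A B : Ty) : Arr A (.plus A B)
  | inr (A B : Ty) : Arr B (.plus A B)
  | case {A B C : Ty} : Arr A C → Arr B C → Arr (.plus A B) C
  | fst (A B : Ty) : Arr (.times A B) A
  | snd (A B : Ty) : Arr (.times A B) B
  | pair {A B C : Ty} : Arr C A → Arr C B → Arr C (.times A B)

/-- Provable equality of formal arrows: the least congruence that satisfies the equations of a
category in which `zero` is initial, `one` is final, `plus` is a binary coproduct and `times` is a
binary product. -/
inductive Arr.Eqv : {A B : Ty} → Arr A B → Arr A B → Prop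
  | refl {A B : Ty} (f : Arr A B) : Eqv f f
  | symm {A B : Ty} {f g : Arr A B} : Eqv f g → Eqv g f
  | trans {A B : Ty} {f g h : Arr A B} : Eqv f g → Eqv g h → Eqv f h
  | comp_congr {A B C : Ty} {f f' : Arr A B} {g g' : Arr B C} :
      Eqv f f' → Eqv g g' → Eqv (f.comp g) (f'.comp g')
  | case_congr {A B C : Ty} {f f' : Arr A C} {g g' : Arr B C} :
      Eqv f f' → Eqv g g' → Eqv (f.case g) (f'.case g')
  | pair_congr {A B C : Ty} {f f' : Arr C A} {g g' : Arr C B} :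
      Eqv f f' → Eqv g g' → Eqv (f.pair g) (f'.pair g')
  | id_comp {A B : Ty} (f : Arr A B) : Eqv ((Arr.id A).comp f) f
  | comp_id {A B : Ty} (f : Arr A B) : Eqv (f.comp (Arr.id B)) f
  | assoc {A B C D : Ty} (f : Arr A B) (g : Arr B C) (h : Arr C D) :
      Eqv ((f.comp g).comp h) (f.comp (g.comp h))
  | cobang_uniq {A : Ty} (f : Arr .zero A) : Eqv f (Arr.cobang A)
  | bang_uniq {A : Ty} (f : Arr A .one) : Eqv f (Arr.bang A)
  | inl_case {A B C : Ty} (f : Arr A C) (g : Arr B C) :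
      Eqv ((Arr.inl A B).comp (f.case g)) f
  | inr_case {A B C : Ty} (f : Arr A C) (g : Arr B C) :
      Eqv ((Arr.inr A B).comp (f.case g)) g
  | case_uniq {A B C : Ty} (h : Arr (.plus A B) C) :
      Eqv h (Arr.case ((Arr.inl A B).comp h) ((Arr.inr A B).comp h))
  | pair_fst {A B C : Ty} (f : Arr C A) (g : Arr C B) :
      Eqv ((f.pair g).comp (Arr.fst A B)) f
  | pair_snd {A B C : Ty} (f : Arr C A) (g : Arr C B) :
      Eqv ((f.pair g).comp (Arr.snd A B)) g
  | pair_uniq {A B C : Ty} (h : Arr C (.times A B)) :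
      Eqv h (Arr.pair (h.comp (Arr.fst A B)) (h.comp (Arr.snd A B)))

/-- Formal arrows up to provable equality. -/
instance Arr.setoid (A B : Ty) : Setoid (Arr A B) where
  r := Arr.Eqv
  iseqv := ⟨Arr.Eqv.refl, Arr.Eqv.symm, Arr.Eqv.trans⟩

/-- The initial sum-product category `ΣΠ(∅)`: its objects are the types, its arrows are the formal
arrows up to provable equality. -/
instance : CategoryTheory.Category Ty where
  Hom A B := Quotient (Arr.setoid A B)
  id A := Quotient.mk _ (Arr.id A)
  comp f g := Quotient.map₂ Arr.comp (fun _ _ h _ _ k => Arr.Eqv.comp_congr h k) f g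
  id_comp f := Quotient.inductionOn f fun f => Quotient.sound (Arr.Eqv.id_comp f)
  comp_id f := Quotient.inductionOn f fun f => Quotient.sound (Arr.Eqv.comp_id f)
  assoc f g h := Quotient.inductionOn₃ f g h fun f g h => Quotient.sound (Arr.Eqv.assoc f g h)

/-- The formal arrow that a cut-free term stands for. -/
def Tm.arr : {A B : Ty} → Tm A B → Arr A B
  | _, _, .cobang B => Arr.cobang B
  | _, _, .bang A => Arr.bang A
  | _, _, .inj₀ t => t.arr.comp (Arr.inl _ _)
  | _, _, .inj₁ t => t.arr.comp (Arr.inr _ _)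
  | _, _, .proj₀ t => (Arr.fst _ _).comp t.arr
  | _, _, .proj₁ t => (Arr.snd _ _).comp t.arr
  | _, _, .cotuple t u => t.arr.case u.arr
  | _, _, .tuple t u => t.arr.pair u.arr

/-- The arrow of `ΣΠ(∅)` that a cut-free term represents. -/
def Tm.hom {A B : Ty} (t : Tm A B) : A ⟶ B := Quotient.mk (Arr.setoid A B) t.arr

/-! ## A machine for first-order functional programs

Data are binary trees whose leaves are labelled by elements of a finite set.  A program is a finite
family of named, mutually recursive functions.  The body of a function is a straight-line sequence
of elementary instructions with finite branching on labels.  The machine executes one elementary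
instruction (or one return from a call) in each step. -/

/-- The labels.  Everything comes in two polarities: `false` stands for sums and their structure
maps, `true` for products and theirs.
* `unit false`, `unit true` : the types `0` and `1`;
* `node false`, `node true` : the type constructors `+` and `×`;
* `nul false`, `nul true` : the terms `{}` and `⟨⟩`;
* `leg false i`, `leg true i` : the term constructors `σᵢ` and `πᵢ` (`i = 0` is `false`,
  `i = 1` is `true`);
* `tup false`, `tup true` : the term constructors `{_, _}` and `⟨_, _⟩`;
* `bit b` : a truth value;
* `nil` : the label of an empty field, and the failure answer of a partial function;
* `found` : the label of a success answer of a partial function. -/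
inductive Label : Type
  | unit (p : Bool)
  | node (p : Bool)
  | nul (p : Bool)
  | leg (p i : Bool)
  | tup (p : Bool)
  | bit (b : Bool)
  | nil
  | found

/-- Data of the machine. -/
inductive Data : Type
  | leaf : Label → Data
  | cons : Data → Data → Data

/-- Names of the functions of the decision procedure. -/
inductive Fn : Type
  | main
  | annot
  | same
  | indef
  | factor (p i : Bool)
  | restrict (p i : Bool)
  | equivalent

/-- Code with data registers of type `V` and a result of type `α`.  Code is written for an
arbitrary type `V`, so that it can touch the data only through the instructions. -/
inductive Code (V α : Type) : Type
  | ret (a : α)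
  | leaf (l : Label) (k : V → Code V α)
  | cons (x y : V) (k : V → Code V α)
  | uncons (x : V) (k : V → V → Code V α)
  | look (x : V) (k : Label → Code V α)
  | call (f : Fn) (args : List V) (k : V → Code V α)
  | abort

/-- Sequencing of code. -/
def Code.bind {V α β : Type} : Code V α → (α → Code V β) → Code V β
  | .ret a, j => j a
  | .leaf l k, j => .leaf l fun v => (k v).bind j
  | .cons x y k, j => .cons x y fun v => (k v).bind j
  | .uncons x k, j => .uncons x fun v w => (k v w).bind j
  | .look x k, j => .look x fun l => (k l).bind j
  | .call f xs k, j => .call f xs fun v => (k v).bind j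
  | .abort, _ => .abort

instance (V : Type) : Monad (Code V) where
  pure := Code.ret
  bind := Code.bind

/-- A state of the machine: the code being executed and the stack of suspended callers. -/
structure State : Type where
  code : Code Data Data
  stack : List (Data → Code Data Data)

/-- One step of the machine that runs a program.  It stays in its state when it has halted
(`ret` with an empty stack) and when it is stuck. -/
def step (prog : Fn → List Data → Code Data Data) : State → State
  | ⟨.ret a, []⟩ => ⟨.ret a, []⟩
  | ⟨.ret a, k :: s⟩ => ⟨k a, s⟩
  | ⟨.leaf l k, s⟩ => ⟨k (.leaf l), s⟩
  | ⟨.cons x y k, s⟩ => ⟨k (.cons x y), s⟩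
  | ⟨.uncons (.cons x y) k, s⟩ => ⟨k x y, s⟩
  | ⟨.uncons (.leaf l) k, s⟩ => ⟨.uncons (.leaf l) k, s⟩
  | ⟨.look (.leaf l) k, s⟩ => ⟨k l, s⟩
  | ⟨.look (.cons x y) k, s⟩ => ⟨.look (.cons x y) k, s⟩
  | ⟨.call f xs k, s⟩ => ⟨prog f xs, k :: s⟩
  | ⟨.abort, s⟩ => ⟨.abort, s⟩

/-- Started on the function `f` with arguments `xs`, the machine halts with result `v` after at
most `n` steps. -/
def HaltsWithin (prog : Fn → List Data → Code Data Data) (f : Fn) (xs : List Data) (n : ℕ)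
    (v : Data) : Prop :=
  (step prog)^[n] ⟨prog f xs, []⟩ = ⟨.ret v, []⟩

/-! ## Input of the procedure -/

/-- A type as a syntax tree. -/
def Ty.data : Ty → Data
  | .zero => .cons (.leaf (.unit false)) (.leaf .nil)
  | .one => .cons (.leaf (.unit true)) (.leaf .nil)
  | .plus A B => .cons (.leaf (.node false)) (.cons A.data B.data)
  | .times A B => .cons (.leaf (.node true)) (.cons A.data B.data)

/-- A term as a syntax tree. -/
def Tm.data : {A B : Ty} → Tm A B → Data
  | _, _, .cobang _ => .cons (.leaf (.nul false)) (.leaf .nil)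
  | _, _, .bang _ => .cons (.leaf (.nul true)) (.leaf .nil)
  | _, _, .inj₀ t => .cons (.leaf (.leg false false)) t.data
  | _, _, .inj₁ t => .cons (.leaf (.leg false true)) t.data
  | _, _, .proj₀ t => .cons (.leaf (.leg true false)) t.data
  | _, _, .proj₁ t => .cons (.leaf (.leg true true)) t.data
  | _, _, .cotuple t u => .cons (.leaf (.tup false)) (.cons t.data u.data)
  | _, _, .tuple t u => .cons (.leaf (.tup true)) (.cons t.data u.data)

/-! ## The decision procedure

An *annotated type* is a syntax tree `tag . (bit . (canon . children))` that stores at each node the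
bit that tells whether the type is pointed (`true`: it has an arrow from `1`) or copointed
(`false`: it has an arrow to `0`), and a term for such a point or copoint.  In `ΣΠ(∅)` every type is
exactly one of the two.  Terms carry no types, so the syntax tree of a copoint `X → 0` is also
the syntax tree of the composite `X → 0 → A`, and dually. -/

section Procedure

variable {V : Type}

/-- The constant `l`. -/
def mkLeaf (l : Label) : Code V V := .leaf l .ret

/-- The pair `x . y`. -/
def mkCons (x y : V) : Code V V := .cons x y .ret

/-- The two components of a pair. -/
def unCons (x : V) : Code V (V × V) := .uncons x fun a b => .ret (a, b)

/-- The label of a leaf. -/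
def getLabel (x : V) : Code V Label := .look x .ret

/-- The value of the function `f` at the arguments `xs`. -/
def callFn (f : Fn) (xs : List V) : Code V V := .call f xs .ret

/-- The tree `l . x`. -/
def mkTag (l : Label) (x : V) : Code V V := do
  let a ← mkLeaf l
  mkCons a x

/-- The tree `l . (x . y)`. -/
def mkTag₂ (l : Label) (x y : V) : Code V V := do
  let c ← mkCons x y
  mkTag l c

/-- The tree `l . nil`: nullary terms, truth values and the failure answer. -/
def mkNullary (l : Label) : Code V V := do
  let n ← mkLeaf .nil
  mkTag l n

/-- The answer `b` as a leaf. -/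
def answer (b : Bool) : Code V V := mkLeaf (.bit b)

/-- The root label of a syntax tree, and the rest. -/
def root (x : V) : Code V (Label × V) := do
  let (a, r) ← unCons x
  let l ← getLabel a
  return (l, r)

/-- The failure answer of a partial function. -/
def failure : Code V V := mkNullary .nil

/-- The success answer of a partial function. -/
def success (x : V) : Code V V := mkTag .found x

/-- Reading the answer of a partial function. -/
def isFound (r : V) : Code V (Option V) := do
  let (l, x) ← root r
  match l with
  | .found => return some x
  | _ => return none

/-- The component of index `i`. -/
def component (i : Bool) (x : V) : Code V V := do
  let (a, b) ← unCons x
  return bif i then b else a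

/-- The bit of an annotated type. -/
def pointed (A : V) : Code V Bool := do
  let (_, r) ← unCons A
  let (b, _) ← unCons r
  match ← getLabel b with
  | .bit b => return b
  | _ => .abort

/-- The canonical point or copoint of an annotated type. -/
def canon (A : V) : Code V V := do
  let (_, r) ← unCons A
  let (_, r) ← unCons r
  let (c, _) ← unCons r
  return c

/-- The child of index `i` of an annotated sum or product type. -/
def child (i : Bool) (A : V) : Code V V := do
  let (_, r) ← unCons A
  let (_, r) ← unCons r
  let (_, r) ← unCons r
  component i r

/-- An annotated type from its parts. -/
def mkAnnot (l : Label) (b : Bool) (c children : V) : Code V V := do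
  let b ← mkLeaf (.bit b)
  let r ← mkCons c children
  let r ← mkCons b r
  mkTag l r

/-- `annot A`: annotation of a type.  Among the polarity `p` types, a sum (`p = false`) is pointed
iff some summand is, and a product (`p = true`) is copointed iff some factor is. -/
def annotBody (A : V) : Code V V := do
  let (l, r) ← root A
  match l with
  | .unit p => do
    let c ← mkNullary (.nul p)
    mkAnnot l p c r
  | .node p => do
    let (A₀, A₁) ← unCons r
    let A₀ ← callFn .annot [A₀]
    let A₁ ← callFn .annot [A₁]
    let r ← mkCons A₀ A₁
    let c₀ ← canon A₀
    let c₁ ← canon A₁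
    if (← pointed A₀) = !p then
      let c ← mkTag (.leg p false) c₀
      mkAnnot l (!p) c r
    else if (← pointed A₁) = !p then
      let c ← mkTag (.leg p true) c₁
      mkAnnot l (!p) c r
    else
      let c ← mkTag₂ (.tup p) c₀ c₁
      mkAnnot l p c r
  | _ => .abort

/-- `same t u`: syntactic equality of two terms. -/
def sameBody (t u : V) : Code V V := do
  let (l, x) ← root t
  let (m, y) ← root u
  match l, m with
  | .nul p, .nul q => answer (p == q)
  | .leg p i, .leg q j => if p = q ∧ i = j then callFn .same [x, y] else answer false
  | .tup p, .tup q =>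
    if p = q then do
      let (x₀, x₁) ← unCons x
      let (y₀, y₁) ← unCons y
      match ← getLabel (← callFn .same [x₀, y₀]) with
      | .bit true => callFn .same [x₁, y₁]
      | _ => answer false
    else answer false
  | _, _ => answer false

/-- For a term `leg p i t`, given the answer `r` of `indef` for `t`: the answer for the term.  Here
`R` is the type on which `leg p` does not act. -/
def indefLeg (p i : Bool) (R r : V) : Code V V := do
  match ← isFound r with
  | none => failure
  | some c =>
    if (← pointed R) = !p then
      let c ← mkTag (.leg p i) c
      success c
    else success c

/-- For a term `tup p t₀ t₁`, given the answers `r₀`, `r₁` of `indef` for `t₀` and `t₁`: the answer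
for the term.  Here `O` is the type on which `tup p` acts and `R` is the other type. -/
def indefTup (p : Bool) (O R r₀ r₁ : V) : Code V V := do
  match ← isFound r₀, ← isFound r₁ with
  | some c₀, some c₁ =>
    if (← pointed R) = p then
      let c ← mkTag₂ (.tup p) c₀ c₁
      success c
    else
      let b₀ ← pointed (← child false O)
      let b₁ ← pointed (← child true O)
      if b₀ = !p then
        if b₁ = !p then
          match ← getLabel (← callFn .same [c₀, c₁]) with
          | .bit true => success c₀
          | _ => failure
        else success c₀
      else success c₁
  | _, _ => failure

/-- `indef X A t`: fails iff `t : X → A` is definite, that is, neither pointed nor copointed.  When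
`X` and `A` are both pointed (both copointed), it finds the point (copoint) through which `t`
factors.  When `X` is copointed and `A` is pointed, it succeeds iff `t` is the disconnect
`X → 0 → 1 → A`, and the term found is immaterial. -/
def indefBody (X A t : V) : Code V V := do
  let (l, x) ← root t
  match l with
  | .nul _ => success t
  | .leg false i => do
    let r ← callFn .indef [X, ← child i A, x]
    indefLeg false i X r
  | .leg true i => do
    let r ← callFn .indef [← child i X, A, x]
    indefLeg true i A r
  | .tup false => do
    let (t₀, t₁) ← unCons x
    let r₀ ← callFn .indef [← child false X, A, t₀]
    let r₁ ← callFn .indef [← child true X, A, t₁]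
    indefTup false X A r₀ r₁
  | .tup true => do
    let (t₀, t₁) ← unCons x
    let r₀ ← callFn .indef [X, ← child false A, t₀]
    let r₁ ← callFn .indef [X, ← child true A, t₁]
    indefTup true A X r₀ r₁
  | _ => .abort

/-- An indefinite term that is copointed (`p = false`; dually for `p = true`) factors through every
coprojection.  Given the answer `r` of `indef`, this returns the factor. -/
def viaIndef (p : Bool) (P Q r : V) : Code V V := do
  match ← isFound r with
  | none => failure
  | some c =>
    if (← pointed Q) = p then
      if (← pointed P) = p then success c
      else success (← canon Q)
    else failure

/-- `factor false i A X t`, for `t : X → A` with `A` a sum: the pair of the answer of `indef` for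
`t` and of a term `u` with `t = σᵢ(u)`, if there is one.  Dually, `factor true i X A t`, for
`t : X → A` with `X` a product, looks for `u` with `t = πᵢ(u)`.  So `P` is the type on which
`leg p i` acts and `Q` is the other one. -/
def factorBody (p i : Bool) (P Q t : V) : Code V V := do
  let (l, x) ← root t
  match l with
  | .nul _ => do
    let s ← success t
    mkCons s s
  | .tup _ => do
    let (t₀, t₁) ← unCons x
    let (r₀, u₀) ← unCons (← callFn (.factor p i) [P, ← child false Q, t₀])
    let (r₁, u₁) ← unCons (← callFn (.factor p i) [P, ← child true Q, t₁])
    let r ← indefTup p Q P r₀ r₁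
    match ← isFound u₀, ← isFound u₁ with
    | some u₀, some u₁ => do
      let u ← success (← mkTag₂ (.tup p) u₀ u₁)
      mkCons r u
    | _, _ => do
      let u ← failure
      mkCons r u
  | .leg q j =>
    if q = p then do
      let r ← callFn .indef (bif p then [P, Q, t] else [Q, P, t])
      if j = i then
        let u ← success x
        mkCons r u
      else
        let u ← viaIndef p P Q r
        mkCons r u
    else do
      let (r, u) ← unCons (← callFn (.factor p i) [P, ← child j Q, x])
      let r ← indefLeg q j P r
      match ← isFound u with
      | some u => do
        let u ← success (← mkTag (.leg q j) u)
        mkCons r u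
      | none => do
        let u ← viaIndef p P Q r
        mkCons r u
  | _ => .abort

/-- `restrict false i t`: the cut-free form of `σᵢ ; t`, for `t` whose domain is a sum.  Dually,
`restrict true i t` is the cut-free form of `t ; πᵢ`, for `t` whose codomain is a product. -/
def restrictBody (p i : Bool) (t : V) : Code V V := do
  let (l, x) ← root t
  match l with
  | .nul _ => return t
  | .leg q j => do
    let u ← callFn (.restrict p i) [x]
    mkTag (.leg q j) u
  | .tup q =>
    if q = p then component i x
    else do
      let (t₀, t₁) ← unCons x
      let u₀ ← callFn (.restrict p i) [t₀]
      let u₁ ← callFn (.restrict p i) [t₁]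
      mkTag₂ (.tup q) u₀ u₁
  | _ => .abort

/-- The type on which `leg p` acts. -/
def actedOn (p : Bool) (X A : V) : V := bif p then X else A

/-- The factor of `t : X → A` through `leg p i`, if there is one. -/
def factorOf (p i : Bool) (X A t : V) : Code V (Option V) := do
  let (_, u) ← unCons (← callFn (.factor p i) [actedOn p X A, actedOn (!p) X A, t])
  isFound u

/-- Recursive comparison of `f` and `g` after cancelling `leg p i` from terms `X → A`. -/
def compareUnder (p i : Bool) (X A f g : V) : Code V V := do
  if p then callFn .equivalent [← child i X, A, f, g]
  else callFn .equivalent [X, ← child i A, f, g]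

/-- Whether the coprojection (projection) `leg p i` of the annotated sum (product) `P` is monic
(epic): `σᵢ` fails to be monic iff its summand is copointed and the other one is pointed. -/
def cancellable (p i : Bool) (P : V) : Code V Bool := do
  let b ← pointed (← child i P)
  let c ← pointed (← child (!i) P)
  return !(b == p && c == !p)

/-- Comparison of definite terms `leg p i f'` and `g` (from a product to a sum) where `leg p i` is
cancellable. -/
def compareMixed (p i : Bool) (X A f' g : V) : Code V V := do
  match ← factorOf p i X A g with
  | some g' => compareUnder p i X A f' g'
  | none => answer false

/-- Comparison of the definite terms `f = leg p i f'` and `g = leg q j g'` from a product to a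
sum. -/
def compareDefinite (X A f g : V) : Code V V := do
  let (l, f') ← root f
  let (m, g') ← root g
  match l, m with
  | .leg p i, .leg q j =>
    if p = q then
      if i = j then
        if ← cancellable p i (actedOn p X A) then
          compareUnder p i X A f' g'
        else
          match ← factorOf (!p) false X A f, ← factorOf (!p) false X A g with
          | some f₁, some g₁ => compareUnder (!p) false X A f₁ g₁
          | _, _ =>
            match ← factorOf (!p) true X A f, ← factorOf (!p) true X A g with
            | some f₁, some g₁ => compareUnder (!p) true X A f₁ g₁
            | _, _ => compareUnder p i X A f' g'
      else answer false
    else if ← cancellable q j (actedOn q X A) then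
      compareMixed q j X A g' f
    else if ← cancellable p i (actedOn p X A) then
      compareMixed p i X A f' g
    else answer false
  | _, _ => .abort

/-- Comparison of terms from `1` or a product to `0` or a sum. -/
def compareCore (X A f g : V) : Code V V := do
  let r ← callFn .indef [X, A, f]
  let s ← callFn .indef [X, A, g]
  match ← isFound r, ← isFound s with
  | some c, some d =>
    if (← pointed X) = (← pointed A) then callFn .same [c, d]
    else answer true
  | none, none => compareDefinite X A f g
  | _, _ => answer false

/-- `equivalent X A f g`: whether `f, g : X → A` are equal. -/
def equivalentBody (X A f g : V) : Code V V := do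
  let (l, _) ← root X
  let (m, _) ← root A
  match l, m with
  | .unit false, _ => answer true
  | _, .unit true => answer true
  | .node false, _ => split false X A f g
  | _, .node true => split true X A f g
  | _, _ => compareCore X A f g
where
  /-- Componentwise comparison, out of a sum (`p = false`) or into a product (`p = true`). -/
  split (p : Bool) (X A f g : V) : Code V V := do
    let f₀ ← callFn (.restrict p false) [f]
    let g₀ ← callFn (.restrict p false) [g]
    match ← getLabel (← compareUnder (!p) false X A f₀ g₀) with
    | .bit true => do
      let f₁ ← callFn (.restrict p true) [f]
      let g₁ ← callFn (.restrict p true) [g]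
      compareUnder (!p) true X A f₁ g₁
    | _ => answer false

/-- `main A B t₁ t₂`: annotates the types and compares the terms. -/
def mainBody (A B t₁ t₂ : V) : Code V V := do
  let A ← callFn .annot [A]
  let B ← callFn .annot [B]
  callFn .equivalent [A, B, t₁, t₂]

/-- The decision procedure for equality of arrows in `ΣΠ(∅)`. -/
def procedure : Fn → List V → Code V V
  | .main, [A, B, t₁, t₂] => mainBody A B t₁ t₂
  | .annot, [A] => annotBody A
  | .same, [t, u] => sameBody t u
  | .indef, [X, A, t] => indefBody X A t
  | .factor p i, [P, Q, t] => factorBody p i P Q t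
  | .restrict p i, [t] => restrictBody p i t
  | .equivalent, [X, A, f, g] => equivalentBody X A f g
  | _, _ => .abort

end Procedure

end SP

/-! The proof first says what equality of arrows means for cut-free terms, then extracts from it the
facts on which the procedure relies, and finally runs the program with a clock.

Equality. Two cut-free terms represent the same arrow iff they are convertible (`Tm.Conv`):
componentwise out of a sum or into a product, always out of 0 or into 1, and otherwise by the
equivalence generated by conversion below the root and the permutation of σᵢ(πⱼ(h)) with πⱼ(σᵢ(h)).
Soundness is `Tm.Conv.arr_eqv`. For completeness, formal arrows act on terms by postcomposition
(`Arr.act`); provably equal arrows act equally up to conversion, and a term is recovered from the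
action of its arrow on the identity, as in the Yoneda lemma. Together these give `Tm.hom_eq_iff`.

Duality. `O p P Q` is the set of terms between `P` and `Q` on whose `P`-side the legs (coprojections
for `p = false`, projections for `p = true`) act. Each statement about legs is proved once for both
polarities, and `O.flip` exchanges legs and colegs.

Indefinite terms. `Tm.ind` computes the point or copoint through which a term factors, with a
placeholder for the disconnect. It is invariant under conversion (`Tm.Conv.ind_eq`), and equal
values force conversion (`O.conv_of_ind_eq`), so it decides equality of indefinite terms.

Definite terms. A predicate read off the root of a term that is constant along conversion steps of
definite terms separates non-convertible ones. With `O.FactorsAtRoot` this gives disjointness of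
distinct legs (`O.indefinite_of_conv_leg`) and the transfer of a factorization to the factor below a
coleg (`O.exists_conv_leg_of_coleg`); with `O.IsLegOf` it gives that cancellable legs are monic
(`O.conv_of_conv_leg`). When σᵢ is not cancellable, a definite f that is both σᵢ(f') and πⱼ(f₁) has
a common factor from the j-th factor of X to the i-th summand of A. That summand is copointed, hence
so is the factor, and πⱼ is cancellable. If f has no factorization through a projection, then no
permutation applies at its root, and σᵢ can be cancelled after all
(`conv_of_conv_leg_of_not_coleg`). If neither leg is cancellable in a mixed comparison, a common
factor would go from a pointed to a copointed type, so the answer is no.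

Time. `Code.Wp` is a weakest-precondition calculus with a step counter. One pass of restriction,
indefiniteness test or factorization costs a constant times the product of the two sizes. A
comparison does a bounded number of passes and then recurses at lower height, either once or into
two types whose sizes add up to less than the original; hence each unit of total height costs one
product of sizes (`eqBound_tup`, `computes_equivalent`). -/

namespace SP

/-! ## Polarised view of types and terms -/

/-- The component of index `i`. -/
abbrev sel {α : Type*} (i : Bool) (a b : α) : α := cond i b a

/-- The units: `0` is negative, `1` is positive. -/
def Ty.unit : Bool → Ty
  | false => .zero
  | true => .one

/-- The binary constructors: `+` is negative, `×` is positive. -/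
def Ty.node : Bool → Ty → Ty → Ty
  | false => .plus
  | true => .times

/-- Whether a type is pointed (`true`) or copointed (`false`). -/
def Ty.ptd : Ty → Bool
  | .zero => false
  | .one => true
  | .plus A B => A.ptd || B.ptd
  | .times A B => A.ptd && B.ptd

/-- The component of index `i` of a type of polarity `p`; other types are left unchanged. -/
def Ty.part (p i : Bool) : Ty → Ty
  | .zero => .zero
  | .one => .one
  | .plus A B => bif p then .plus A B else sel i A B
  | .times A B => bif p then sel i A B else .times A B

theorem Ty.size_pos (A : Ty) : 0 < A.size := by cases A <;> simp [Ty.size]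

theorem Ty.size_node (p : Bool) (A B : Ty) : (Ty.node p A B).size = 1 + A.size + B.size := by
  cases p <;> rfl

theorem Ty.size_sel (i : Bool) (A B : Ty) : (sel i A B).size ≤ A.size + B.size := by
  cases i <;> simp [sel]

/-- Case analysis on types relative to a polarity. -/
theorem Ty.pol_induction (p : Bool) {motive : Ty → Prop}
    (unit : motive (.unit p)) (counit : motive (.unit (!p)))
    (node : ∀ A B, (∀ i, motive (sel i A B)) → motive (.node p A B))
    (conode : ∀ A B, (∀ i, motive (sel i A B)) → motive (.node (!p) A B)) (A : Ty) : motive A := by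
  have key : ∀ {A B : Ty}, motive A → motive B → ∀ i, motive (sel i A B) := by
    intro A B hA hB i; cases i <;> assumption
  induction A with
  | zero => cases p <;> assumption
  | one => cases p <;> assumption
  | plus A B hA hB =>
    cases p
    · exact node A B (key hA hB)
    · exact conode A B (key hA hB)
  | times A B hA hB =>
    cases p
    · exact conode A B (key hA hB)
    · exact node A B (key hA hB)

theorem Ty.ptd_unit (p : Bool) : (Ty.unit p).ptd = p := by cases p <;> rfl

theorem Ty.ptd_node (p : Bool) (A B : Ty) :
    (Ty.node p A B).ptd = if A.ptd = p ∧ B.ptd = p then p else !p := by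
  cases p <;> cases hA : A.ptd <;> cases hB : B.ptd <;> simp [Ty.node, Ty.ptd, hA, hB]

/-- The coprojections. -/
def Tm.inj : (i : Bool) → {A B₀ B₁ : Ty} → Tm A (sel i B₀ B₁) → Tm A (.plus B₀ B₁)
  | false, _, _, _, t => .inj₀ t
  | true, _, _, _, t => .inj₁ t

/-- The projections. -/
def Tm.proj : (i : Bool) → {A₀ A₁ B : Ty} → Tm (sel i A₀ A₁) B → Tm (.times A₀ A₁) B
  | false, _, _, _, t => .proj₀ t
  | true, _, _, _, t => .proj₁ t

/-- `resL` for an arbitrary domain. -/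
def Tm.cutL (i : Bool) : {X A : Ty} → Tm X A → Tm (X.part false i) A
  | _, _, .cobang B => .cobang B
  | _, _, .bang _ => .bang _
  | _, _, .inj₀ t => .inj₀ (t.cutL i)
  | _, _, .inj₁ t => .inj₁ (t.cutL i)
  | _, _, .proj₀ t => .proj₀ t
  | _, _, .proj₁ t => .proj₁ t
  | _, _, .cotuple t u => match i with
    | false => t
    | true => u
  | _, _, .tuple t u => .tuple (t.cutL i) (u.cutL i)

/-- `resR` for an arbitrary codomain. -/
def Tm.cutR (i : Bool) : {X A : Ty} → Tm X A → Tm X (A.part true i)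
  | _, _, .cobang _ => .cobang _
  | _, _, .bang A => .bang A
  | _, _, .inj₀ t => .inj₀ t
  | _, _, .inj₁ t => .inj₁ t
  | _, _, .proj₀ t => .proj₀ (t.cutR i)
  | _, _, .proj₁ t => .proj₁ (t.cutR i)
  | _, _, .cotuple t u => .cotuple (t.cutR i) (u.cutR i)
  | _, _, .tuple t u => match i with
    | false => t
    | true => u

/-- Precomposition with the coprojection `σᵢ`. -/
def Tm.resL (i : Bool) {X₀ X₁ A : Ty} (t : Tm (.plus X₀ X₁) A) : Tm (sel i X₀ X₁) A := t.cutL i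

/-- Postcomposition with the projection `πᵢ`. -/
def Tm.resR (i : Bool) {X A₀ A₁ : Ty} (t : Tm X (.times A₀ A₁)) : Tm X (sel i A₀ A₁) := t.cutR i

/-! ## Conversion of cut-free terms -/

/-- One permuting conversion at the root, or a conversion below the root, for terms from a product
to a sum. -/
inductive Tm.Step {X₀ X₁ A₀ A₁ : Ty}
    (R : ∀ i, Tm (.times X₀ X₁) (sel i A₀ A₁) → Tm (.times X₀ X₁) (sel i A₀ A₁) → Prop)
    (S : ∀ j, Tm (sel j X₀ X₁) (.plus A₀ A₁) → Tm (sel j X₀ X₁) (.plus A₀ A₁) → Prop) :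
    Tm (.times X₀ X₁) (.plus A₀ A₁) → Tm (.times X₀ X₁) (.plus A₀ A₁) → Prop
  | inj (i) {f g} : R i f g → Step R S (.inj i f) (.inj i g)
  | proj (j) {f g} : S j f g → Step R S (.proj j f) (.proj j g)
  | swap (i j) (h : Tm (sel j X₀ X₁) (sel i A₀ A₁)) :
      Step R S (.inj i (.proj j h)) (.proj j (.inj i h))

/-- A conversion below the root, for terms into a sum. -/
inductive Tm.StepInj {X A₀ A₁ : Ty} (R : ∀ i, Tm X (sel i A₀ A₁) → Tm X (sel i A₀ A₁) → Prop) :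
    Tm X (.plus A₀ A₁) → Tm X (.plus A₀ A₁) → Prop
  | inj (i) {f g} : R i f g → StepInj R (.inj i f) (.inj i g)

/-- A conversion below the root, for terms out of a product. -/
inductive Tm.StepProj {X₀ X₁ A : Ty} (S : ∀ j, Tm (sel j X₀ X₁) A → Tm (sel j X₀ X₁) A → Prop) :
    Tm (.times X₀ X₁) A → Tm (.times X₀ X₁) A → Prop
  | proj (j) {f g} : S j f g → StepProj S (.proj j f) (.proj j g)

/-- Equality of cut-free terms up to permuting conversions. -/
def Tm.Conv : (X A : Ty) → Tm X A → Tm X A → Prop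
  | .zero, _ => fun _ _ => True
  | .plus X₀ X₁, A => fun f g => ∀ i, Conv (sel i X₀ X₁) A (f.resL i) (g.resL i)
  | .one, .one => fun _ _ => True
  | .times _ _, .one => fun _ _ => True
  | .one, .times A₀ A₁ => fun f g => ∀ i, Conv .one (sel i A₀ A₁) (f.resR i) (g.resR i)
  | .times X₀ X₁, .times A₀ A₁ => fun f g =>
      ∀ i, Conv (.times X₀ X₁) (sel i A₀ A₁) (f.resR i) (g.resR i)
  | .one, .zero => fun _ _ => True
  | .one, .plus A₀ A₁ => Relation.EqvGen (StepInj fun i => Conv .one (sel i A₀ A₁))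
  | .times X₀ X₁, .zero => Relation.EqvGen (StepProj fun j => Conv (sel j X₀ X₁) .zero)
  | .times X₀ X₁, .plus A₀ A₁ => Relation.EqvGen
      (Step (fun i => Conv (.times X₀ X₁) (sel i A₀ A₁)) fun j => Conv (sel j X₀ X₁) (.plus A₀ A₁))
termination_by X A => X.size + A.size
decreasing_by
  all_goals (try cases i) <;> (try cases j) <;> simp only [sel, cond, Ty.size] <;> omega

namespace Tm

/-- At units the relation is total, at the remaining base cases it is a generated equivalence, and
elsewhere it is pulled back from conversions at types of smaller total size. -/
theorem Conv.equivalence (X A : Ty) : Equivalence (Conv X A) := by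
  induction hn : X.size + A.size using Nat.strong_induction_on generalizing X A with
  | _ n ih =>
  subst hn
  have gen : ∀ {α : Type} (r : α → α → Prop), Equivalence (Relation.EqvGen r) :=
    fun r => Relation.EqvGen.is_equivalence r
  have all : ∀ {α : Type} (β : Bool → Type) (R : ∀ i, β i → β i → Prop) (F : ∀ i, α → β i),
      (∀ i, Equivalence (R i)) → Equivalence fun f g => ∀ i, R i (F i f) (F i g) :=
    fun β R F h => ⟨fun f i => (h i).refl _, fun k i => (h i).symm (k i),
      fun k l i => (h i).trans (k i) (l i)⟩
  have tr : ∀ {α : Type}, Equivalence fun _ _ : α => True :=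
    ⟨fun _ => trivial, fun _ => trivial, fun _ _ => trivial⟩
  rcases X with _ | _ | ⟨X₀, X₁⟩ | ⟨X₀, X₁⟩
  · unfold Conv; exact tr
  · rcases A with _ | _ | ⟨A₀, A₁⟩ | ⟨A₀, A₁⟩ <;> unfold Conv
    · exact tr
    · exact tr
    · exact gen _
    · exact all _ (fun i => Conv .one (sel i A₀ A₁)) (fun i f => Tm.resR i f) fun i => ih _ (by
        cases i <;> simp only [sel, cond, Ty.size] <;> omega) _ _ rfl
  · unfold Conv
    exact all _ (fun i => Conv (sel i X₀ X₁) A) (fun i f => Tm.resL i f) fun i => ih _ (by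
        cases i <;> simp only [sel, cond, Ty.size] <;> omega) _ _ rfl
  · rcases A with _ | _ | ⟨A₀, A₁⟩ | ⟨A₀, A₁⟩ <;> unfold Conv
    · exact gen _
    · exact tr
    · exact gen _
    · exact all _ (fun i => Conv (.times X₀ X₁) (sel i A₀ A₁)) (fun i f => Tm.resR i f)
        fun i => ih _ (by cases i <;> simp only [sel, cond, Ty.size] <;> omega) _ _ rfl

theorem Conv.refl {X A : Ty} (f : Tm X A) : Conv X A f f := (Conv.equivalence X A).refl f

theorem Conv.symm {X A : Ty} {f g : Tm X A} (h : Conv X A f g) : Conv X A g f :=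
  (Conv.equivalence X A).symm h

theorem Conv.trans {X A : Ty} {f g h : Tm X A} (k : Conv X A f g) (l : Conv X A g h) :
    Conv X A f h :=
  (Conv.equivalence X A).trans k l

/-- `Conv` takes a sum domain apart before it looks at the codomain. This commutation removes the
asymmetry. -/
theorem resL_resR (i j : Bool) {X₀ X₁ A₀ A₁ : Ty} (f : Tm (.plus X₀ X₁) (.times A₀ A₁)) :
    (f.resR j).resL i = (f.resL i).resR j := by
  cases f <;> cases i <;> cases j <;> rfl

theorem conv_zero {A : Ty} (f g : Tm .zero A) : Conv .zero A f g := by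
  unfold Conv; trivial

theorem conv_plus {X₀ X₁ A : Ty} {f g : Tm (.plus X₀ X₁) A} :
    Conv (.plus X₀ X₁) A f g ↔ ∀ i, Conv (sel i X₀ X₁) A (f.resL i) (g.resL i) := by
  conv_lhs => unfold Conv

/-- The codomain 1 becomes visible to `Conv` only after every sum in the domain has been split,
hence the induction on the domain. -/
theorem conv_one {X : Ty} (f g : Tm X .one) : Conv X .one f g := by
  induction X with
  | zero => unfold Conv; trivial
  | one => unfold Conv; trivial
  | times => unfold Conv; trivial
  | plus X₀ X₁ h₀ h₁ =>
    rw [conv_plus]; rintro (_ | _)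
    · exact h₀ _ _
    · exact h₁ _ _

/-- Extensionality for products holds by definition only when the domain is 1 or a product. For a
sum domain the two families of components are interchanged by `resL_resR`. -/
theorem conv_times {X A₀ A₁ : Ty} {f g : Tm X (.times A₀ A₁)} :
    Conv X (.times A₀ A₁) f g ↔ ∀ i, Conv X (sel i A₀ A₁) (f.resR i) (g.resR i) := by
  induction X with
  | zero => exact ⟨fun _ _ => conv_zero _ _, fun _ => conv_zero _ _⟩
  | one => conv_lhs => unfold Conv
  | times => conv_lhs => unfold Conv
  | plus X₀ X₁ h₀ h₁ =>
    rw [conv_plus]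
    constructor
    · intro h i
      rw [conv_plus]
      intro j
      rw [resL_resR, resL_resR]
      cases j
      · exact h₀.1 (h false) i
      · exact h₁.1 (h true) i
    · rintro h (_ | _)
      · refine h₀.2 fun i => ?_
        have := conv_plus.1 (h i) false
        rwa [resL_resR, resL_resR] at this
      · refine h₁.2 fun i => ?_
        have := conv_plus.1 (h i) true
        rwa [resL_resR, resL_resR] at this

theorem resL_inj (i k : Bool) {X₀ X₁ A₀ A₁ : Ty} (f : Tm (.plus X₀ X₁) (sel k A₀ A₁)) :
    (inj k f).resL i = inj k (f.resL i) := by cases k <;> rfl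

theorem resR_proj (i k : Bool) {X₀ X₁ A₀ A₁ : Ty} (f : Tm (sel k X₀ X₁) (.times A₀ A₁)) :
    (proj k f).resR i = proj k (f.resR i) := by cases k <;> rfl

/-- A generator of conversion when the domain is 1 or a product; for a sum domain the coprojection
commutes with restriction to the summands. -/
theorem Conv.inj (i : Bool) {X A₀ A₁ : Ty} {f g : Tm X (sel i A₀ A₁)}
    (h : Conv X (sel i A₀ A₁) f g) : Conv X (.plus A₀ A₁) (inj i f) (inj i g) := by
  induction X with
  | zero => exact conv_zero _ _
  | one => unfold Conv; exact .rel _ _ (.inj i h)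
  | times X₀ X₁ _ _ => unfold Conv; exact .rel _ _ (.inj i h)
  | plus X₀ X₁ h₀ h₁ =>
    rw [conv_plus] at h ⊢
    intro j
    rw [resL_inj, resL_inj]
    cases j
    · exact h₀ (h false)
    · exact h₁ (h true)

theorem Conv.proj (j : Bool) {X₀ X₁ A : Ty} {f g : Tm (sel j X₀ X₁) A}
    (h : Conv (sel j X₀ X₁) A f g) : Conv (.times X₀ X₁) A (proj j f) (proj j g) := by
  induction A with
  | one => exact conv_one _ _
  | zero => unfold Conv; exact .rel _ _ (.proj j h)
  | plus A₀ A₁ _ _ => unfold Conv; exact .rel _ _ (.proj j h)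
  | times A₀ A₁ h₀ h₁ =>
    rw [conv_times] at h ⊢
    intro i
    rw [resR_proj, resR_proj]
    cases i
    · exact h₀ (h false)
    · exact h₁ (h true)

theorem Conv.swap (i j : Bool) {X₀ X₁ A₀ A₁ : Ty} (h : Tm (sel j X₀ X₁) (sel i A₀ A₁)) :
    Conv (.times X₀ X₁) (.plus A₀ A₁) (Tm.inj i (Tm.proj j h)) (Tm.proj j (Tm.inj i h)) := by
  unfold Conv; exact .rel _ _ (.swap i j h)

theorem Conv.cotuple {X₀ X₁ A : Ty} {f f' : Tm X₀ A} {g g' : Tm X₁ A}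
    (h : Conv X₀ A f f') (k : Conv X₁ A g g') :
    Conv (.plus X₀ X₁) A (.cotuple f g) (.cotuple f' g') := by
  rw [conv_plus]; rintro (_ | _)
  · exact h
  · exact k

theorem Conv.tuple {X A₀ A₁ : Ty} {f f' : Tm X A₀} {g g' : Tm X A₁}
    (h : Conv X A₀ f f') (k : Conv X A₁ g g') :
    Conv X (.times A₀ A₁) (.tuple f g) (.tuple f' g') := by
  rw [conv_times]; rintro (_ | _)
  · exact h
  · exact k

/-- What is constant along conversion steps from a product to a sum is constant along conversion. -/
theorem Conv.core_eq {X₀ X₁ A₀ A₁ : Ty} {β : Sort*} (φ : Tm (.times X₀ X₁) (.plus A₀ A₁) → β)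
    (hinj : ∀ i f g, Conv _ _ f g → φ (Tm.inj i f) = φ (Tm.inj i g))
    (hproj : ∀ j f g, Conv _ _ f g → φ (Tm.proj j f) = φ (Tm.proj j g))
    (hswap : ∀ i j h, φ (Tm.inj i (Tm.proj j h)) = φ (Tm.proj j (Tm.inj i h)))
    {f g : Tm (.times X₀ X₁) (.plus A₀ A₁)} (h : Conv _ _ f g) : φ f = φ g := by
  unfold Conv at h
  induction h with
  | rel f g h =>
    cases h with
    | inj i h => exact hinj _ _ _ h
    | proj j h => exact hproj _ _ _ h
    | swap i j h => exact hswap _ _ _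
  | refl => rfl
  | symm _ _ _ ih => exact ih.symm
  | trans _ _ _ _ _ ih₁ ih₂ => exact ih₁.trans ih₂

theorem Conv.one_plus_eq {A₀ A₁ : Ty} {β : Sort*} (φ : Tm .one (.plus A₀ A₁) → β)
    (hinj : ∀ i f g, Conv _ _ f g → φ (Tm.inj i f) = φ (Tm.inj i g))
    {f g : Tm .one (.plus A₀ A₁)} (h : Conv _ _ f g) : φ f = φ g := by
  unfold Conv at h
  induction h with
  | rel f g h => cases h with | inj i h => exact hinj _ _ _ h
  | refl => rfl
  | symm _ _ _ ih => exact ih.symm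
  | trans _ _ _ _ _ ih₁ ih₂ => exact ih₁.trans ih₂

theorem Conv.times_zero_eq {X₀ X₁ : Ty} {β : Sort*} (φ : Tm (.times X₀ X₁) .zero → β)
    (hproj : ∀ j f g, Conv _ _ f g → φ (Tm.proj j f) = φ (Tm.proj j g))
    {f g : Tm (.times X₀ X₁) .zero} (h : Conv _ _ f g) : φ f = φ g := by
  unfold Conv at h
  induction h with
  | rel f g h => cases h with | proj i h => exact hproj _ _ _ h
  | refl => rfl
  | symm _ _ _ ih => exact ih.symm
  | trans _ _ _ _ _ ih₁ ih₂ => exact ih₁.trans ih₂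

end Tm

/-! ## Conversion is equality in the initial sum-product category -/

/-- The coprojections, indexed. -/
def Arr.inj : (i : Bool) → (A B : Ty) → Arr (sel i A B) (.plus A B)
  | false, A, B => .inl A B
  | true, A, B => .inr A B

/-- The projections, indexed. -/
def Arr.proj : (i : Bool) → (A B : Ty) → Arr (.times A B) (sel i A B)
  | false, A, B => .fst A B
  | true, A, B => .snd A B

namespace Arr.Eqv

theorem plus_ext {A B C : Ty} {f g : Arr (.plus A B) C}
    (h : ∀ i, Eqv ((Arr.inj i A B).comp f) ((Arr.inj i A B).comp g)) : Eqv f g :=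
  (case_uniq f).trans ((case_congr (h false) (h true)).trans (case_uniq g).symm)

theorem times_ext {A B C : Ty} {f g : Arr C (.times A B)}
    (h : ∀ i, Eqv (f.comp (Arr.proj i A B)) (g.comp (Arr.proj i A B))) : Eqv f g :=
  (pair_uniq f).trans ((pair_congr (h false) (h true)).trans (pair_uniq g).symm)

end Arr.Eqv

namespace Tm

open Arr.Eqv in
theorem arr_inj (i : Bool) {X A₀ A₁ : Ty} (t : Tm X (sel i A₀ A₁)) :
    Arr.Eqv (inj i t).arr (t.arr.comp (Arr.inj i A₀ A₁)) := by cases i <;> exact refl _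

open Arr.Eqv in
theorem arr_proj (i : Bool) {X₀ X₁ A : Ty} (t : Tm (sel i X₀ X₁) A) :
    Arr.Eqv (proj i t).arr ((Arr.proj i X₀ X₁).comp t.arr) := by cases i <;> exact refl _

-- Precomposition with a coprojection passes through the constructors that act on the codomain until
-- it meets a cotuple, where it is a β-law. Induction on the codomain suffices, as only constructors
-- that shrink it are crossed.
open Arr.Eqv in
theorem arr_resL (i : Bool) {X₀ X₁ A : Ty} (t : Tm (.plus X₀ X₁) A) :
    Arr.Eqv (t.resL i).arr ((Arr.inj i X₀ X₁).comp t.arr) := by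
  induction A with
  | zero => cases t; cases i <;> exact (by first | exact (inl_case _ _).symm | exact (inr_case _ _).symm)
  | one => exact (bang_uniq _).trans (bang_uniq _).symm
  | plus A₀ A₁ h₀ h₁ =>
    cases t with
    | inj₀ t => exact (comp_congr (h₀ t) (refl _)).trans (assoc _ _ _)
    | inj₁ t => exact (comp_congr (h₁ t) (refl _)).trans (assoc _ _ _)
    | cotuple t u => cases i <;> first | exact (inl_case _ _).symm | exact (inr_case _ _).symm
  | times A₀ A₁ h₀ h₁ =>
    cases t with
    | cotuple t u => cases i <;> first | exact (inl_case _ _).symm | exact (inr_case _ _).symm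
    | tuple t u =>
      refine times_ext ?_
      rintro (_ | _)
      · exact (pair_fst _ _).trans ((h₀ t).trans
          ((comp_congr (refl _) (pair_fst _ _).symm).trans (assoc _ _ _).symm))
      · exact (pair_snd _ _).trans ((h₁ u).trans
          ((comp_congr (refl _) (pair_snd _ _).symm).trans (assoc _ _ _).symm))

open Arr.Eqv in
theorem arr_resR (i : Bool) {X A₀ A₁ : Ty} (t : Tm X (.times A₀ A₁)) :
    Arr.Eqv (t.resR i).arr (t.arr.comp (Arr.proj i A₀ A₁)) := by
  induction X with
  | zero => exact (cobang_uniq _).trans (cobang_uniq _).symm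
  | one => cases t; cases i <;> first | exact (pair_fst _ _).symm | exact (pair_snd _ _).symm
  | times X₀ X₁ h₀ h₁ =>
    cases t with
    | proj₀ t => exact (comp_congr (refl _) (h₀ t)).trans (assoc _ _ _).symm
    | proj₁ t => exact (comp_congr (refl _) (h₁ t)).trans (assoc _ _ _).symm
    | tuple t u => cases i <;> first | exact (pair_fst _ _).symm | exact (pair_snd _ _).symm
  | plus X₀ X₁ h₀ h₁ =>
    cases t with
    | tuple t u => cases i <;> first | exact (pair_fst _ _).symm | exact (pair_snd _ _).symm
    | cotuple t u =>
      refine plus_ext ?_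
      rintro (_ | _)
      · exact (inl_case _ _).trans ((h₀ t).trans
          ((comp_congr (inl_case _ _).symm (refl _)).trans (assoc _ _ _)))
      · exact (inr_case _ _).trans ((h₁ u).trans
          ((comp_congr (inr_case _ _).symm (refl _)).trans (assoc _ _ _)))

open Arr.Eqv in
/-- Convertible terms represent the same arrow. -/
theorem Conv.arr_eqv {X A : Ty} {f g : Tm X A} (h : Conv X A f g) : Arr.Eqv f.arr g.arr := by
  induction hn : X.size + A.size using Nat.strong_induction_on generalizing X A with
  | _ n ih =>
  subst hn
  have hL : ∀ {X₀ X₁ A : Ty} (i : Bool),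
      (sel i X₀ X₁).size + A.size < (Ty.plus X₀ X₁).size + A.size := by
    intro X₀ X₁ A i; cases i <;> simp only [sel, cond, Ty.size] <;> omega
  have hR : ∀ {X A₀ A₁ : Ty} (i : Bool),
      X.size + (sel i A₀ A₁).size < X.size + (Ty.times A₀ A₁).size := by
    intro X₀ X₁ A i; cases i <;> simp only [sel, cond, Ty.size] <;> omega
  have plus : ∀ {X₀ X₁ : Ty}, X = .plus X₀ X₁ → Arr.Eqv f.arr g.arr := by
    rintro X₀ X₁ rfl
    exact plus_ext fun i => (arr_resL i f).symm.trans ((ih _ (hL i) (conv_plus.1 h i) rfl).trans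
      (arr_resL i g))
  have times : ∀ {A₀ A₁ : Ty}, A = .times A₀ A₁ → Arr.Eqv f.arr g.arr := by
    rintro A₀ A₁ rfl
    exact times_ext fun i => (arr_resR i f).symm.trans ((ih _ (hR i) (conv_times.1 h i) rfl).trans
      (arr_resR i g))
  have hproj : ∀ {X₀ X₁ : Ty}, X = .times X₀ X₁ → ∀ j (f g : Tm (sel j X₀ X₁) A),
      Conv _ _ f g → Arr.Eqv (Tm.proj j f).arr (Tm.proj j g).arr := by
    rintro X₀ X₁ rfl j f g h
    exact (arr_proj j f).trans ((comp_congr (Arr.Eqv.refl _) (ih _ (hL j) h rfl)).trans (arr_proj j g).symm)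
  have hinj : ∀ {A₀ A₁ : Ty}, A = .plus A₀ A₁ → ∀ j (f g : Tm X (sel j A₀ A₁)),
      Conv _ _ f g → Arr.Eqv (Tm.inj j f).arr (Tm.inj j g).arr := by
    rintro A₀ A₁ rfl j f g h
    exact (arr_inj j f).trans ((comp_congr (ih _ (hR j) h rfl) (Arr.Eqv.refl _)).trans (arr_inj j g).symm)
  -- The elimination lemmas for conversion speak of functions with equal values, so provable
  -- equality is turned into equality in the hom quotient and back.
  have sound : ∀ {f g : Tm X A}, Arr.Eqv f.arr g.arr →
      (Quotient.mk (Arr.setoid X A) f.arr) = Quotient.mk _ g.arr := fun h => Quotient.sound h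
  have exact' : ∀ {f g : Tm X A}, (Quotient.mk (Arr.setoid X A) f.arr) = Quotient.mk _ g.arr →
      Arr.Eqv f.arr g.arr := fun h => Quotient.exact h
  rcases X with _ | _ | ⟨X₀, X₁⟩ | ⟨X₀, X₁⟩
  · exact (cobang_uniq _).trans (cobang_uniq _).symm
  · rcases A with _ | _ | ⟨A₀, A₁⟩ | ⟨A₀, A₁⟩
    · cases f
    · exact (bang_uniq _).trans (bang_uniq _).symm
    · exact exact' (Conv.one_plus_eq (fun f => Quotient.mk (Arr.setoid _ _) f.arr)
        (fun i f g h => sound (hinj rfl i f g h)) h)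
    · exact times rfl
  · exact plus rfl
  · rcases A with _ | _ | ⟨A₀, A₁⟩ | ⟨A₀, A₁⟩
    · exact exact' (Conv.times_zero_eq (fun f => Quotient.mk (Arr.setoid _ _) f.arr)
        (fun i f g h => sound (hproj rfl i f g h)) h)
    · exact (bang_uniq _).trans (bang_uniq _).symm
    · refine exact' (Conv.core_eq (fun f => Quotient.mk (Arr.setoid _ _) f.arr)
        (fun i f g h => sound (hinj rfl i f g h)) (fun i f g h => sound (hproj rfl i f g h)) ?_ h)
      intro i j h
      refine sound ?_
      exact (arr_inj i _).trans ((comp_congr (arr_proj j h) (Arr.Eqv.refl _)).trans ((assoc _ _ _).trans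
        ((comp_congr (Arr.Eqv.refl _) (arr_inj i h).symm).trans (arr_proj j _).symm)))
    · exact times rfl

/-! ### The action of formal arrows on terms -/

/-- Families of maps that commute with everything that acts on the domain. -/
structure Natural {B C : Ty} (F : ∀ X, Tm X B → Tm X C) : Prop where
  congr : ∀ {X} {u v : Tm X B}, Conv X B u v → Conv X C (F X u) (F X v)
  resL : ∀ {X₀ X₁} i (u : Tm (.plus X₀ X₁) B), Conv _ C ((F _ u).resL i) (F _ (u.resL i))
  proj : ∀ {X₀ X₁} j (u : Tm (sel j X₀ X₁) B), Conv _ C (F _ (Tm.proj j u)) (Tm.proj j (F _ u))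

/-- The action of `0 → C`. -/
def absurd {C : Ty} : (X : Ty) → Tm X .zero → Tm X C
  | .zero, _ => .cobang C
  | .one, t => nomatch t
  | .plus X₀ X₁, t => .cotuple (absurd X₀ (t.resL false)) (absurd X₁ (t.resL true))
  | .times X₀ _, .proj₀ t => .proj₀ (absurd X₀ t)
  | .times _ X₁, .proj₁ t => .proj₁ (absurd X₁ t)

/-- The action of a cotuple. -/
def elim {A B C : Ty} (F : ∀ X, Tm X A → Tm X C) (G : ∀ X, Tm X B → Tm X C) :
    (X : Ty) → Tm X (.plus A B) → Tm X C
  | .zero, _ => .cobang C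
  | .one, .inj₀ t => F _ t
  | .one, .inj₁ t => G _ t
  | .plus X₀ X₁, t => .cotuple (elim F G X₀ (t.resL false)) (elim F G X₁ (t.resL true))
  | .times _ _, .inj₀ t => F _ t
  | .times _ _, .inj₁ t => G _ t
  | .times X₀ _, .proj₀ t => .proj₀ (elim F G X₀ t)
  | .times _ X₁, .proj₁ t => .proj₁ (elim F G X₁ t)

theorem Natural.absurd {C : Ty} : Natural (Tm.absurd (C := C)) where
  congr {X u v} h := by
    induction X with
    | zero => exact conv_zero _ _
    | one => cases u
    | plus X₀ X₁ h₀ h₁ => exact .cotuple (h₀ (conv_plus.1 h false)) (h₁ (conv_plus.1 h true))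
    | times X₀ X₁ h₀ h₁ =>
      -- Conversion in the target becomes equality in the quotient by `Conv`, as the elimination
      -- lemma requires.
      refine (Conv.equivalence _ _).quot_mk_eq_iff _ _ |>.1 (Conv.times_zero_eq (fun f => Quot.mk (Conv _ C) (Tm.absurd _ f)) ?_ h)
      rintro (_ | _) f g h <;> refine Quot.sound ?_
      · exact .proj false (h₀ h)
      · exact .proj true (h₁ h)
  resL i u := by cases i <;> exact .refl _
  proj j u := by cases j <;> exact .refl _

/-- The β-law for the action of a cotuple. For a sum domain `elim` restricts before it inspects the
term, so `F` must commute with restriction. -/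
theorem elim_inj₀ {A B C : Ty} {F : ∀ X, Tm X A → Tm X C} (G : ∀ X, Tm X B → Tm X C)
    (hF : Natural F) {X : Ty} (t : Tm X A) : Conv X C (elim F G X (.inj₀ t)) (F X t) := by
  induction X with
  | zero => exact conv_zero _ _
  | one => exact .refl _
  | times => exact .refl _
  | plus X₀ X₁ h₀ h₁ =>
    rw [conv_plus]; rintro (_ | _)
    · exact (h₀ (t.resL false)).trans (hF.resL false t).symm
    · exact (h₁ (t.resL true)).trans (hF.resL true t).symm

theorem elim_inj₁ {A B C : Ty} (F : ∀ X, Tm X A → Tm X C) {G : ∀ X, Tm X B → Tm X C}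
    (hG : Natural G) {X : Ty} (t : Tm X B) : Conv X C (elim F G X (.inj₁ t)) (G X t) := by
  induction X with
  | zero => exact conv_zero _ _
  | one => exact .refl _
  | times => exact .refl _
  | plus X₀ X₁ h₀ h₁ =>
    rw [conv_plus]; rintro (_ | _)
    · exact (h₀ (t.resL false)).trans (hG.resL false t).symm
    · exact (h₁ (t.resL true)).trans (hG.resL true t).symm

/-- Respect for the permutation of a coprojection with a projection is exactly the compatibility of
`F` and `G` with projections. -/
theorem Natural.elim {A B C : Ty} {F : ∀ X, Tm X A → Tm X C} {G : ∀ X, Tm X B → Tm X C}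
    (hF : Natural F) (hG : Natural G) : Natural (Tm.elim F G) where
  congr {X u v} h := by
    induction X with
    | zero => exact conv_zero _ _
    | one =>
      refine (Conv.equivalence _ _).quot_mk_eq_iff _ _ |>.1 (Conv.one_plus_eq (fun f => Quot.mk (Conv _ C) (Tm.elim F G _ f)) ?_ h)
      rintro (_ | _) f g h <;> refine Quot.sound ?_
      · exact hF.congr h
      · exact hG.congr h
    | plus X₀ X₁ h₀ h₁ => exact .cotuple (h₀ (conv_plus.1 h false)) (h₁ (conv_plus.1 h true))
    | times X₀ X₁ h₀ h₁ =>
      refine (Conv.equivalence _ _).quot_mk_eq_iff _ _ |>.1 (Conv.core_eq (fun f => Quot.mk (Conv _ C) (Tm.elim F G _ f)) ?_ ?_ ?_ h)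
      · rintro (_ | _) f g h <;> refine Quot.sound ?_
        · exact hF.congr h
        · exact hG.congr h
      · rintro (_ | _) f g h <;> refine Quot.sound ?_
        · exact .proj false (h₀ h)
        · exact .proj true (h₁ h)
      · rintro (_ | _) (_ | _) h <;> refine Quot.sound ?_
        · exact (hF.proj false h).trans (.proj false (elim_inj₀ G hF h).symm)
        · exact (hF.proj true h).trans (.proj true (elim_inj₀ G hF h).symm)
        · exact (hG.proj false h).trans (.proj false (elim_inj₁ F hG h).symm)
        · exact (hG.proj true h).trans (.proj true (elim_inj₁ F hG h).symm)
  resL i u := by cases i <;> exact .refl _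
  proj j u := by cases j <;> exact .refl _

theorem Natural.inj (i : Bool) (A₀ A₁ : Ty) :
    Natural (fun X (u : Tm X (sel i A₀ A₁)) => (Tm.inj i u : Tm X (.plus A₀ A₁))) where
  congr h := h.inj i
  resL j u := by rw [resL_inj]; exact .refl _
  proj j u := .swap i j u

theorem Natural.resR (i : Bool) (A₀ A₁ : Ty) :
    Natural (fun X (u : Tm X (.times A₀ A₁)) => u.resR i) where
  congr h := conv_times.1 h i
  resL j u := by rw [resL_resR]; exact .refl _
  proj j u := by rw [resR_proj]; exact .refl _

theorem Natural.tuple {B A₀ A₁ : Ty} {F : ∀ X, Tm X B → Tm X A₀} {G : ∀ X, Tm X B → Tm X A₁}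
    (hF : Natural F) (hG : Natural G) : Natural (fun X u => Tm.tuple (F X u) (G X u)) where
  congr h := .tuple (hF.congr h) (hG.congr h)
  resL i u := by
    rw [conv_times]; rintro (_ | _)
    · exact hF.resL i u
    · exact hG.resL i u
  proj i u := by
    rw [conv_times]; rintro (_ | _) <;> rw [resR_proj]
    · exact hF.proj i u
    · exact hG.proj i u

end Tm

/-- The action of formal arrows on terms by postcomposition. -/
def Arr.act : {B C : Ty} → Arr B C → (X : Ty) → Tm X B → Tm X C
  | _, _, .id _, _, u => u
  | _, _, .comp f g, X, u => g.act X (f.act X u)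
  | _, _, .cobang _, X, u => Tm.absurd X u
  | _, _, .bang _, X, _ => .bang X
  | _, _, .inl _ _, _, u => .inj₀ u
  | _, _, .inr _ _, _, u => .inj₁ u
  | _, _, .case f g, X, u => Tm.elim f.act g.act X u
  | _, _, .fst _ _, _, u => u.resR false
  | _, _, .snd _ _, _, u => u.resR true
  | _, _, .pair f g, X, u => .tuple (f.act X u) (g.act X u)

open Tm

/-- Naturality in the domain supplies what the congruence and uniqueness laws need in `Arr.Eqv.act`.
-/
theorem Arr.act_natural {B C : Ty} (f : Arr B C) : Natural f.act := by
  induction f with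
  | id => exact ⟨fun h => h, fun _ _ => .refl _, fun _ _ => .refl _⟩
  | comp f g hf hg => exact ⟨fun h => hg.congr (hf.congr h),
      fun i u => (hg.resL i _).trans (hg.congr (hf.resL i u)),
      fun i u => (hg.congr (hf.proj i u)).trans (hg.proj i _)⟩
  | cobang => exact .absurd
  | bang => exact ⟨fun _ => conv_one _ _, fun _ _ => conv_one _ _, fun _ _ => conv_one _ _⟩
  | inl A B => exact .inj false A B
  | inr A B => exact .inj true A B
  | case f g hf hg => exact .elim hf hg
  | fst A B => exact .resR false A B
  | snd A B => exact .resR true A B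
  | pair f g hf hg => exact .tuple hf hg

/-- Terms modulo conversion form a model of the equational theory. The laws for 0 and + go by
induction on the domain, along which `absurd` and `elim` recurse; those for 1 and × are immediate
from the conversion rules. -/
theorem Arr.Eqv.act {B C : Ty} {f g : Arr B C} (h : Arr.Eqv f g) :
    ∀ {X : Ty} (u : Tm X B), Conv X C (f.act X u) (g.act X u) := by
  induction h with
  | refl => exact fun _ => .refl _
  | symm _ ih => exact fun u => (ih u).symm
  | trans _ _ ih₁ ih₂ => exact fun u => (ih₁ u).trans (ih₂ u)
  | comp_congr _ _ ih₁ ih₂ => exact fun u => ((Arr.act_natural _).congr (ih₁ u)).trans (ih₂ _)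
  | case_congr _ _ ih₁ ih₂ =>
    intro X u
    induction X with
    | zero => exact conv_zero _ _
    | one => cases u with
      | inj₀ u => exact ih₁ u
      | inj₁ u => exact ih₂ u
    | plus X₀ X₁ h₀ h₁ => exact .cotuple (h₀ _) (h₁ _)
    | times X₀ X₁ h₀ h₁ => cases u with
      | inj₀ u => exact ih₁ u
      | inj₁ u => exact ih₂ u
      | proj₀ u => exact .proj false (h₀ u)
      | proj₁ u => exact .proj true (h₁ u)
  | pair_congr _ _ ih₁ ih₂ => exact fun u => .tuple (ih₁ u) (ih₂ u)
  | id_comp => exact fun _ => .refl _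
  | comp_id => exact fun _ => .refl _
  | assoc => exact fun _ => .refl _
  | cobang_uniq f =>
    intro X u
    induction X with
    | zero => exact conv_zero _ _
    | one => cases u
    | plus X₀ X₁ h₀ h₁ =>
      rw [conv_plus]; rintro (_ | _)
      · exact ((Arr.act_natural f).resL false u).trans (h₀ _)
      · exact ((Arr.act_natural f).resL true u).trans (h₁ _)
    | times X₀ X₁ h₀ h₁ => cases u with
      | proj₀ u => exact ((Arr.act_natural f).proj false u).trans (.proj false (h₀ u))
      | proj₁ u => exact ((Arr.act_natural f).proj true u).trans (.proj true (h₁ u))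
  | bang_uniq => exact fun _ => conv_one _ _
  | inl_case f g => exact fun u => elim_inj₀ _ (Arr.act_natural f) u
  | inr_case f g => exact fun u => elim_inj₁ _ (Arr.act_natural g) u
  | case_uniq f =>
    intro X u
    induction X with
    | zero => exact conv_zero _ _
    | one => cases u <;> exact .refl _
    | plus X₀ X₁ h₀ h₁ =>
      rw [conv_plus]; rintro (_ | _)
      · exact ((Arr.act_natural f).resL false u).trans (h₀ _)
      · exact ((Arr.act_natural f).resL true u).trans (h₁ _)
    | times X₀ X₁ h₀ h₁ => cases u with
      | inj₀ u => exact .refl _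
      | inj₁ u => exact .refl _
      | proj₀ u => exact ((Arr.act_natural f).proj false u).trans (.proj false (h₀ u))
      | proj₁ u => exact ((Arr.act_natural f).proj true u).trans (.proj true (h₁ u))
  | pair_fst => exact fun _ => .refl _
  | pair_snd => exact fun _ => .refl _
  | pair_uniq f =>
    intro X u
    rw [conv_times]; rintro (_ | _) <;> exact .refl _

/-- The identity as a cut-free term. -/
def Tm.ident : (A : Ty) → Tm A A
  | .zero => .cobang _
  | .one => .bang _
  | .plus A B => .cotuple (.inj₀ (ident A)) (.inj₁ (ident B))
  | .times A B => .tuple (.proj₀ (ident A)) (.proj₁ (ident B))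

/-- The Yoneda step: the action on the identity determines the term, so the interpretation of terms
as arrows is faithful up to conversion. -/
theorem Tm.act_ident {A B : Ty} (t : Tm A B) : Conv A B (t.arr.act A (Tm.ident A)) t := by
  induction t with
  | cobang => exact conv_zero _ _
  | bang => exact conv_one _ _
  | inj₀ t ih => exact ih.inj false
  | inj₁ t ih => exact ih.inj true
  | proj₀ t ih => exact ((Arr.act_natural t.arr).proj false _).trans (ih.proj false)
  | proj₁ t ih => exact ((Arr.act_natural t.arr).proj true _).trans (ih.proj true)
  | cotuple t u iht ihu =>
    exact .cotuple ((elim_inj₀ _ (Arr.act_natural t.arr) _).trans iht)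
      ((elim_inj₁ _ (Arr.act_natural u.arr) _).trans ihu)
  | tuple t u iht ihu => exact .tuple iht ihu

theorem Tm.hom_eq_iff {A B : Ty} {t u : Tm A B} : t.hom = u.hom ↔ Conv A B t u := by
  constructor
  · intro h
    exact (act_ident t).symm.trans (((Quotient.exact h : Arr.Eqv t.arr u.arr).act _).trans
      (act_ident u))
  · exact fun h => Quotient.sound h.arr_eqv

/-! ## Polarised terms -/

/-- Terms between `P` and `Q`, directed so that the structure maps `leg p` act on `P`: terms `Q → P`
for the negative polarity and `P → Q` for the positive one. -/
def O (p : Bool) (P Q : Ty) : Type := match p with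
  | false => Tm Q P
  | true => Tm P Q

namespace O

/-- The same term, seen with the opposite polarity. -/
def flip : (p : Bool) → {P Q : Ty} → O p P Q → O (!p) Q P
  | false, _, _, t => t
  | true, _, _, t => t

def Conv : (p : Bool) → {P Q : Ty} → O p P Q → O p P Q → Prop
  | false, P, Q => Tm.Conv Q P
  | true, P, Q => Tm.Conv P Q

def data : (p : Bool) → {P Q : Ty} → O p P Q → Data
  | false, _, _, t => Tm.data t
  | true, _, _, t => Tm.data t

def nul : (p : Bool) → (P : Ty) → O p P (.unit p)
  | false, P => .cobang P
  | true, P => .bang P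

def conul : (p : Bool) → (Q : Ty) → O p (.unit (!p)) Q
  | false, P => .bang P
  | true, P => .cobang P

def leg : (p i : Bool) → {P₀ P₁ Q : Ty} → O p (sel i P₀ P₁) Q → O p (.node p P₀ P₁) Q
  | false, i, _, _, _, t => Tm.inj i t
  | true, i, _, _, _, t => Tm.proj i t

def coleg : (p j : Bool) → {P Q₀ Q₁ : Ty} → O p P (sel j Q₀ Q₁) → O p P (.node (!p) Q₀ Q₁)
  | false, i, _, _, _, t => Tm.proj i t
  | true, i, _, _, _, t => Tm.inj i t

def tup : (p : Bool) → {P Q₀ Q₁ : Ty} → O p P Q₀ → O p P Q₁ → O p P (.node p Q₀ Q₁)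
  | false, _, _, _, t, u => Tm.cotuple t u
  | true, _, _, _, t, u => Tm.tuple t u

def cotup : (p : Bool) → {P₀ P₁ Q : Ty} → O p P₀ Q → O p P₁ Q → O p (.node (!p) P₀ P₁) Q
  | false, _, _, _, t, u => Tm.tuple t u
  | true, _, _, _, t, u => Tm.cotuple t u

def res : (p i : Bool) → {P Q₀ Q₁ : Ty} → O p P (.node p Q₀ Q₁) → O p P (sel i Q₀ Q₁)
  | false, i, _, _, _, t => Tm.resL i t
  | true, i, _, _, _, t => Tm.resR i t

-- Both polarities are the recursor of `Tm` with the constructors paired up in opposite ways, so one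
-- induction proves a statement together with its dual.
@[elab_as_elim]
theorem induction (p : Bool) {motive : ∀ P Q, O p P Q → Prop}
    (nul : ∀ P, motive P _ (nul p P)) (conul : ∀ Q, motive _ Q (conul p Q))
    (leg : ∀ i P₀ P₁ Q (t : O p (sel i P₀ P₁) Q), motive _ _ t → motive _ _ (leg p i t))
    (coleg : ∀ j P Q₀ Q₁ (t : O p P (sel j Q₀ Q₁)), motive _ _ t → motive _ _ (coleg p j t))
    (tup : ∀ P Q₀ Q₁ (t : O p P Q₀) (u : O p P Q₁), motive _ _ t → motive _ _ u →
      motive _ _ (tup p t u))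
    (cotup : ∀ P₀ P₁ Q (t : O p P₀ Q) (u : O p P₁ Q), motive _ _ t → motive _ _ u →
      motive _ _ (cotup p t u))
    {P Q : Ty} (t : O p P Q) : motive P Q t := by
  cases p
  · exact Tm.rec (motive := fun Q P t => motive P Q t) nul conul
      (fun t h => leg false _ _ _ t h) (fun t h => leg true _ _ _ t h)
      (fun t h => coleg false _ _ _ t h) (fun t h => coleg true _ _ _ t h)
      (fun t u h k => tup _ _ _ t u h k) (fun t u h k => cotup _ _ _ t u h k) t
  · exact Tm.rec (motive := fun P Q t => motive P Q t) conul nul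
      (fun t h => coleg false _ _ _ t h) (fun t h => coleg true _ _ _ t h)
      (fun t h => leg false _ _ _ t h) (fun t h => leg true _ _ _ t h)
      (fun t u h k => cotup _ _ _ t u h k) (fun t u h k => tup _ _ _ t u h k) t

section
variable {p i j k : Bool} {P P₀ P₁ Q Q₀ Q₁ : Ty}

theorem res_leg (t : O p (sel k P₀ P₁) (.node p Q₀ Q₁)) :
    res p i (leg p k t) = leg p k (res p i t) := by cases p <;> cases k <;> rfl

theorem res_cotup (t : O p P₀ (.node p Q₀ Q₁)) (u : O p P₁ (.node p Q₀ Q₁)) :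
    res p i (cotup p t u) = cotup p (res p i t) (res p i u) := by cases p <;> rfl

theorem res_conul : res p i (conul p (.node p Q₀ Q₁)) = conul p _ := by cases p <;> rfl

theorem res_tup (t : O p P Q₀) (u : O p P Q₁) (i : Bool) :
    res p i (tup p t u) = match i with | false => t | true => u := by
  cases p <;> cases i <;> rfl

theorem flip_coleg (t : O p P (sel j Q₀ Q₁)) : flip p (coleg p j t) = leg (!p) j (flip p t) := by
  cases p <;> rfl

theorem conv_flip {f g : O p P Q} : Conv (!p) (flip p f) (flip p g) ↔ Conv p f g := by
  cases p <;> rfl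

theorem flip_surjective (f : O (!p) Q P) : ∃ g : O p P Q, flip p g = f := by
  cases p <;> exact ⟨f, rfl⟩

theorem Conv.refl (f : O p P Q) : Conv p f f := by cases p <;> exact Tm.Conv.refl f

theorem Conv.symm {f g : O p P Q} (h : Conv p f g) : Conv p g f := by
  cases p <;> exact Tm.Conv.symm h

theorem Conv.trans {f g h : O p P Q} (k : Conv p f g) (l : Conv p g h) : Conv p f h := by
  cases p <;> exact Tm.Conv.trans k l

theorem conv_unit (f g : O p P (.unit p)) : Conv p f g := by
  cases p
  · exact Tm.conv_zero _ _
  · exact Tm.conv_one _ _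

theorem conv_node {f g : O p P (.node p Q₀ Q₁)} :
    Conv p f g ↔ ∀ i, Conv p (res p i f) (res p i g) := by
  cases p
  · exact Tm.conv_plus
  · exact Tm.conv_times

theorem Conv.leg {f g : O p (sel i P₀ P₁) Q} (h : Conv p f g) : Conv p (leg p i f) (leg p i g) := by
  cases p
  · exact Tm.Conv.inj i h
  · exact Tm.Conv.proj i h

theorem Conv.coleg {f g : O p P (sel i Q₀ Q₁)} (h : Conv p f g) :
    Conv p (coleg p i f) (coleg p i g) := by
  cases p
  · exact Tm.Conv.proj i h
  · exact Tm.Conv.inj i h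

theorem Conv.tup {f f' : O p P Q₀} {g g' : O p P Q₁} (h : Conv p f f') (k : Conv p g g') :
    Conv p (tup p f g) (tup p f' g') := by
  cases p
  · exact Tm.Conv.cotuple h k
  · exact Tm.Conv.tuple h k

theorem Conv.swap (h : O p (sel i P₀ P₁) (sel j Q₀ Q₁)) :
    Conv p (O.leg p i (O.coleg p j h)) (O.coleg p j (O.leg p i h)) := by
  cases p
  · exact Tm.Conv.swap i j h
  · exact (Tm.Conv.swap j i h).symm

end

/-- The immediate subterm of a term between a sum and a product that starts with a leg or a
coleg. -/
def view : (p : Bool) → {P₀ P₁ Q₀ Q₁ : Ty} → O p (.node p P₀ P₁) (.node (!p) Q₀ Q₁) →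
    (Σ i, O p (sel i P₀ P₁) (.node (!p) Q₀ Q₁)) ⊕ (Σ j, O p (.node p P₀ P₁) (sel j Q₀ Q₁))
  | false, _, _, _, _, .inj₀ t => .inl ⟨false, t⟩
  | false, _, _, _, _, .inj₁ t => .inl ⟨true, t⟩
  | false, _, _, _, _, .proj₀ t => .inr ⟨false, t⟩
  | false, _, _, _, _, .proj₁ t => .inr ⟨true, t⟩
  | true, _, _, _, _, .inj₀ t => .inr ⟨false, t⟩
  | true, _, _, _, _, .inj₁ t => .inr ⟨true, t⟩
  | true, _, _, _, _, .proj₀ t => .inl ⟨false, t⟩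
  | true, _, _, _, _, .proj₁ t => .inl ⟨true, t⟩

theorem view_leg (p i : Bool) {P₀ P₁ Q₀ Q₁ : Ty} (t : O p (sel i P₀ P₁) (.node (!p) Q₀ Q₁)) :
    view p (leg p i t) = .inl ⟨i, t⟩ := by cases p <;> cases i <;> rfl

theorem view_coleg (p j : Bool) {P₀ P₁ Q₀ Q₁ : Ty} (t : O p (.node p P₀ P₁) (sel j Q₀ Q₁)) :
    view p (coleg p j t) = .inr ⟨j, t⟩ := by cases p <;> cases j <;> rfl

theorem core_cases (p : Bool) {P₀ P₁ Q₀ Q₁ : Ty} (t : O p (.node p P₀ P₁) (.node (!p) Q₀ Q₁)) :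
    (∃ i u, t = leg p i u) ∨ ∃ j u, t = coleg p j u := by
  cases p <;> cases t
  exacts [.inl ⟨false, _, rfl⟩, .inl ⟨true, _, rfl⟩, .inr ⟨false, _, rfl⟩, .inr ⟨true, _, rfl⟩,
    .inr ⟨false, _, rfl⟩, .inr ⟨true, _, rfl⟩, .inl ⟨false, _, rfl⟩, .inl ⟨true, _, rfl⟩]

theorem Conv.core_eq {p : Bool} {P₀ P₁ Q₀ Q₁ : Ty} {β : Sort*}
    (φ : O p (.node p P₀ P₁) (.node (!p) Q₀ Q₁) → β)
    (hleg : ∀ i f g, Conv p f g → φ (O.leg p i f) = φ (O.leg p i g))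
    (hcoleg : ∀ j f g, Conv p f g → φ (O.coleg p j f) = φ (O.coleg p j g))
    (hswap : ∀ i j h, φ (O.leg p i (O.coleg p j h)) = φ (O.coleg p j (O.leg p i h)))
    {f g : O p (.node p P₀ P₁) (.node (!p) Q₀ Q₁)} (h : Conv p f g) : φ f = φ g := by
  cases p
  · exact Tm.Conv.core_eq φ hleg hcoleg hswap h
  · exact Tm.Conv.core_eq φ hcoleg hleg (fun i j h => (hswap j i h).symm) h

end O

/-! ## Points and copoints -/

namespace Data

/-- The tree of a nullary term. -/
abbrev nullary (l : Label) : Data := .cons (.leaf l) (.leaf .nil)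

/-- The tree of a unary term. -/
abbrev tag (l : Label) (d : Data) : Data := .cons (.leaf l) d

/-- The tree of a binary term. -/
abbrev tag₂ (l : Label) (d e : Data) : Data := .cons (.leaf l) (.cons d e)

end Data

namespace O

section
variable {p i j k : Bool} {P P₀ P₁ Q Q₀ Q₁ : Ty}

theorem data_flip (t : O p P Q) : data (!p) (flip p t) = data p t := by cases p <;> rfl

theorem data_nul : data p (nul p P) = .nullary (.nul p) := by cases p <;> rfl

theorem data_conul : data p (conul p Q) = .nullary (.nul !p) := by cases p <;> rfl

theorem data_leg (t : O p (sel i P₀ P₁) Q) :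
    data p (leg p i t) = .tag (.leg p i) (data p t) := by cases p <;> cases i <;> rfl

theorem data_coleg (t : O p P (sel i Q₀ Q₁)) :
    data p (coleg p i t) = .tag (.leg (!p) i) (data p t) := by cases p <;> cases i <;> rfl

theorem data_tup (t : O p P Q₀) (u : O p P Q₁) :
    data p (tup p t u) = .tag₂ (.tup p) (data p t) (data p u) := by cases p <;> rfl

theorem data_cotup (t : O p P₀ Q) (u : O p P₁ Q) :
    data p (cotup p t u) = .tag₂ (.tup !p) (data p t) (data p u) := by cases p <;> rfl

end

end O

/-- Syntax trees carry no types, but once the domain and the codomain are fixed, the root label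
determines the types of the subterms. -/
theorem Tm.data_injective {X A : Ty} {t u : Tm X A} (h : t.data = u.data) : t = u := by
  induction t with
  | cobang => cases u <;> simp_all [Tm.data]
  | bang => cases u <;> simp_all [Tm.data]
  | inj₀ t ih => cases u <;> simp only [Tm.data] at h <;> first | cases h | injection h with _ h; rw [ih h]
  | inj₁ t ih => cases u <;> simp only [Tm.data] at h <;> first | cases h | injection h with _ h; rw [ih h]
  | proj₀ t ih => cases u <;> simp only [Tm.data] at h <;> first | cases h | injection h with _ h; rw [ih h]
  | proj₁ t ih => cases u <;> simp only [Tm.data] at h <;> first | cases h | injection h with _ h; rw [ih h]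
  | cotuple t t' ih ih' =>
    cases u <;> simp only [Tm.data] at h <;>
      first | cases h | injection h with _ h; injection h with h h'; rw [ih h, ih' h']
  | tuple t t' ih ih' =>
    cases u <;> simp only [Tm.data] at h <;>
      first | cases h | injection h with _ h; injection h with h h'; rw [ih h, ih' h']

theorem O.data_injective {p : Bool} {P Q : Ty} {t u : O p P Q} (h : data p t = data p u) :
    t = u := by cases p <;> exact Tm.data_injective h

theorem Tm.ptd_of_ptd {X A : Ty} (t : Tm X A) (h : X.ptd = true) : A.ptd = true := by
  induction t <;> simp_all [Ty.ptd]
  rcases h with h | h <;> simp_all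

/-- Arrows carry points forward and copoints backward. The two statements are contrapositives, since
`ptd` has just two values. -/
theorem O.ptd_of_ptd {p : Bool} {P Q : Ty} (t : O p P Q) (h : Q.ptd = !p) : P.ptd = !p := by
  cases p
  · exact Tm.ptd_of_ptd t h
  · by_contra h'
    have := Tm.ptd_of_ptd t (by simpa using h')
    simp_all

/-- Syntax trees of the points (`b = true`) and of the copoints (`b = false`) of a type. -/
inductive Pt (b : Bool) : Ty → Data → Prop
  | nul : Pt b (.unit b) (.nullary (.nul b))
  | leg {q} (i) {A₀ A₁ c} : q ≠ b → Pt b (sel i A₀ A₁) c →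
      Pt b (.node q A₀ A₁) (.tag (.leg q i) c)
  | tup {A₀ A₁ c₀ c₁} : Pt b A₀ c₀ → Pt b A₁ c₁ → Pt b (.node b A₀ A₁) (.tag₂ (.tup b) c₀ c₁)

theorem Pt.ptd_eq {b : Bool} {A : Ty} {c : Data} (h : Pt b A c) : A.ptd = b := by
  induction h with
  | nul => exact Ty.ptd_unit b
  | @leg q i A₀ A₁ c hq _ ih =>
    rw [Ty.ptd_node]
    cases i <;> cases b <;> cases q <;> simp_all
  | tup _ _ ih₀ ih₁ => rw [Ty.ptd_node]; simp_all

namespace O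

/-- A copoint `X → 0` gives terms `X → A` with the same syntax tree, and dually. -/
theorem exists_of_pt {p : Bool} {Q : Ty} {c : Data} (h : Pt p Q c) (P : Ty) :
    ∃ u : O p P Q, data p u = c := by
  induction h with
  | nul => exact ⟨nul p P, data_nul⟩
  | @leg q i A₀ A₁ c hq _ ih =>
    obtain ⟨u, rfl⟩ := ih
    obtain rfl : q = !p := by cases p <;> cases q <;> simp_all
    exact ⟨coleg p i u, data_coleg _⟩
  | tup _ _ ih₀ ih₁ =>
    obtain ⟨u₀, rfl⟩ := ih₀
    obtain ⟨u₁, rfl⟩ := ih₁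
    exact ⟨tup _ u₀ u₁, data_tup _ _⟩

theorem exists_of_copt {p : Bool} {P : Ty} {c : Data} (h : Pt (!p) P c) (Q : Ty) :
    ∃ u : O p P Q, data p u = c := by
  obtain ⟨u, rfl⟩ := exists_of_pt h Q
  obtain ⟨v, rfl⟩ := flip_surjective u
  exact ⟨v, (data_flip v).symm⟩

/-- A leg is absorbed by a constant on the other side: X → 0 → Aᵢ followed by σᵢ is X → 0 → A, and
both composites with 0 have the tree of the copoint. The leg is permuted past the constructors of
that tree until it meets the unit. -/
theorem conv_leg_of_pt {p i : Bool} {P₀ P₁ Q : Ty} {c : Data} (h : Pt p Q c)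
    {u : O p (sel i P₀ P₁) Q} {v : O p (.node p P₀ P₁) Q} (hu : data p u = c)
    (hv : data p v = c) : Conv p (leg p i u) v := by
  induction h with
  | nul => exact conv_unit _ _
  | @leg q j A₀ A₁ c hq hc ih =>
    obtain rfl : q = !p := by cases p <;> cases q <;> simp_all
    obtain ⟨u', hu'⟩ := exists_of_pt hc (sel i P₀ P₁)
    obtain ⟨v', hv'⟩ := exists_of_pt hc (.node p P₀ P₁)
    obtain rfl : coleg p j u' = u := data_injective (by rw [data_coleg, hu', hu])
    obtain rfl : coleg p j v' = v := data_injective (by rw [data_coleg, hv', hv])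
    exact (Conv.swap u').trans (ih hu' hv').coleg
  | @tup A₀ A₁ c₀ c₁ h₀ h₁ ih₀ ih₁ =>
    obtain ⟨u₀, hu₀⟩ := exists_of_pt h₀ (sel i P₀ P₁)
    obtain ⟨v₀, hv₀⟩ := exists_of_pt h₀ (.node p P₀ P₁)
    obtain ⟨u₁, hu₁⟩ := exists_of_pt h₁ (sel i P₀ P₁)
    obtain ⟨v₁, hv₁⟩ := exists_of_pt h₁ (.node p P₀ P₁)
    obtain rfl : tup p u₀ u₁ = u := data_injective (by rw [data_tup, hu₀, hu₁, hu])
    obtain rfl : tup p v₀ v₁ = v := data_injective (by rw [data_tup, hv₀, hv₁, hv])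
    rw [conv_node]; intro k
    rw [res_leg, res_tup, res_tup]
    cases k
    · exact ih₀ hu₀ hv₀
    · exact ih₁ hu₁ hv₁

theorem conv_coleg_of_copt {p j : Bool} {P Q₀ Q₁ : Ty} {c : Data} (h : Pt (!p) P c)
    {u : O p P (sel j Q₀ Q₁)} {v : O p P (.node (!p) Q₀ Q₁)} (hu : data p u = c)
    (hv : data p v = c) : Conv p (coleg p j u) v := by
  rw [← conv_flip, flip_coleg]
  exact conv_leg_of_pt h (by rw [data_flip, hu]) (by rw [data_flip, hv])

/-- A term that is constant by virtue of its `P`-side contains no constructor that decomposes the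
`Q`-side, so restriction there leaves its tree alone. -/
theorem data_res_of_copt {p i : Bool} {P Q₀ Q₁ : Ty} {c : Data} (h : Pt (!p) P c)
    {v : O p P (.node p Q₀ Q₁)} (hv : data p v = c) : data p (res p i v) = c := by
  induction h with
  | nul =>
    obtain rfl : conul p _ = v := data_injective (by rw [data_conul, hv])
    rw [res_conul, data_conul]
  | @leg q j A₀ A₁ c hq hc ih =>
    obtain rfl : q = p := by cases p <;> cases q <;> simp_all
    obtain ⟨v', hv'⟩ := exists_of_copt hc (.node q Q₀ Q₁)
    obtain rfl : leg q j v' = v := data_injective (by rw [data_leg, hv', hv])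
    rw [res_leg, data_leg, ih hv']
  | @tup A₀ A₁ c₀ c₁ h₀ h₁ ih₀ ih₁ =>
    obtain ⟨v₀, hv₀⟩ := exists_of_copt h₀ (.node p Q₀ Q₁)
    obtain ⟨v₁, hv₁⟩ := exists_of_copt h₁ (.node p Q₀ Q₁)
    obtain rfl : cotup p v₀ v₁ = v := data_injective (by rw [data_cotup, hv₀, hv₁, hv])
    rw [res_cotup, data_cotup, ih₀ hv₀, ih₁ hv₁]

/-- The disconnect `X → 0 → 1 → A` does not depend on the copoint of `X` and the point of `A`. -/
theorem conv_of_pt_of_copt {p : Bool} {P Q : Ty} {c a : Data} (hc : Pt p Q c) (ha : Pt (!p) P a)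
    {u v : O p P Q} (hu : data p u = c) (hv : data p v = a) : Conv p u v := by
  induction hc with
  | nul => exact conv_unit _ _
  | @leg q j A₀ A₁ c hq hc ih =>
    obtain rfl : q = !p := by cases p <;> cases q <;> simp_all
    obtain ⟨u', hu'⟩ := exists_of_pt hc P
    obtain rfl : coleg p j u' = u := data_injective (by rw [data_coleg, hu', hu])
    obtain ⟨v', hv'⟩ := exists_of_copt ha (sel j A₀ A₁)
    exact (ih hu' hv').coleg.trans (conv_coleg_of_copt ha hv' hv)
  | @tup A₀ A₁ c₀ c₁ h₀ h₁ ih₀ ih₁ =>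
    obtain ⟨u₀, hu₀⟩ := exists_of_pt h₀ P
    obtain ⟨u₁, hu₁⟩ := exists_of_pt h₁ P
    obtain rfl : tup p u₀ u₁ = u := data_injective (by rw [data_tup, hu₀, hu₁, hu])
    rw [conv_node]; intro k
    have := data_res_of_copt (i := k) ha hv
    rw [res_tup]
    cases k
    · exact ih₀ hu₀ this
    · exact ih₁ hu₁ this

end O

/-! ### Canonical points and copoints -/

/-- The syntax tree of the point or copoint that annotates a type. -/
def Ty.canonData : Ty → Data
  | .zero => .nullary (.nul false)
  | .one => .nullary (.nul true)
  | .plus A B => if A.ptd then .tag (.leg false false) A.canonData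
      else if B.ptd then .tag (.leg false true) B.canonData
      else .tag₂ (.tup false) A.canonData B.canonData
  | .times A B => if !A.ptd then .tag (.leg true false) A.canonData
      else if !B.ptd then .tag (.leg true true) B.canonData
      else .tag₂ (.tup true) A.canonData B.canonData

theorem Ty.pt_canonData (A : Ty) : Pt A.ptd A A.canonData := by
  induction A with
  | zero => exact .nul
  | one => exact .nul
  | plus A B hA hB =>
    cases h : A.ptd <;> cases k : B.ptd <;> simp only [Ty.ptd, Ty.canonData, h, k, Bool.or_true,
      Bool.or_false, if_true, if_false, Bool.false_eq_true] <;> rw [h] at hA <;> rw [k] at hB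
    · exact .tup hA hB
    · exact .leg true (q := false) (by simp) hB
    · exact .leg false (q := false) (by simp) hA
    · exact .leg false (q := false) (by simp) hA
  | times A B hA hB =>
    cases h : A.ptd <;> cases k : B.ptd <;> simp only [Ty.ptd, Ty.canonData, h, k, Bool.and_true,
      Bool.and_false, if_true, if_false, Bool.false_eq_true, Bool.not_true, Bool.not_false]
      <;> rw [h] at hA <;> rw [k] at hB
    · exact .leg false (q := true) (by simp) hA
    · exact .leg false (q := true) (by simp) hA
    · exact .leg true (q := true) (by simp) hB
    · exact .tup hA hB

/-! ## Indefinite terms -/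

/-- The value of an indefinite term between `P` and `Q`: a placeholder for the disconnect. -/
def Ty.norm (P Q : Ty) (d : Data) : Data := if P.ptd = Q.ptd then d else .leaf .nil

/-- The value of `leg p i t`, a term between `P` and `Q`, from that of `t`. -/
def indLeg (p i : Bool) (P Q : Ty) (r : Option Data) : Option Data :=
  r.map fun c => Ty.norm P Q (if Q.ptd = !p then .tag (.leg p i) c else c)

open Classical in
/-- The value of `tup p t₀ t₁`, a term between `P` and `node p Q₀ Q₁`, from those of `t₀`, `t₁`. -/
noncomputable def indTup (p : Bool) (P Q₀ Q₁ : Ty) : Option Data → Option Data → Option Data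
  | some c₀, some c₁ =>
    if P.ptd = p then some (.tag₂ (.tup p) c₀ c₁)
    else if Q₀.ptd = !p then
      if Q₁.ptd = !p then if c₀ = c₁ then some c₀ else none
      else some c₀
    else if Q₁.ptd = !p then some c₁
    else some (.leaf .nil)
  | _, _ => none

/-- The syntax tree of the point or copoint through which a term factors, if there is one, with a
placeholder for the disconnect. -/
noncomputable def Tm.ind : {X A : Ty} → Tm X A → Option Data
  | _, _, .cobang B => some (Ty.norm B .zero (.nullary (.nul false)))
  | _, _, .bang A => some (Ty.norm A .one (.nullary (.nul true)))
  | X, .plus B₀ B₁, .inj₀ t => indLeg false false (.plus B₀ B₁) X t.ind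
  | X, .plus B₀ B₁, .inj₁ t => indLeg false true (.plus B₀ B₁) X t.ind
  | .times A₀ A₁, B, .proj₀ t => indLeg true false (.times A₀ A₁) B t.ind
  | .times A₀ A₁, B, .proj₁ t => indLeg true true (.times A₀ A₁) B t.ind
  | .plus A₀ A₁, B, .cotuple t u => indTup false B A₀ A₁ t.ind u.ind
  | A, .times B₀ B₁, .tuple t u => indTup true A B₀ B₁ t.ind u.ind

theorem Ty.norm_comm (P Q : Ty) (d : Data) : Ty.norm P Q d = Ty.norm Q P d := by
  simp only [Ty.norm, eq_comm]

namespace O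

noncomputable def ind : (p : Bool) → {P Q : Ty} → O p P Q → Option Data
  | false, _, _, t => Tm.ind t
  | true, _, _, t => Tm.ind t

section
variable {p i j : Bool} {P P₀ P₁ Q Q₀ Q₁ : Ty}

theorem ind_flip (t : O p P Q) : ind (!p) (flip p t) = ind p t := by cases p <;> rfl

theorem ind_nul : ind p (nul p P) = some (P.norm (.unit p) (.nullary (.nul p))) := by
  cases p <;> simp [ind, nul, Tm.ind, Ty.unit]

theorem ind_conul : ind p (conul p Q) = some (Ty.norm (.unit !p) Q (.nullary (.nul !p))) := by
  rw [Ty.norm_comm]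
  cases p <;> simp [ind, conul, Tm.ind, Ty.unit]

theorem ind_leg (t : O p (sel i P₀ P₁) Q) :
    ind p (leg p i t) = indLeg p i (.node p P₀ P₁) Q (ind p t) := by
  cases p <;> cases i <;> rfl

theorem ind_coleg (t : O p P (sel j Q₀ Q₁)) :
    ind p (coleg p j t) = indLeg (!p) j (.node (!p) Q₀ Q₁) P (ind p t) := by
  cases p <;> cases j <;> rfl

theorem ind_tup (t : O p P Q₀) (u : O p P Q₁) :
    ind p (tup p t u) = indTup p P Q₀ Q₁ (ind p t) (ind p u) := by
  cases p <;> rfl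

theorem ind_cotup (t : O p P₀ Q) (u : O p P₁ Q) :
    ind p (cotup p t u) = indTup (!p) Q P₀ P₁ (ind p t) (ind p u) := by
  cases p <;> rfl

end

theorem ptd_sel_of_ptd {p i k : Bool} {P₀ P₁ Q₀ Q₁ : Ty}
    (t : O p (sel i P₀ P₁) (.node p Q₀ Q₁)) (h : (sel k Q₀ Q₁).ptd = !p) :
    (sel i P₀ P₁).ptd = !p :=
  ptd_of_ptd (res p k t) h

/-- Compatibility of the test with moving a leg through a tuple. The hypothesis `h` excludes the
polarities for which no term of these types exists; what remains is a finite check. The next two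
lemmas do the same for two tuples and for two legs. -/
theorem indLeg_indTup {p i : Bool} {P₀ P₁ Q₀ Q₁ : Ty} (r₀ r₁ : Option Data)
    (h : ∀ k, (sel k Q₀ Q₁).ptd = !p → (sel i P₀ P₁).ptd = !p) :
    indLeg p i (.node p P₀ P₁) (.node p Q₀ Q₁) (indTup p (sel i P₀ P₁) Q₀ Q₁ r₀ r₁) =
      indTup p (.node p P₀ P₁) Q₀ Q₁ (indLeg p i (.node p P₀ P₁) Q₀ r₀)
        (indLeg p i (.node p P₀ P₁) Q₁ r₁) := by
  have h₀ := h false; have h₁ := h true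
  rcases r₀ with _ | c₀
  · rfl
  rcases r₁ with _ | c₁
  · rfl
  simp only [indTup, indLeg, Ty.norm, Ty.ptd_node, Option.map_some]
  by_cases hc : c₀ = c₁ <;>
  cases p <;> cases i <;> cases e₀ : P₀.ptd <;> cases e₁ : P₁.ptd <;> cases f₀ : Q₀.ptd <;>
    cases f₁ : Q₁.ptd <;> simp_all

theorem indTup_indTup {p : Bool} {P₀ P₁ Q₀ Q₁ : Ty} (r₀₀ r₀₁ r₁₀ r₁₁ : Option Data)
    (h : ∀ k i, (sel k Q₀ Q₁).ptd = !p → (sel i P₀ P₁).ptd = !p) :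
    indTup (!p) (.node p Q₀ Q₁) P₀ P₁ (indTup p P₀ Q₀ Q₁ r₀₀ r₀₁) (indTup p P₁ Q₀ Q₁ r₁₀ r₁₁) =
      indTup p (.node (!p) P₀ P₁) Q₀ Q₁ (indTup (!p) Q₀ P₀ P₁ r₀₀ r₁₀)
        (indTup (!p) Q₁ P₀ P₁ r₀₁ r₁₁) := by
  have h₀₀ := h false false; have h₀₁ := h false true
  have h₁₀ := h true false; have h₁₁ := h true true
  clear h
  rcases r₀₀ with _ | c₀₀ <;> rcases r₀₁ with _ | c₀₁ <;> rcases r₁₀ with _ | c₁₀ <;>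
    rcases r₁₁ with _ | c₁₁ <;> simp only [indTup, Ty.ptd_node] <;>
    cases p <;> cases e₀ : P₀.ptd <;> cases e₁ : P₁.ptd <;> cases f₀ : Q₀.ptd <;>
    cases f₁ : Q₁.ptd <;> simp_all <;> (try split_ifs) <;> simp_all

theorem indLeg_comm {p i j : Bool} {P₀ P₁ Q₀ Q₁ : Ty} (r : Option Data)
    (h : (sel j Q₀ Q₁).ptd = !p → (sel i P₀ P₁).ptd = !p) :
    indLeg p i (.node p P₀ P₁) (.node (!p) Q₀ Q₁)
        (indLeg (!p) j (.node (!p) Q₀ Q₁) (sel i P₀ P₁) r) =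
      indLeg (!p) j (.node (!p) Q₀ Q₁) (.node p P₀ P₁)
        (indLeg p i (.node p P₀ P₁) (sel j Q₀ Q₁) r) := by
  rcases r with _ | c
  · rfl
  simp only [indLeg, Ty.norm, Ty.ptd_node, Option.map_some]
  cases p <;> cases i <;> cases j <;> cases e₀ : P₀.ptd <;> cases e₁ : P₁.ptd <;>
    cases f₀ : Q₀.ptd <;> cases f₁ : Q₁.ptd <;> simp_all

theorem ind_leg_coleg {p i j : Bool} {P₀ P₁ Q₀ Q₁ : Ty} (h : O p (sel i P₀ P₁) (sel j Q₀ Q₁)) :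
    ind p (leg p i (coleg p j h)) = ind p (coleg p j (leg p i h)) := by
  rw [ind_leg, ind_coleg, ind_coleg, ind_leg]
  exact indLeg_comm _ (ptd_of_ptd h)

/-- All terms out of 0 (into 1) are convertible, so an invariant must give them all the value of the
nullary term. -/
theorem ind_of_unit {p : Bool} {P : Ty} (t : O p P (.unit p)) :
    ind p t = some (P.norm (.unit p) (.nullary (.nul p))) := by
  suffices h : ∀ {P Q : Ty} (t : O p P Q), Q = .unit p →
      ind p t = some (P.norm Q (.nullary (.nul p))) from h t rfl
  intro P Q t
  induction t using O.induction with
  | nul P => intro _; exact ind_nul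
  | conul Q => rintro rfl; rw [ind_conul]; cases p <;> rfl
  | leg i P₀ P₁ Q t ih =>
    rintro rfl
    rw [ind_leg, ih rfl]
    have := ptd_of_ptd t
    simp only [indLeg, Ty.norm, Ty.ptd_node, Option.map_some, Ty.ptd_unit]
    cases p <;> cases i <;> cases e₀ : P₀.ptd <;> cases e₁ : P₁.ptd <;> simp_all
  | coleg j P Q₀ Q₁ t ih => intro h; cases p <;> cases h
  | tup => intro h; cases p <;> cases h
  | cotup P₀ P₁ Q t u iht ihu =>
    rintro rfl
    rw [ind_cotup, iht rfl, ihu rfl]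
    simp only [indTup, Ty.norm, Ty.ptd_node, Ty.ptd_unit]
    cases p <;> rcases Bool.eq_false_or_eq_true P₀.ptd with e₀ | e₀ <;>
      rcases Bool.eq_false_or_eq_true P₁.ptd with e₁ | e₁ <;> simp_all [Ty.ptd_unit]

/-- Invariance under η: the value can be computed as if the term began with the tuple of its
components, whatever its actual root is. -/
theorem ind_of_node {p : Bool} {P Q₀ Q₁ : Ty} (t : O p P (.node p Q₀ Q₁)) :
    ind p t = indTup p P Q₀ Q₁ (ind p (res p false t)) (ind p (res p true t)) := by
  suffices h : ∀ {P Q : Ty} (t : O p P Q) {Q₀ Q₁} (h : Q = .node p Q₀ Q₁),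
      ind p t = indTup p P Q₀ Q₁ (ind p (res p false (h ▸ t))) (ind p (res p true (h ▸ t)))
      from h t rfl
  clear t Q₀ Q₁ P
  intro P Q t
  induction t using O.induction with
  | nul P => intro _ _ h; cases p <;> cases h
  | conul Q =>
    rintro Q₀ Q₁ rfl
    simp only [res_conul, ind_conul]
    simp only [indTup, Ty.norm, Ty.ptd_node, Ty.ptd_unit]
    cases p <;> cases e₀ : Q₀.ptd <;> cases e₁ : Q₁.ptd <;> simp_all
  | leg i P₀ P₁ Q t ih =>
    rintro Q₀ Q₁ rfl
    simp only [res_leg, ind_leg]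
    rw [ih rfl]
    exact indLeg_indTup _ _ fun k => ptd_sel_of_ptd t
  | coleg j P Q₀ Q₁ t ih => intro _ _ h; cases p <;> cases h
  | tup P Q₀ Q₁ t u =>
    intro R₀ R₁ h
    obtain ⟨rfl, rfl⟩ : Q₀ = R₀ ∧ Q₁ = R₁ := by cases p <;> cases h <;> exact ⟨rfl, rfl⟩
    simp only [res_tup, ind_tup]
  | cotup P₀ P₁ Q t u iht ihu =>
    rintro Q₀ Q₁ rfl
    simp only [res_cotup, ind_cotup]
    rw [iht rfl, ihu rfl]
    refine indTup_indTup _ _ _ _ ?_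
    rintro k (_ | _)
    · exact ptd_sel_of_ptd (i := false) (P₁ := P₁) t
    · exact ptd_sel_of_ptd (i := true) (P₀ := P₀) u

end O

/-- Induction on total size along the definition of `Conv`: units by `O.ind_of_unit`, componentwise
comparison by `O.ind_of_node`, permutations by `O.ind_leg_coleg`. -/
theorem Tm.Conv.ind_eq {X A : Ty} {f g : Tm X A} (h : Tm.Conv X A f g) : f.ind = g.ind := by
  induction hn : X.size + A.size using Nat.strong_induction_on generalizing X A with
  | _ n ih =>
  subst hn
  have node : ∀ {p : Bool} {P Q₀ Q₁ : Ty},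
      (Ty.node p Q₀ Q₁).size + P.size ≤ X.size + A.size → ∀ {f g : O p P (.node p Q₀ Q₁)},
      O.Conv p f g → O.ind p f = O.ind p g := by
    intro p P Q₀ Q₁ hs f g h
    have : ∀ i, O.ind p (O.res p i f) = O.ind p (O.res p i g) := by
      intro i
      rw [Ty.size_node] at hs
      have hi := Ty.size_sel i Q₀ Q₁
      have := O.conv_node.1 h i
      cases p <;> exact ih _ (by omega) this rfl
    rw [O.ind_of_node, O.ind_of_node, this, this]
  have leg : ∀ {p : Bool} {P₀ P₁ Q : Ty},
      (Ty.node p P₀ P₁).size + Q.size ≤ X.size + A.size → ∀ i (f g : O p (sel i P₀ P₁) Q),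
      O.Conv p f g → O.ind p (O.leg p i f) = O.ind p (O.leg p i g) := by
    intro p P₀ P₁ Q hs i f g h
    have : O.ind p f = O.ind p g := by
      rw [Ty.size_node] at hs
      have hi := Ty.size_sel i P₀ P₁
      cases p <;> exact ih _ (by omega) h rfl
    rw [O.ind_leg, O.ind_leg, this]
  rcases X with _ | _ | ⟨X₀, X₁⟩ | ⟨X₀, X₁⟩
  · exact (O.ind_of_unit (p := false) f).trans (O.ind_of_unit (p := false) g).symm
  · rcases A with _ | _ | ⟨A₀, A₁⟩ | ⟨A₀, A₁⟩
    · cases f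
    · exact (O.ind_of_unit (p := true) f).trans (O.ind_of_unit (p := true) g).symm
    · exact Conv.one_plus_eq (fun t => t.ind) (leg (p := false) (by simp [Ty.node]; omega)) h
    · exact node (p := true) (by simp [Ty.node]; omega) h
  · exact node (p := false) (by simp [Ty.node]) h
  · rcases A with _ | _ | ⟨A₀, A₁⟩ | ⟨A₀, A₁⟩
    · exact Conv.times_zero_eq (fun t => t.ind) (leg (p := true) (by simp [Ty.node])) h
    · exact (O.ind_of_unit (p := true) f).trans (O.ind_of_unit (p := true) g).symm
    · refine Conv.core_eq (fun t => t.ind) (leg (p := false) (by simp [Ty.node]; omega))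
        (leg (p := true) (by simp [Ty.node])) (fun i j h => ?_) h
      exact O.ind_leg_coleg (p := false) h
    · exact node (p := true) (by simp [Ty.node]; omega) h

theorem O.Conv.ind_eq {p : Bool} {P Q : Ty} {f g : O p P Q} (h : O.Conv p f g) :
    ind p f = ind p g := by cases p <;> exact Tm.Conv.ind_eq h

namespace O

/-- The term has the syntax tree of a point or of a copoint. -/
def IsConst (p : Bool) {P Q : Ty} (u : O p P Q) : Prop := Pt p Q (data p u) ∨ Pt (!p) P (data p u)

theorem isConst_flip {p : Bool} {P Q : Ty} {u : O p P Q} :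
    IsConst (!p) (flip p u) ↔ IsConst p u := by
  simp only [IsConst, data_flip, Bool.not_not, or_comm]

/-- With these polarities the only constant is the disconnect. Trees from either side are compared
with the canonical tree of the opposite side, and those two with each other. -/
theorem IsConst.conv {p : Bool} {P Q : Ty} {u v : O p P Q} (hu : IsConst p u) (hv : IsConst p v)
    (hQ : Q.ptd = p) (hP : P.ptd = !p) : Conv p u v := by
  have hc := Q.pt_canonData; rw [hQ] at hc
  have ha := P.pt_canonData; rw [hP] at ha
  obtain ⟨x, hx⟩ := exists_of_pt hc P
  obtain ⟨y, hy⟩ := exists_of_copt ha Q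
  have key : ∀ {u : O p P Q}, IsConst p u → Conv p u x := by
    rintro u (hu | hu)
    · exact (conv_of_pt_of_copt hu ha rfl hy).trans (conv_of_pt_of_copt hc ha hx hy).symm
    · exact (conv_of_pt_of_copt hc hu hx rfl).symm
  exact (key hu).trans (key hv).symm

/-- An indefinite term is a point or a copoint. -/
def IndSpec (p : Bool) {P Q : Ty} (t : O p P Q) : Prop :=
  ∀ d, ind p t = some d → ∃ u, Conv p t u ∧ IsConst p u ∧ Ty.norm P Q (data p u) = d

theorem indSpec_flip {p : Bool} {P Q : Ty} {t : O p P Q} :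
    IndSpec (!p) (flip p t) ↔ IndSpec p t := by
  constructor
  · intro h d hd
    obtain ⟨u, h₁, h₂, h₃⟩ := h d (by rwa [ind_flip])
    obtain ⟨u, rfl⟩ := flip_surjective u
    exact ⟨u, conv_flip.1 h₁, isConst_flip.1 h₂, by rwa [Ty.norm_comm, ← data_flip]⟩
  · intro h d hd
    obtain ⟨u, h₁, h₂, h₃⟩ := h d (by rwa [ind_flip] at hd)
    exact ⟨flip p u, conv_flip.2 h₁, isConst_flip.2 h₂, by rwa [Ty.norm_comm, data_flip]⟩

theorem ptd_node_of_sel {p i : Bool} {A B : Ty} (h : (sel i A B).ptd = !p) :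
    (Ty.node p A B).ptd = !p := by
  rw [Ty.ptd_node]; cases p <;> cases i <;> simp_all

theorem ptd_sel_of_node {p : Bool} (i : Bool) {A B : Ty} (h : (Ty.node p A B).ptd = p) :
    (sel i A B).ptd = p := by
  by_contra h'
  have := ptd_node_of_sel (p := p) (i := i) (A := A) (B := B) (by cases p <;> simpa using h')
  cases p <;> simp_all

theorem ptd_of_ptd' {p : Bool} {P Q : Ty} (t : O p P Q) (h : P.ptd = p) : Q.ptd = p := by
  by_contra h'
  have := ptd_of_ptd t (by cases p <;> simpa using h')
  cases p <;> simp_all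

/-- If the factor is constant by virtue of `Q`, the leg is absorbed. If it is constant by virtue of
its component of `P`, the leg stays and extends that constant to `P`. -/
theorem IndSpec.leg {p i : Bool} {P₀ P₁ Q : Ty} {t : O p (sel i P₀ P₁) Q} (ht : IndSpec p t) :
    IndSpec p (leg p i t) := by
  intro d hd
  rw [ind_leg] at hd
  obtain ⟨c, hc, rfl⟩ := Option.map_eq_some_iff.1 hd
  obtain ⟨u, h₁, h₂, rfl⟩ := ht c hc
  by_cases hQ : Q.ptd = p
  · have hQ' : Q.ptd ≠ !p := by cases p <;> simp [hQ]
    rw [if_neg hQ']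
    rcases h₂ with h₂ | h₂
    · obtain ⟨v, hv⟩ := exists_of_pt h₂ (.node p P₀ P₁)
      refine ⟨v, h₁.leg.trans (conv_leg_of_pt h₂ rfl hv), .inl (by rwa [hv]), ?_⟩
      rw [hv]
      by_cases hP : (Ty.node p P₀ P₁).ptd = p
      · rw [Ty.norm, Ty.norm, Ty.norm, ptd_sel_of_node i hP, hQ, if_pos rfl]
      · simp only [Ty.norm, hQ, hP, if_false]
    · have hP := ptd_node_of_sel h₂.ptd_eq
      refine ⟨O.leg p i u, h₁.leg, .inr ?_, ?_⟩
      · rw [data_leg]; exact .leg i (by cases p <;> simp) h₂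
      · have : (Ty.node p P₀ P₁).ptd ≠ Q.ptd := by rw [hP, hQ]; cases p <;> simp
        simp only [Ty.norm, this, if_false]
  · have hQ' : Q.ptd = !p := by cases p <;> simpa using hQ
    have hP := ptd_of_ptd t hQ'
    rcases h₂ with h₂ | h₂
    · exact absurd h₂.ptd_eq hQ
    · refine ⟨O.leg p i u, h₁.leg, .inr ?_, ?_⟩
      · rw [data_leg]; exact .leg i (by cases p <;> simp) h₂
      · rw [if_pos hQ', data_leg, Ty.norm.eq_1 (sel i P₀ P₁), if_pos (hP.trans hQ'.symm)]

/-- If `P` has polarity `p`, both components are constants of their `Q`-sides and may be tupled.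
Otherwise one constant of `P` has to serve both: a component with `Q`-side of polarity `!p`
prescribes it, whereas one of polarity `p` is the disconnect and accepts any. -/
theorem IndSpec.tup {p : Bool} {P Q₀ Q₁ : Ty} {t : O p P Q₀} {u : O p P Q₁} (ht : IndSpec p t)
    (hu : IndSpec p u) : IndSpec p (tup p t u) := by
  intro d hd
  rw [ind_tup] at hd
  rcases e₀ : ind p t with _ | c₀
  · rw [e₀] at hd; cases hd
  rcases e₁ : ind p u with _ | c₁
  · rw [e₀, e₁] at hd; cases hd
  rw [e₀, e₁] at hd
  obtain ⟨t', ht₁, ht₂, rfl⟩ := ht c₀ e₀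
  obtain ⟨u', hu₁, hu₂, rfl⟩ := hu c₁ e₁
  clear ht hu e₀ e₁
  by_cases hP : P.ptd = p
  · have h₀ := ptd_of_ptd' t hP
    have h₁ := ptd_of_ptd' u hP
    simp only [indTup, hP, if_true, Ty.norm, h₀, h₁, Option.some.injEq] at hd
    subst hd
    have hne : ∀ c, ¬ Pt (!p) P c := fun c h => by have := h.ptd_eq; cases p <;> simp_all
    have hc := Pt.tup (ht₂.resolve_right (hne _)) (hu₂.resolve_right (hne _))
    refine ⟨O.tup p t' u', ht₁.tup hu₁, .inl ?_, ?_⟩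
    · rwa [data_tup]
    · rw [data_tup, Ty.norm, hc.ptd_eq, if_pos hP]
  · have hP' : P.ptd = !p := by cases p <;> simpa using hP
    -- It is enough to exhibit one constant of `P` to which both components convert.
    have key : ∀ c, Pt (!p) P c → (∀ v : O p P Q₀, data p v = c → Conv p t' v) →
        (∀ v : O p P Q₁, data p v = c → Conv p u' v) →
        Ty.norm P (.node p Q₀ Q₁) c = d → 
        ∃ w, Conv p (O.tup p t u) w ∧ IsConst p w ∧ Ty.norm P (.node p Q₀ Q₁) (data p w) = d := by
      intro c hc h₀ h₁ hd
      obtain ⟨w, rfl⟩ := exists_of_copt hc (.node p Q₀ Q₁)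
      refine ⟨w, conv_node.2 ?_, .inr hc, hd⟩
      rintro (_ | _) <;> rw [res_tup]
      · exact ht₁.trans (h₀ _ (data_res_of_copt hc rfl))
      · exact hu₁.trans (h₁ _ (data_res_of_copt hc rfl))
    have const : ∀ {c Q} {v : O p P Q}, Pt (!p) P c → data p v = c → IsConst p v := by
      rintro c Q v h rfl; exact .inr h
    have pol : ∀ {Q : Ty}, Q.ptd ≠ (!p) → Q.ptd = p := by
      intro Q hQ; cases p <;> simpa using hQ
    have pt : ∀ {Q : Ty} {v : O p P Q}, Q.ptd = (!p) → IsConst p v → Pt (!p) P (data p v) := by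
      rintro Q v hQ (h | h)
      · have := h.ptd_eq; cases p <;> simp_all
      · exact h
    simp only [indTup, hP, if_false] at hd
    by_cases h₀ : Q₀.ptd = !p
    · have hQ := ptd_node_of_sel (p := p) (i := false) (A := Q₀) (B := Q₁) h₀
      have n₀ : Ty.norm P Q₀ (data p t') = data p t' := if_pos (hP'.trans h₀.symm)
      rw [if_pos h₀, n₀] at hd
      have hc := pt h₀ ht₂
      refine key _ hc (fun v hv => data_injective hv ▸ .refl _) (fun v hv => ?_) ?_
      · by_cases h₁ : Q₁.ptd = !p
        · have n₁ : Ty.norm P Q₁ (data p u') = data p u' := if_pos (hP'.trans h₁.symm)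
          rw [if_pos h₁, n₁] at hd
          split_ifs at hd with h
          exact data_injective (hv.trans h) ▸ .refl _
        · exact hu₂.conv (const hc hv) (pol h₁) hP'
      · rw [Ty.norm, hP', hQ, if_pos rfl]
        split_ifs at hd <;> simpa using hd
    · by_cases h₁ : Q₁.ptd = !p
      · have hQ := ptd_node_of_sel (p := p) (i := true) (A := Q₀) (B := Q₁) h₁
        simp only [h₀, if_false, h₁, if_true, Ty.norm, hP'] at hd
        have hc := pt h₁ hu₂
        refine key _ hc (fun v hv => ht₂.conv (const hc hv) (pol h₀) hP')
          (fun v hv => data_injective hv ▸ .refl _) ?_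
        rw [Ty.norm, hP', hQ, if_pos rfl]
        simpa using hd
      · simp only [h₀, h₁, if_false] at hd
        -- Both components are disconnects, so the canonical constant of `P` will do.
        have hc := P.pt_canonData; rw [hP'] at hc
        refine key _ hc (fun v hv => ht₂.conv (const hc hv) (pol h₀) hP')
          (fun v hv => hu₂.conv (const hc hv) (pol h₁) hP') ?_
        have : (Ty.node p Q₀ Q₁).ptd = p := by rw [Ty.ptd_node, if_pos ⟨pol h₀, pol h₁⟩]
        rw [Ty.norm, if_neg (by rw [this]; exact hP)]
        simpa using hd

theorem indSpec {p : Bool} {P Q : Ty} (t : O p P Q) : IndSpec p t := by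
  induction t using O.induction with
  | nul P =>
    intro d hd
    rw [ind_nul] at hd
    exact ⟨_, .refl _, .inl (by rw [data_nul]; exact .nul), by rw [data_nul]; simpa using hd⟩
  | conul Q =>
    intro d hd
    rw [ind_conul] at hd
    exact ⟨_, .refl _, .inr (by rw [data_conul]; exact .nul), by rw [data_conul]; simpa using hd⟩
  | leg i P₀ P₁ Q t ih => exact ih.leg
  | coleg j P Q₀ Q₁ t ih =>
    rw [← indSpec_flip, flip_coleg]; exact (indSpec_flip.2 ih).leg
  | tup P Q₀ Q₁ t u iht ihu => exact iht.tup ihu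
  | cotup P₀ P₁ Q t u iht ihu =>
    cases p
    · exact IndSpec.tup (p := true) (indSpec_flip.2 iht) (indSpec_flip.2 ihu) |> indSpec_flip.2
    · exact IndSpec.tup (p := false) (indSpec_flip.2 iht) (indSpec_flip.2 ihu) |> indSpec_flip.2

/-- When the polarities of the types agree, the value is the tree of the constant itself. When they
differ, the existence of a term leaves only the case in which all constants coincide. -/
theorem conv_of_ind_eq {p : Bool} {P Q : Ty} {f g : O p P Q} {d : Data} (hf : ind p f = some d)
    (hg : ind p g = some d) : Conv p f g := by
  obtain ⟨u, hu, cu, du⟩ := indSpec f d hf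
  obtain ⟨v, hv, cv, dv⟩ := indSpec g d hg
  refine hu.trans (Conv.trans ?_ hv.symm)
  by_cases h : P.ptd = Q.ptd
  · rw [Ty.norm, if_pos h] at du dv
    exact data_injective (du.trans dv.symm) ▸ .refl _
  · by_cases hQ : Q.ptd = p
    · exact cu.conv cv hQ (by cases p <;> simp_all)
    · have hQ' : Q.ptd = !p := by cases p <;> simpa using hQ
      exact absurd ((ptd_of_ptd f hQ').trans hQ'.symm) h

theorem ind_of_pt {p : Bool} {P Q : Ty} {c : Data} (h : Pt p Q c) {u : O p P Q}
    (hu : data p u = c) : ind p u = some (Ty.norm P Q c) := by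
  induction h with
  | nul => exact ind_of_unit u
  | @leg q j A₀ A₁ c hq hc ih =>
    obtain rfl : q = !p := by cases p <;> cases q <;> simp_all
    obtain ⟨u', hu'⟩ := exists_of_pt hc P
    obtain rfl : coleg p j u' = u := data_injective (by rw [data_coleg, hu', hu])
    have hQ : (Ty.node (!p) A₀ A₁).ptd = p := (Pt.leg j hq hc).ptd_eq
    rw [ind_coleg, ih hu', indLeg, Option.map_some, Ty.norm_comm]
    simp only [Ty.norm, hQ, hc.ptd_eq, Bool.not_not]
    by_cases hP : P.ptd = p <;> simp [hP]
  | @tup A₀ A₁ c₀ c₁ h₀ h₁ ih₀ ih₁ =>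
    obtain ⟨u₀, hu₀⟩ := exists_of_pt h₀ P
    obtain ⟨u₁, hu₁⟩ := exists_of_pt h₁ P
    obtain rfl : tup p u₀ u₁ = u := data_injective (by rw [data_tup, hu₀, hu₁, hu])
    rw [ind_tup, ih₀ hu₀, ih₁ hu₁]
    have hQ : (Ty.node p A₀ A₁).ptd = p := (Pt.tup h₀ h₁).ptd_eq
    simp only [indTup, Ty.norm, hQ, h₀.ptd_eq, h₁.ptd_eq]
    by_cases hP : P.ptd = p <;> simp [hP]

theorem ind_of_copt {p : Bool} {P Q : Ty} {c : Data} (h : Pt (!p) P c) {u : O p P Q}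
    (hu : data p u = c) : ind p u = some (Ty.norm P Q c) := by
  rw [← ind_flip, Ty.norm_comm]
  exact ind_of_pt h (by rw [data_flip, hu])

/-- Terms out of `1` and terms into `0` are indefinite. -/
theorem ind_of_counit {p : Bool} {P : Ty} (t : O p P (.unit (!p))) : ind p t ≠ none := by
  suffices h : ∀ {P Q : Ty} (t : O p P Q), Q = .unit (!p) → ind p t ≠ none from h t rfl
  clear t P
  intro P Q t
  induction t using O.induction with
  | nul P => intro h; cases p <;> cases h
  | conul Q => intro _; rw [ind_conul]; simp
  | leg i P₀ P₁ Q t ih => intro h; rw [ind_leg]; simpa [indLeg] using ih h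
  | coleg j P Q₀ Q₁ t ih => intro h; cases p <;> cases h
  | tup => intro h; cases p <;> cases h
  | cotup P₀ P₁ Q t u iht ihu =>
    rintro rfl
    rw [ind_cotup]
    rcases e₀ : ind p t with _ | c₀
    · exact absurd e₀ (iht rfl)
    rcases e₁ : ind p u with _ | c₁
    · exact absurd e₁ (ihu rfl)
    simp [indTup, Ty.ptd_unit]

/-! ## Definite terms -/

theorem ind_leg_eq_none {p i : Bool} {P₀ P₁ Q : Ty} {t : O p (sel i P₀ P₁) Q} :
    ind p (leg p i t) = none ↔ ind p t = none := by
  rw [ind_leg, indLeg, Option.map_eq_none_iff]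

theorem ind_coleg_eq_none {p j : Bool} {P Q₀ Q₁ : Ty} {t : O p P (sel j Q₀ Q₁)} :
    ind p (coleg p j t) = none ↔ ind p t = none := by
  rw [ind_coleg, indLeg, Option.map_eq_none_iff]

/-- What is constant along conversion steps of definite terms from a product to a sum is constant
along conversion. -/
theorem Conv.definite_eq {p : Bool} {P₀ P₁ Q₀ Q₁ : Ty}
    (φ : O p (.node p P₀ P₁) (.node (!p) Q₀ Q₁) → Prop)
    (hleg : ∀ i f g, Conv p f g → ind p f = none → φ (O.leg p i f) = φ (O.leg p i g))
    (hcoleg : ∀ j f g, Conv p f g → ind p f = none → φ (O.coleg p j f) = φ (O.coleg p j g))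
    (hswap : ∀ i j h, ind p h = none →
      φ (O.leg p i (O.coleg p j h)) = φ (O.coleg p j (O.leg p i h)))
    {f g : O p (.node p P₀ P₁) (.node (!p) Q₀ Q₁)} (h : Conv p f g) (hf : ind p f = none) :
    φ f = φ g := by
  -- Definiteness is itself invariant, so the conditional predicate is constant along all steps,
  -- definite or not.
  have key : (ind p f = none → φ f) = (ind p g = none → φ g) := by
    refine Conv.core_eq (fun f => ind p f = none → φ f) ?_ ?_ ?_ h
    · intro i f g h
      rw [ind_leg_eq_none, ind_leg_eq_none, ← h.ind_eq]
      exact propext (forall_congr' fun e => iff_of_eq (hleg i f g h e))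
    · intro i f g h
      rw [ind_coleg_eq_none, ind_coleg_eq_none, ← h.ind_eq]
      exact propext (forall_congr' fun e => iff_of_eq (hcoleg i f g h e))
    · intro i j h
      rw [ind_leg_eq_none, ind_coleg_eq_none, ind_coleg_eq_none, ind_leg_eq_none]
      exact propext (forall_congr' fun e => iff_of_eq (hswap i j h e))
  have hg : ind p g = none := h.ind_eq ▸ hf
  simpa [hf, hg] using key

/-- Whether a term from a product to a sum factors through `leg p i`, in view of its root. -/
def FactorsAtRoot (p i : Bool) {P₀ P₁ Q₀ Q₁ : Ty}
    (t : O p (.node p P₀ P₁) (.node (!p) Q₀ Q₁)) : Prop :=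
  match view p t with
  | .inl ⟨k, _⟩ => k = i
  | .inr ⟨_, w⟩ => ∃ u, Conv p w (leg p i u)

theorem factorsAtRoot_leg {p i k : Bool} {P₀ P₁ Q₀ Q₁ : Ty}
    {t : O p (sel k P₀ P₁) (.node (!p) Q₀ Q₁)} : FactorsAtRoot p i (leg p k t) ↔ k = i := by
  rw [FactorsAtRoot, view_leg]

theorem factorsAtRoot_coleg {p i j : Bool} {P₀ P₁ Q₀ Q₁ : Ty}
    {t : O p (.node p P₀ P₁) (sel j Q₀ Q₁)} :
    FactorsAtRoot p i (coleg p j t) ↔ ∃ u, Conv p t (leg p i u) := by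
  rw [FactorsAtRoot, view_coleg]

/-- Only permutations can disturb the predicate, and only if the term below the coleg factors
through two different legs. `H` rules this out at the smaller type; it is a hypothesis because
disjointness of legs is itself proved with this lemma. -/
theorem FactorsAtRoot.congr {p i : Bool} {P₀ P₁ Q₀ Q₁ : Ty}
    (H : ∀ {j k : Bool}, i ≠ k → ∀ {f : O p (sel i P₀ P₁) (sel j Q₀ Q₁)}
      {g : O p (sel k P₀ P₁) (sel j Q₀ Q₁)}, Conv p (leg p k g) (leg p i f) → ind p g ≠ none)
    {f g : O p (.node p P₀ P₁) (.node (!p) Q₀ Q₁)} (h : Conv p f g) (hf : ind p f = none) :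
    FactorsAtRoot p i f ↔ FactorsAtRoot p i g := by
  refine iff_of_eq (h.definite_eq (FactorsAtRoot p i) ?_ ?_ ?_ hf)
  · intro m f g _ _
    rw [eq_iff_iff, factorsAtRoot_leg, factorsAtRoot_leg]
  · intro j f g hfg _
    rw [eq_iff_iff, factorsAtRoot_coleg, factorsAtRoot_coleg]
    exact ⟨fun ⟨u, hu⟩ => ⟨u, hfg.symm.trans hu⟩, fun ⟨u, hu⟩ => ⟨u, hfg.trans hu⟩⟩
  · intro m j w hw
    rw [eq_iff_iff, factorsAtRoot_leg, factorsAtRoot_coleg]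
    constructor
    · rintro rfl; exact ⟨w, .refl _⟩
    · rintro ⟨u, hu⟩
      by_contra hm
      exact H (Ne.symm hm) hu hw

/-- If `Q` had polarity `!p`, both values would keep their outermost leg, and these labels differ.
-/
theorem ptd_of_conv_leg {p i k : Bool} (hik : i ≠ k) {P₀ P₁ Q : Ty}
    {f : O p (sel i P₀ P₁) Q} {g : O p (sel k P₀ P₁) Q}
    (h : Conv p (leg p i f) (leg p k g)) (hne : ind p (leg p i f) ≠ none) : Q.ptd = p := by
  by_contra hQ
  have hQ' : Q.ptd = !p := by cases p <;> simpa using hQ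
  have hP := ptd_of_ptd (leg p i f) hQ'
  have e := h.ind_eq
  rw [ind_leg] at hne
  rw [ind_leg, ind_leg] at e
  rcases e₀ : ind p f with _ | c₀
  · rw [e₀] at hne; exact hne rfl
  rcases e₁ : ind p g with _ | c₁
  · rw [e₀, e₁] at e; cases e
  simp only [e₀, e₁, indLeg, Option.map_some, Ty.norm, hQ', hP, if_true] at e
  simp [hik] at e

/-- The two legs of a sum are disjoint, but for disconnects and copoints. -/
theorem indefinite_of_conv_leg {p i k : Bool} (hik : i ≠ k) {P₀ P₁ Q : Ty}
    {f : O p (sel i P₀ P₁) Q} {g : O p (sel k P₀ P₁) Q}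
    (h : Conv p (leg p i f) (leg p k g)) : ind p (leg p i f) ≠ none := by
  induction Q using Ty.pol_induction p generalizing i k with
  | unit => rw [ind_of_unit]; simp
  | counit => exact ind_of_counit _
  | node A B ih =>
    have ih' : ∀ m, ind p (res p m (leg p i f)) ≠ none ∧ (sel m A B).ptd = p := by
      intro m
      have hm := conv_node.1 h m
      rw [res_leg, res_leg] at hm
      rw [res_leg]
      exact ⟨ih m hik hm, ptd_of_conv_leg hik hm (ih m hik hm)⟩
    rw [ind_of_node]
    obtain ⟨h₀, k₀⟩ := ih' false
    obtain ⟨h₁, k₁⟩ := ih' true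
    rcases e₀ : ind p (res p false (leg p i f)) with _ | c₀
    · exact absurd e₀ h₀
    rcases e₁ : ind p (res p true (leg p i f)) with _ | c₁
    · exact absurd e₁ h₁
    have hne : p ≠ !p := by cases p <;> simp
    change A.ptd = p at k₀
    change B.ptd = p at k₁
    -- Both components of `Q` have polarity `p`, so `indTup` has no constants to compare and cannot
    -- fail.
    simp only [indTup, k₀, k₁, if_neg hne]
    split_ifs <;> simp
  | conode A B ih =>
    intro hdef
    -- Were the term definite, factoring through leg `i` at the root would pass to the other side,
    -- whose root is leg `k`. The induction hypothesis is disjointness at the components of `Q`.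
    have key := FactorsAtRoot.congr (i := i)
      (fun {j m} him f g hm hg => ih j him.symm hm (ind_leg_eq_none.2 hg)) h hdef
    rw [factorsAtRoot_leg, factorsAtRoot_leg] at key
    exact hik (key.1 rfl).symm

/-- A cancellable leg can be cancelled from indefinite terms. -/
theorem conv_of_conv_leg_of_indefinite {p i : Bool} {P₀ P₁ Q : Ty}
    (hc : ¬ ((sel i P₀ P₁).ptd = p ∧ (sel (!i) P₀ P₁).ptd = !p)) {f g : O p (sel i P₀ P₁) Q}
    (h : Conv p (leg p i f) (leg p i g)) (hf : ind p f ≠ none) : Conv p f g := by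
  have e := h.ind_eq
  rw [ind_leg, ind_leg] at e
  rcases e₀ : ind p f with _ | c₀
  · exact absurd e₀ hf
  rcases e₁ : ind p g with _ | c₁
  · rw [e₀, e₁] at e; cases e
  suffices hcc : c₀ = c₁ from conv_of_ind_eq e₀ (hcc ▸ e₁)
  obtain ⟨_, -, -, k₀⟩ := indSpec f c₀ e₀
  obtain ⟨_, -, -, k₁⟩ := indSpec g c₁ e₁
  rw [e₀, e₁] at e
  by_cases hQ : Q.ptd = p
  · have hQ' : Q.ptd ≠ !p := by cases p <;> simp [hQ]
    -- If this component has polarity `p`, cancellability gives its sibling and the whole node the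
    -- same polarity, so no value is erased. If not, both terms are disconnects already before the
    -- leg is applied.
    by_cases hi : (sel i P₀ P₁).ptd = p
    · have hi' : (sel (!i) P₀ P₁).ptd = p := by
        by_contra h'; exact hc ⟨hi, by cases p <;> simpa using h'⟩
      have hP : (Ty.node p P₀ P₁).ptd = p := by
        rw [Ty.ptd_node, if_pos]; cases i
        · exact ⟨hi, hi'⟩
        · exact ⟨hi', hi⟩
      simpa [indLeg, Ty.norm, hP, hQ, hQ'] using e
    · have : (sel i P₀ P₁).ptd ≠ Q.ptd := by rwa [hQ]
      rw [Ty.norm, if_neg this] at k₀ k₁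
      rw [← k₀, ← k₁]
  · have hQ' : Q.ptd = !p := by cases p <;> simpa using hQ
    have hP := ptd_of_ptd (leg p i f) hQ'
    simpa [indLeg, Ty.norm, hP, hQ'] using e

/-- The predicate on terms from a product to a sum that holds for `leg p i g` iff `g` is
convertible to `f`, in view of the root. -/
def IsLegOf {p i : Bool} {P₀ P₁ Q₀ Q₁ : Ty} (f : O p (sel i P₀ P₁) (.node (!p) Q₀ Q₁))
    (t : O p (.node p P₀ P₁) (.node (!p) Q₀ Q₁)) : Prop :=
  match view p t with
  | .inl s => ∃ g, s = ⟨i, g⟩ ∧ Conv p g f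
  | .inr ⟨j, w⟩ => ∃ h, Conv p w (leg p i h) ∧ Conv p (coleg p j h) f

/-- Cancellable legs are monic. -/
theorem conv_of_conv_leg {p i : Bool} {P₀ P₁ Q : Ty}
    (hc : ¬ ((sel i P₀ P₁).ptd = p ∧ (sel (!i) P₀ P₁).ptd = !p)) {f g : O p (sel i P₀ P₁) Q}
    (h : Conv p (leg p i f) (leg p i g)) : Conv p f g := by
  induction Q using Ty.pol_induction p with
  | unit => exact conv_unit _ _
  | counit => exact conv_of_conv_leg_of_indefinite hc h (ind_of_counit _)
  | node A B ih =>
    rw [conv_node] at h ⊢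
    intro m
    have hm := h m
    rw [res_leg, res_leg] at hm
    exact ih m hm
  | conode A B ih =>
    by_cases hf : ind p f = none
    swap
    · exact conv_of_conv_leg_of_indefinite hc h hf
    have hself : ∀ g, IsLegOf f (leg p i g) ↔ Conv p g f := by
      intro g
      rw [IsLegOf, view_leg]
      exact ⟨fun ⟨g', e, h⟩ => by cases e; exact h, fun h => ⟨g, rfl, h⟩⟩
    have hother : ∀ {k} (g : O p (sel k P₀ P₁) _), k ≠ i → ¬ IsLegOf f (leg p k g) := by
      intro k g hk
      rw [IsLegOf, view_leg]
      rintro ⟨g', e, -⟩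
      exact hk (congrArg Sigma.fst e)
    have hco : ∀ {j} (w : O p _ (sel j A B)), IsLegOf f (coleg p j w) ↔
        ∃ h, Conv p w (leg p i h) ∧ Conv p (coleg p j h) f := by
      intro j w; rw [IsLegOf, view_coleg]
    -- Transporting the predicate from `leg p i f`, where it holds by reflexivity, to `leg p i g`
    -- gives the claim.
    have key := h.definite_eq (IsLegOf f) ?_ ?_ ?_ (ind_leg_eq_none.2 hf)
    · rw [eq_iff_iff, hself, hself] at key
      exact (key.1 (.refl _)).symm
    · intro k g g' hg _
      rw [eq_iff_iff]
      by_cases hk : k = i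
      · subst hk
        rw [hself, hself]
        exact ⟨fun h => hg.symm.trans h, fun h => hg.trans h⟩
      · exact iff_of_false (hother _ hk) (hother _ hk)
    · intro j w w' hw _
      rw [eq_iff_iff, hco, hco]
      exact ⟨fun ⟨h, h₁, h₂⟩ => ⟨h, hw.symm.trans h₁, h₂⟩, fun ⟨h, h₁, h₂⟩ => ⟨h, hw.trans h₁, h₂⟩⟩
    · intro k j w hw
      rw [eq_iff_iff, hco]
      by_cases hk : k = i
      · subst hk
        rw [hself]
        -- The permutation step is where monicity at the smaller type enters: it makes the factor of
        -- the term below the coleg unique.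
        exact ⟨fun h => ⟨w, .refl _, h⟩, fun ⟨h, h₁, h₂⟩ => (ih j h₁).coleg.trans h₂⟩
      · refine iff_of_false (hother _ hk) ?_
        rintro ⟨h, h₁, -⟩
        exact indefinite_of_conv_leg hk h₁ (ind_leg_eq_none.2 hw)

/-! ### Factorization through a leg -/

/-- A copointed term into a sum factors through both coprojections, and dually. -/
theorem exists_conv_leg_of_ind {p : Bool} (i : Bool) {P₀ P₁ Q : Ty} {t : O p (.node p P₀ P₁) Q}
    {d : Data} (ht : ind p t = some d) (hQ : Q.ptd = p) :
    ∃ u : O p (sel i P₀ P₁) Q,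
      data p u = (if (Ty.node p P₀ P₁).ptd = p then d else Q.canonData) ∧
        Conv p t (leg p i u) := by
  obtain ⟨u₀, h₁, h₂, h₃⟩ := indSpec t d ht
  by_cases hP : (Ty.node p P₀ P₁).ptd = p
  · rw [if_pos hP]
    rw [Ty.norm, hP, hQ, if_pos rfl] at h₃
    rcases h₂ with h₂ | h₂
    · obtain ⟨u, hu⟩ := exists_of_pt h₂ (sel i P₀ P₁)
      exact ⟨u, hu.trans h₃, h₁.trans (conv_leg_of_pt h₂ hu rfl).symm⟩
    · have := h₂.ptd_eq; rw [hP] at this; cases p <;> cases this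
  -- The term is the disconnect, so the canonical constant of `Q` represents it and its factor.
  · rw [if_neg hP]
    have hc := Q.pt_canonData; rw [hQ] at hc
    obtain ⟨u, hu⟩ := exists_of_pt hc (sel i P₀ P₁)
    obtain ⟨v, hv⟩ := exists_of_pt hc (.node p P₀ P₁)
    refine ⟨u, hu, h₁.trans ((h₂.conv (.inl ?_) hQ ?_).trans (conv_leg_of_pt hc hu hv).symm)⟩
    · rwa [hv]
    · cases p <;> simpa using hP

/-- If `πⱼ(w) = σᵢ(u)`, then `w` factors through `σᵢ`, but for disconnects and copoints. -/
theorem exists_conv_leg_of_coleg {p i j : Bool} {P₀ P₁ Q₀ Q₁ : Ty}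
    {w : O p (.node p P₀ P₁) (sel j Q₀ Q₁)} {u : O p (sel i P₀ P₁) (.node (!p) Q₀ Q₁)}
    (h : Conv p (coleg p j w) (leg p i u)) :
    (∃ u', Conv p w (leg p i u')) ∨
      ind p (coleg p j w) ≠ none ∧ (Ty.node (!p) Q₀ Q₁).ptd = p := by
  by_cases hdef : ind p (coleg p j w) = none
  · have key := FactorsAtRoot.congr (i := i) (fun {j m} him f g hm hg =>
      indefinite_of_conv_leg him.symm hm (ind_leg_eq_none.2 hg)) h hdef
    rw [factorsAtRoot_leg, factorsAtRoot_coleg] at key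
    exact .inl (key.2 rfl)
  by_cases hQ : (Ty.node (!p) Q₀ Q₁).ptd = p
  · exact .inr ⟨hdef, hQ⟩
  left
  have hQ' : (Ty.node (!p) Q₀ Q₁).ptd = !p := by cases p <;> simpa using hQ
  have hj : (sel j Q₀ Q₁).ptd = !p := ptd_sel_of_node j hQ'
  have hP := ptd_of_ptd w hj
  have hi := ptd_of_ptd u hQ'
  have e := h.ind_eq
  rw [ind_coleg, ind_leg] at e
  rcases e₀ : ind p w with _ | c₀
  · exact absurd (ind_coleg_eq_none.2 e₀) hdef
  rcases e₁ : ind p u with _ | c₁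
  · rw [e₀, e₁] at e; cases e
  -- With these polarities the coleg leaves the value of `w` unchanged, while the leg adds its label
  -- to the value of `u`. Hence the constant behind `w` begins with `leg p i`, and its remainder is
  -- the factor sought.
  have e' : c₀ = .tag (.leg p i) c₁ := by
    have hne : (!p) ≠ p := by cases p <;> simp
    simpa [e₀, e₁, indLeg, Ty.norm, hP, hQ', hne] using e
  subst e'
  obtain ⟨v, -, hv, hd⟩ := indSpec u c₁ e₁
  rw [Ty.norm, if_pos (hi.trans hQ'.symm)] at hd
  subst hd
  have hv' : Pt (!p) (sel i P₀ P₁) (data p v) := by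
    rcases hv with hv | hv
    · exact absurd hv.ptd_eq hQ
    · exact hv
  obtain ⟨u', hu'⟩ := exists_of_copt hv' (sel j Q₀ Q₁)
  refine ⟨u', conv_of_ind_eq e₀ ?_⟩
  have : Pt (!p) (.node p P₀ P₁) (.tag (.leg p i) (data p v)) :=
    .leg i (by cases p <;> simp) hv'
  rw [ind_of_copt this (by rw [data_leg, hu']), Ty.norm, if_pos (hP.trans hj.symm)]

end O

/-! ## Execution of code -/

/-- The code returns `a` after exactly `n` steps. -/
def Code.Runs {α : Type} (c : Code Data α) (n : ℕ) (a : α) : Prop :=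
  ∀ (j : α → Code Data Data) (s : List (Data → Code Data Data)),
    (step procedure)^[n] ⟨c.bind j, s⟩ = ⟨j a, s⟩

/-- The code, started after `t` steps, returns some `a` after `t'` steps in all such that
`Q a t'`. -/
def Code.Wp {α : Type} : Code Data α → ℕ → (α → ℕ → Prop) → Prop
  | .ret a, t, Q => Q a t
  | .leaf l k, t, Q => (k (.leaf l)).Wp (t + 1) Q
  | .cons x y k, t, Q => (k (.cons x y)).Wp (t + 1) Q
  | .uncons (.cons x y) k, t, Q => (k x y).Wp (t + 1) Q
  | .uncons (.leaf _) _, _, _ => False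
  | .look (.leaf l) k, t, Q => (k l).Wp (t + 1) Q
  | .look (.cons _ _) _, _, _ => False
  | .call f xs k, t, Q =>
      ∃ v n, (procedure f xs).Runs n v ∧ (k v).Wp (t + n + 2) Q
  | .abort, _, _ => False

namespace Code

theorem bind_ret {α : Type} (c : Code Data α) : c.bind .ret = c := by
  induction c <;> simp_all [Code.bind]

/-- Since `Runs` quantifies over the continuation and the stack, the run of a called function can be
inserted into that of its caller. -/
theorem Wp.exists_runs {α : Type} {c : Code Data α} {t : ℕ} {Q : α → ℕ → Prop} (h : c.Wp t Q) :
    ∃ a n, c.Runs n a ∧ Q a (t + n) := by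
  induction c generalizing t with
  | ret a => exact ⟨a, 0, fun _ _ => rfl, h⟩
  | leaf l k ih =>
    obtain ⟨a, n, h₁, h₂⟩ := ih _ h
    exact ⟨a, n + 1, fun j s => h₁ j s, by rwa [Nat.add_comm n, ← Nat.add_assoc]⟩
  | cons x y k ih =>
    obtain ⟨a, n, h₁, h₂⟩ := ih _ h
    exact ⟨a, n + 1, fun j s => h₁ j s, by rwa [Nat.add_comm n, ← Nat.add_assoc]⟩
  | uncons x k ih =>
    cases x with
    | leaf l => exact h.elim
    | cons x y =>
      obtain ⟨a, n, h₁, h₂⟩ := ih _ _ h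
      exact ⟨a, n + 1, fun j s => h₁ j s, by rwa [Nat.add_comm n, ← Nat.add_assoc]⟩
  | look x k ih =>
    cases x with
    | cons x y => exact h.elim
    | leaf l =>
      obtain ⟨a, n, h₁, h₂⟩ := ih _ h
      exact ⟨a, n + 1, fun j s => h₁ j s, by rwa [Nat.add_comm n, ← Nat.add_assoc]⟩
  | call f xs k ih =>
    obtain ⟨v, m, hv, h⟩ := h
    obtain ⟨a, n, h₁, h₂⟩ := ih _ h
    -- The two extra steps are the call and the return.
    refine ⟨a, n + (m + 2), fun j s => ?_, by convert h₂ using 1; omega⟩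
    rw [Function.iterate_add_apply]
    have : (step procedure)^[m + 2] ⟨(Code.call f xs k).bind j, s⟩ = ⟨(k v).bind j, s⟩ := by
      have hm := hv .ret ((fun v => (k v).bind j) :: s)
      rw [bind_ret] at hm
      rw [Function.iterate_succ_apply']
      change step procedure ((step procedure)^[m] ⟨procedure f xs, (fun v => (k v).bind j) :: s⟩) = _
      rw [hm]
      rfl
    rw [this]
    exact h₁ j s
  | abort => exact h.elim

theorem Wp.mono {α : Type} {c : Code Data α} {t : ℕ} {Q Q' : α → ℕ → Prop} (h : c.Wp t Q)
    (hQ : ∀ a t', Q a t' → Q' a t') : c.Wp t Q' := by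
  induction c generalizing t with
  | ret a => exact hQ _ _ h
  | leaf l k ih => exact ih _ h
  | cons x y k ih => exact ih _ h
  | uncons x k ih =>
    cases x with
    | leaf l => exact h.elim
    | cons x y => exact ih _ _ h
  | look x k ih =>
    cases x with
    | cons x y => exact h.elim
    | leaf l => exact ih _ h
  | call f xs k ih =>
    obtain ⟨v, m, hv, h⟩ := h
    exact ⟨v, m, hv, ih _ h⟩
  | abort => exact h.elim

theorem wp_bind {α β : Type} (c : Code Data α) (k : α → Code Data β) (t : ℕ) (Q : β → ℕ → Prop) :
    (c >>= k).Wp t Q ↔ c.Wp t fun a t' => (k a).Wp t' Q := by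
  change (c.bind k).Wp t Q ↔ _
  induction c generalizing t with
  | ret a => rfl
  | leaf l k ih => exact ih _ _
  | cons x y k ih => exact ih _ _
  | uncons x k ih =>
    cases x with
    | leaf l => rfl
    | cons x y => exact ih _ _ _
  | look x k ih =>
    cases x with
    | cons x y => rfl
    | leaf l => exact ih _ _
  | call f xs k ih => exact exists_congr fun v => exists_congr fun n => and_congr_right fun _ => ih _ _
  | abort => rfl

end Code

/-- A type as an annotated tree. -/
def Ty.ann : Ty → Data
  | .zero => .tag (.unit false) (.cons (.leaf (.bit false))
      (.cons (Ty.canonData .zero) (.leaf .nil)))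
  | .one => .tag (.unit true) (.cons (.leaf (.bit true)) (.cons (Ty.canonData .one) (.leaf .nil)))
  | .plus A B => .tag (.node false) (.cons (.leaf (.bit (Ty.plus A B).ptd))
      (.cons (Ty.canonData (.plus A B)) (.cons A.ann B.ann)))
  | .times A B => .tag (.node true) (.cons (.leaf (.bit (Ty.times A B).ptd))
      (.cons (Ty.canonData (.times A B)) (.cons A.ann B.ann)))

/-! ### Exact costs of the basic combinators -/

section
open Code
variable {t : ℕ}

theorem wp_pure {α : Type} (a : α) (Q : α → ℕ → Prop) :
    (pure a : Code Data α).Wp t Q ↔ Q a t := Iff.rfl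

theorem wp_mkCons (x y : Data) (Q) : (mkCons x y).Wp t Q ↔ Q (.cons x y) (t + 1) := Iff.rfl

theorem wp_unCons (x y : Data) (Q) : (unCons (Data.cons x y)).Wp t Q ↔ Q (x, y) (t + 1) := Iff.rfl

theorem wp_getLabel (l : Label) (Q) : (getLabel (Data.leaf l)).Wp t Q ↔ Q l (t + 1) := Iff.rfl

theorem wp_mkTag (l : Label) (x : Data) (Q) : (mkTag l x).Wp t Q ↔ Q (.tag l x) (t + 2) := Iff.rfl

theorem wp_mkTag₂ (l : Label) (x y : Data) (Q) :
    (mkTag₂ l x y).Wp t Q ↔ Q (.tag₂ l x y) (t + 3) := Iff.rfl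

theorem wp_answer (b : Bool) (Q) : (answer b).Wp t Q ↔ Q (.leaf (.bit b)) (t + 1) := Iff.rfl

theorem wp_failure (Q) : (failure : Code Data Data).Wp t Q ↔ Q (.nullary .nil) (t + 3) := Iff.rfl

theorem wp_success (x : Data) (Q) : (success x).Wp t Q ↔ Q (.tag .found x) (t + 2) := Iff.rfl

theorem wp_isFound_found (x : Data) (Q) :
    (isFound (Data.tag .found x)).Wp t Q ↔ Q (some x) (t + 2) := Iff.rfl

theorem wp_isFound_nil (x : Data) (Q) :
    (isFound (Data.tag .nil x)).Wp t Q ↔ Q none (t + 2) := Iff.rfl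

theorem wp_root (l : Label) (x : Data) (Q) : (root (Data.tag l x)).Wp t Q ↔ Q (l, x) (t + 2) :=
  Iff.rfl

theorem wp_component (i : Bool) (x y : Data) (Q) :
    (component i (Data.cons x y)).Wp t Q ↔ Q (bif i then y else x) (t + 1) := Iff.rfl

theorem wp_mkAnnot (l : Label) (b : Bool) (c d : Data) (Q) : (mkAnnot l b c d).Wp t Q ↔
    Q (.tag l (.cons (.leaf (.bit b)) (.cons c d))) (t + 5) := Iff.rfl

theorem wp_pointed (A : Ty) (Q) : (pointed A.ann).Wp t Q ↔ Q A.ptd (t + 3) := by cases A <;> rfl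

theorem wp_canon (A : Ty) (Q) : (canon A.ann).Wp t Q ↔ Q A.canonData (t + 3) := by cases A <;> rfl

theorem wp_child (p i : Bool) (A B : Ty) (Q) :
    (child i (Ty.node p A B).ann).Wp t Q ↔ Q (sel i A B).ann (t + 4) := by
  cases p <;> cases i <;> rfl

theorem wp_ite {α : Type} (P : Prop) [Decidable P] (c d : Code Data α) (Q) :
    (if P then c else d).Wp t Q ↔ if P then c.Wp t Q else d.Wp t Q := by split <;> rfl

/-- The outcome of a call: a value within a time bound. -/
def Computes (f : Fn) (xs : List Data) (N : ℕ) (post : Data → Prop) : Prop :=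
  ∃ v n, (procedure f xs).Runs n v ∧ post v ∧ n ≤ N

theorem Code.Wp.computes {f : Fn} {xs : List Data} {N : ℕ} {post : Data → Prop}
    (h : (procedure f xs).Wp 0 fun v n => post v ∧ n ≤ N) : Computes f xs N post := by
  obtain ⟨v, n, h₁, h₂, h₃⟩ := h.exists_runs
  exact ⟨v, n, h₁, h₂, by omega⟩

/-- A call returns what the called function computes, at the cost of two more steps. -/
theorem Computes.callFn {f : Fn} {xs : List Data} {N : ℕ} {post : Data → Prop}
    (h : Computes f xs N post) {Q : Data → ℕ → Prop}
    (hQ : ∀ v n, post v → n ≤ N → Q v (t + n + 2)) : (callFn f xs).Wp t Q := by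
  obtain ⟨v, n, h₁, h₂, h₃⟩ := h
  exact ⟨v, n, h₁, hQ v n h₂ h₃⟩

end

/-! ### Annotation of types -/

theorem computes_annot (A : Ty) : Computes .annot [A.data] (60 * A.size) (· = A.ann) := by
  have node : ∀ {p : Bool} {A B : Ty}, Computes .annot [A.data] (60 * A.size) (· = A.ann) →
      Computes .annot [B.data] (60 * B.size) (· = B.ann) →
      Computes .annot [(Ty.node p A B).data] (60 * (Ty.node p A B).size)
        (· = (Ty.node p A B).ann) := by
    intro p A B hA hB
    refine Code.Wp.computes ?_
    have e : (Ty.node p A B).data = .tag (.node p) (.cons A.data B.data) := by cases p <;> rfl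
    rw [e, Ty.size_node]
    simp only [procedure, annotBody, Code.wp_bind, wp_root, wp_unCons]
    refine hA.callFn fun _ n h hn => ?_
    subst h
    refine hB.callFn fun _ m h hm => ?_
    subst h
    simp only [Code.wp_bind, wp_mkCons, wp_canon, wp_pointed, wp_ite, wp_mkTag, wp_mkTag₂, wp_mkAnnot]
    cases p <;> cases h₀ : A.ptd <;> cases h₁ : B.ptd <;>
      simp [Ty.node, Ty.ann, Ty.canonData, Ty.ptd, h₀, h₁] <;> omega
  induction A with
  | zero => exact Code.Wp.computes ⟨rfl, by simp [Ty.size]⟩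
  | one => exact Code.Wp.computes ⟨rfl, by simp [Ty.size]⟩
  | plus A B hA hB => exact node (p := false) hA hB
  | times A B hA hB => exact node (p := true) hA hB

open Code

/-! ### Bounds -/

/-- A leg makes `P` larger by at least one, which adds at least `K` to the product bound and so pays
for constant overhead. -/
theorem cost_leg {K c n i : ℕ} {p k : Bool} {P₀ P₁ Q : Ty} (hn : n ≤ K * ((sel k P₀ P₁).size * Q.size))
    (hc : c ≤ K) (hi : i = n + c) : i ≤ K * ((Ty.node p P₀ P₁).size * Q.size) := by
  have h₁ : (sel k P₀ P₁).size + 1 ≤ (Ty.node p P₀ P₁).size := by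
    rw [Ty.size_node]; have := Ty.size_sel k P₀ P₁; omega
  have h₂ := Q.size_pos
  calc i ≤ K * ((sel k P₀ P₁).size * Q.size) + K * 1 := by omega
    _ ≤ K * ((sel k P₀ P₁).size * Q.size) + K * Q.size := by gcongr; exact h₂
    _ = K * (((sel k P₀ P₁).size + 1) * Q.size) := by ring
    _ ≤ _ := by gcongr

theorem cost_coleg {K c n i : ℕ} {p k : Bool} {P Q₀ Q₁ : Ty}
    (hn : n ≤ K * (P.size * (sel k Q₀ Q₁).size)) (hc : c ≤ K) (hi : i = n + c) :
    i ≤ K * (P.size * (Ty.node p Q₀ Q₁).size) := by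
  rw [Nat.mul_comm P.size] at hn ⊢
  exact cost_leg hn hc hi

/-- The sizes of the two components add up to one less than that of the node, and this unit pays for
overhead linear in `P`. -/
theorem cost_tup {K c n₀ n₁ i : ℕ} {p : Bool} {P Q₀ Q₁ : Ty} (h₀ : n₀ ≤ K * (P.size * Q₀.size))
    (h₁ : n₁ ≤ K * (P.size * Q₁.size)) (hc : c ≤ K * P.size) (hi : i = n₀ + n₁ + c) :
    i ≤ K * (P.size * (Ty.node p Q₀ Q₁).size) := by
  rw [Ty.size_node]
  calc i ≤ K * (P.size * Q₀.size) + K * (P.size * Q₁.size) + K * P.size := by omega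
    _ = _ := by ring

theorem cost_cotup {K c n₀ n₁ i : ℕ} {p : Bool} {P₀ P₁ Q : Ty} (h₀ : n₀ ≤ K * (P₀.size * Q.size))
    (h₁ : n₁ ≤ K * (P₁.size * Q.size)) (hc : c ≤ K * Q.size) (hi : i = n₀ + n₁ + c) :
    i ≤ K * ((Ty.node p P₀ P₁).size * Q.size) := by
  rw [Nat.mul_comm _ Q.size] at h₀ h₁ ⊢
  exact cost_tup h₀ h₁ hc hi

theorem cost_const {K c : ℕ} (P Q : Ty) (hc : c ≤ K) : c ≤ K * (P.size * Q.size) :=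
  hc.trans (Nat.le_mul_of_pos_right _ (Nat.mul_pos P.size_pos Q.size_pos))

/-! ### Syntactic equality -/

theorem Ty.node_inj {p q : Bool} {A B C D : Ty} (h : Ty.node p A B = Ty.node q C D) :
    p = q ∧ A = C ∧ B = D := by
  cases p <;> cases q <;> cases h <;> exact ⟨rfl, rfl, rfl⟩

theorem Ty.node_ne_unit {p q : Bool} {A B : Ty} : Ty.node p A B ≠ Ty.unit q := by
  cases p <;> cases q <;> simp [Ty.node, Ty.unit]

theorem Pt.of_unit {b : Bool} {d : Data} (h : Pt b (.unit b) d) : d = .nullary (.nul b) := by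
  generalize hA : Ty.unit b = A at h
  cases h with
  | nul => rfl
  | leg => exact absurd hA.symm Ty.node_ne_unit
  | tup => exact absurd hA.symm Ty.node_ne_unit

theorem Pt.of_node_ne {b q : Bool} {A B : Ty} {d : Data} (hq : q ≠ b) (h : Pt b (.node q A B) d) :
    ∃ i c, d = .tag (.leg q i) c ∧ Pt b (sel i A B) c := by
  generalize hA : Ty.node q A B = A at h
  cases h with
  | nul => exact absurd hA Ty.node_ne_unit
  | leg i hq h => obtain ⟨rfl, rfl, rfl⟩ := Ty.node_inj hA; exact ⟨i, _, rfl, h⟩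
  | tup => exact absurd (Ty.node_inj hA).1 hq

theorem Pt.of_node {b : Bool} {A B : Ty} {d : Data} (h : Pt b (.node b A B) d) :
    ∃ c₀ c₁, d = .tag₂ (.tup b) c₀ c₁ ∧ Pt b A c₀ ∧ Pt b B c₁ := by
  generalize hA : Ty.node b A B = A at h
  cases h with
  | nul => exact absurd hA Ty.node_ne_unit
  | leg i hq h => exact absurd (Ty.node_inj hA).1.symm hq
  | tup h₀ h₁ => obtain ⟨-, rfl, rfl⟩ := Ty.node_inj hA; exact ⟨_, _, rfl, h₀, h₁⟩

-- Two points of one type have the same shape except for the choices of leg, so the recursion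
-- follows the type and its cost is linear in the size of the type.
open Classical in
theorem computes_same {b : Bool} {A : Ty} {c d : Data} (hc : Pt b A c) (hd : Pt b A d) :
    Computes .same [c, d] (20 * A.size) (· = .leaf (.bit (decide (c = d)))) := by
  induction hc generalizing d with
  | nul =>
    obtain rfl := hd.of_unit
    refine Wp.computes ?_
    have := (Ty.unit b).size_pos
    simp only [procedure, sameBody, wp_bind, wp_root, wp_answer]
    simp; omega
  | @leg q i A₀ A₁ c hq h ih =>
    obtain ⟨k, d, rfl, hd'⟩ := hd.of_node_ne hq
    refine Wp.computes ?_
    simp only [procedure, sameBody, wp_bind, wp_root, Ty.size_node]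
    by_cases hik : i = k
    · subst hik
      simp only [true_and, if_true]
      refine (ih hd').callFn ?_
      rintro _ n rfl hn
      have := Ty.size_sel i A₀ A₁
      simp; omega
    · simp [hik, wp_answer]; omega
  | @tup A₀ A₁ c₀ c₁ h₀ h₁ ih₀ ih₁ =>
    obtain ⟨d₀, d₁, rfl, hd₀, hd₁⟩ := hd.of_node
    refine Wp.computes ?_
    simp only [procedure, sameBody, wp_bind, wp_root, Ty.size_node, if_true, wp_unCons]
    refine (ih₀ hd₀).callFn ?_
    rintro _ n rfl hn
    simp only [wp_getLabel]
    by_cases h : c₀ = d₀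
    · simp only [h, decide_true]
      refine (ih₁ hd₁).callFn ?_
      rintro _ m rfl hm
      simp; omega
    · simp [h, wp_answer]; omega

/-! ### Restriction -/

-- A pass over a term costs at most the product of the sizes: each leg uses up a node of one type,
-- and each tuple divides one of the types between its two branches.
open O in
theorem computes_restrict {p : Bool} (i : Bool) {P Q₀ Q₁ : Ty} (t : O p P (.node p Q₀ Q₁)) :
    Computes (.restrict p i) [data p t] (20 * (P.size * (Ty.node p Q₀ Q₁).size))
      (· = data p (res p i t)) := by
  suffices h : ∀ {P Q : Ty} (t : O p P Q) {Q₀ Q₁} (h : Q = .node p Q₀ Q₁),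
      Computes (.restrict p i) [data p t] (20 * (P.size * Q.size)) (· = data p (res p i (h ▸ t)))
      from h t rfl
  clear t Q₀ Q₁ P
  intro P Q t
  induction t using O.induction with
  | nul P => intro _ _ h; exact absurd h.symm Ty.node_ne_unit
  | conul Q =>
    rintro Q₀ Q₁ rfl
    refine Wp.computes ?_
    simp only [procedure, restrictBody, wp_bind, data_conul, res_conul, wp_root, wp_pure, true_and]
    exact cost_const _ _ (by omega)
  | leg k P₀ P₁ Q t ih =>
    rintro Q₀ Q₁ rfl
    refine Wp.computes ?_
    simp only [procedure, restrictBody, wp_bind, data_leg, res_leg, wp_root]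
    refine (ih rfl).callFn ?_
    rintro _ n rfl hn
    simp only [wp_mkTag, true_and]
    exact cost_leg hn (c := 6) (by omega) (by omega)
  | coleg j P Q₀ Q₁ t ih =>
    intro _ _ h; exact absurd (Ty.node_inj h).1 (by cases p <;> simp)
  | tup P Q₀ Q₁ t u =>
    intro R₀ R₁ h
    obtain ⟨-, rfl, rfl⟩ := Ty.node_inj h
    refine Wp.computes ?_
    simp only [procedure, restrictBody, wp_bind, data_tup, res_tup, wp_root, if_true, wp_component]
    refine ⟨by cases i <;> rfl, cost_const _ _ (by omega)⟩
  | cotup P₀ P₁ Q t u iht ihu =>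
    rintro Q₀ Q₁ rfl
    refine Wp.computes ?_
    have hp : (!p) ≠ p := by cases p <;> simp
    simp only [procedure, restrictBody, wp_bind, data_cotup, res_cotup, wp_root, if_neg hp, wp_unCons]
    refine (iht rfl).callFn ?_
    rintro _ n rfl hn
    refine (ihu rfl).callFn ?_
    rintro _ m rfl hm
    simp only [wp_mkTag₂, true_and]
    have := (Ty.node p Q₀ Q₁).size_pos
    exact cost_cotup hn hm (c := 10) (by omega) (by omega)

/-! ### The indefiniteness test -/

/-- The answer `r` of `indef` for a term between `P` and `Q` with value `o`. -/
def IndAnswer (P Q : Ty) (o : Option Data) (r : Data) : Prop :=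
  (o = none ∧ r = .nullary .nil) ∨ ∃ c, r = .tag .found c ∧ o = some (Ty.norm P Q c)

theorem IndAnswer.swap {P Q : Ty} {o : Option Data} {r : Data} (h : IndAnswer P Q o r) :
    IndAnswer Q P o r := by
  rcases h with h | ⟨c, h₁, h₂⟩
  · exact .inl h
  · exact .inr ⟨c, h₁, by rwa [Ty.norm_comm]⟩

open O

/-- For types of different polarity `Ty.norm` erases the tree, so the machine may return any; for
equal polarities the program adds the label exactly when `indLeg` does. -/
theorem wp_indefLeg {p i : Bool} {P₀ P₁ Q : Ty} {t : O p (sel i P₀ P₁) Q} {r : Data}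
    (h : IndAnswer (sel i P₀ P₁) Q (ind p t) r) {τ : ℕ} :
    (indefLeg p i Q.ann r).Wp τ fun r' τ' =>
      IndAnswer (.node p P₀ P₁) Q (ind p (leg p i t)) r' ∧ τ' ≤ τ + 9 := by
  rw [ind_leg]
  rcases h with ⟨h, rfl⟩ | ⟨c, rfl, h⟩
  · simp only [indefLeg, wp_bind, wp_isFound_nil, wp_failure, h]
    exact ⟨.inl ⟨rfl, rfl⟩, by omega⟩
  · simp only [indefLeg, wp_bind, wp_isFound_found, wp_pointed, wp_ite, wp_mkTag, wp_success]
    by_cases hQ : Q.ptd = !p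
    · have hP := ptd_of_ptd t hQ
      rw [if_pos hQ]
      refine ⟨.inr ⟨_, rfl, ?_⟩, by omega⟩
      rw [h, indLeg, Option.map_some, if_pos hQ, Ty.norm.eq_1 (sel i P₀ P₁),
        if_pos (hP.trans hQ.symm)]
    · rw [if_neg hQ]
      refine ⟨.inr ⟨_, rfl, ?_⟩, by omega⟩
      rw [h, indLeg, Option.map_some, if_neg hQ]
      have hQ' : Q.ptd = p := by cases p <;> simpa using hQ
      by_cases hP : (Ty.node p P₀ P₁).ptd = p
      · rw [Ty.norm.eq_1 (sel i P₀ P₁), ptd_sel_of_node i hP, hQ', if_pos rfl]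
      · simp only [Ty.norm, hQ', hP, if_false]

/-- The only overhead that is not constant is one call of `same`. By `indSpec` its arguments are
constants of `P`, so it is linear in the size of `P`. -/
theorem wp_indefTup {p : Bool} {P Q₀ Q₁ : Ty} {t : O p P Q₀} {u : O p P Q₁} {r₀ r₁ : Data}
    (h₀ : IndAnswer P Q₀ (ind p t) r₀) (h₁ : IndAnswer P Q₁ (ind p u) r₁) {τ : ℕ} :
    (indefTup p (Ty.node p Q₀ Q₁).ann P.ann r₀ r₁).Wp τ fun r' τ' =>
      IndAnswer P (.node p Q₀ Q₁) (ind p (tup p t u)) r' ∧ τ' ≤ τ + 60 * P.size := by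
  have hs := P.size_pos
  rw [ind_tup]
  rcases h₀ with ⟨h₀, rfl⟩ | ⟨c₀, rfl, h₀⟩
  · rcases h₁ with ⟨h₁, rfl⟩ | ⟨c₁, rfl, h₁⟩
    · simp only [indefTup, wp_bind, wp_isFound_nil, wp_failure, h₀]
      exact ⟨.inl ⟨rfl, rfl⟩, by omega⟩
    · simp only [indefTup, wp_bind, wp_isFound_nil, wp_isFound_found, wp_failure, h₀]
      exact ⟨.inl ⟨rfl, rfl⟩, by omega⟩
  rcases h₁ with ⟨h₁, rfl⟩ | ⟨c₁, rfl, h₁⟩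
  · simp only [indefTup, wp_bind, wp_isFound_nil, wp_isFound_found, wp_failure, h₀, h₁]
    exact ⟨.inl ⟨rfl, rfl⟩, by omega⟩
  obtain ⟨t', -, ht, et⟩ := indSpec t _ h₀
  obtain ⟨u', -, hu, eu⟩ := indSpec u _ h₁
  simp only [indefTup, wp_bind, wp_isFound_found, wp_pointed, wp_ite, wp_mkTag₂, wp_success,
    wp_child]
  change if P.ptd = p then _ else if Q₀.ptd = (!p) then (if Q₁.ptd = (!p) then _ else _) else _
  rw [h₀, h₁]
  by_cases hP : P.ptd = p
  · rw [if_pos hP]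
    refine ⟨.inr ⟨_, rfl, ?_⟩, by omega⟩
    simp [indTup, Ty.norm, hP, ptd_of_ptd' t hP, ptd_of_ptd' u hP, Ty.ptd_node]
  have hP' : P.ptd = !p := by cases p <;> simpa using hP
  rw [if_neg hP]
  have pt : ∀ {Q : Ty} {v : O p P Q} {c : Data}, Q.ptd = (!p) → IsConst p v →
      Ty.norm P Q (data p v) = Ty.norm P Q c → Pt (!p) P c := by
    rintro Q v c hQ h e
    rw [Ty.norm, Ty.norm, if_pos (hP'.trans hQ.symm), if_pos (hP'.trans hQ.symm)] at e
    subst e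
    rcases h with h | h
    · have := h.ptd_eq; cases p <;> simp_all
    · exact h
  by_cases k₀ : Q₀.ptd = !p
  · have hQ := ptd_node_of_sel (p := p) (i := false) (A := Q₀) (B := Q₁) k₀
    have n₀ : Ty.norm P Q₀ c₀ = c₀ := if_pos (hP'.trans k₀.symm)
    have n : ∀ c, Ty.norm P (.node p Q₀ Q₁) c = c := fun c => if_pos (hP'.trans hQ.symm)
    rw [if_pos k₀]
    by_cases k₁ : Q₁.ptd = !p
    · have n₁ : Ty.norm P Q₁ c₁ = c₁ := if_pos (hP'.trans k₁.symm)
      rw [if_pos k₁, n₀, n₁]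
      refine (computes_same (pt k₀ ht et) (pt k₁ hu eu)).callFn ?_
      rintro _ m rfl hm
      simp only [wp_getLabel, indTup, hP, k₀, k₁, if_true, if_false]
      by_cases hc : c₀ = c₁
      · simp only [hc, decide_true, wp_success, if_true]
        exact ⟨.inr ⟨_, rfl, by rw [n]⟩, by omega⟩
      · simp only [hc, decide_false, wp_failure, if_false]
        exact ⟨.inl ⟨rfl, rfl⟩, by omega⟩
    · rw [if_neg k₁]
      refine ⟨.inr ⟨_, rfl, ?_⟩, by omega⟩
      rw [n]
      simp only [indTup, hP, k₀, k₁, n₀, if_true, if_false]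
  · rw [if_neg k₀]
    refine ⟨.inr ⟨_, rfl, ?_⟩, by omega⟩
    by_cases k₁ : Q₁.ptd = !p
    · have hQ := ptd_node_of_sel (p := p) (i := true) (A := Q₀) (B := Q₁) k₁
      have n₁ : Ty.norm P Q₁ c₁ = c₁ := if_pos (hP'.trans k₁.symm)
      have n : ∀ c, Ty.norm P (.node p Q₀ Q₁) c = c := fun c => if_pos (hP'.trans hQ.symm)
      rw [n]
      simp only [indTup, hP, k₀, k₁, n₁, if_true, if_false]
    · have pol : ∀ {Q : Ty}, Q.ptd ≠ (!p) → Q.ptd = p := by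
        intro Q hQ; cases p <;> simpa using hQ
      have hQ : (Ty.node p Q₀ Q₁).ptd = p := by rw [Ty.ptd_node, if_pos ⟨pol k₀, pol k₁⟩]
      simp only [indTup, hP, k₀, k₁, if_false, Ty.norm, hQ]

/-- The linear overhead at each tuple is just what `cost_tup` and `cost_cotup` absorb, so the pass
stays within the product of the sizes. -/
theorem computes_indef_tm {P Q : Ty} (t : O false P Q) :
    Computes .indef [Q.ann, P.ann, data false t] (100 * (P.size * Q.size))
      (IndAnswer P Q (ind false t)) := by
  induction t using O.induction with
  | nul P =>
    refine Wp.computes ?_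
    simp only [procedure, indefBody, wp_bind, data_nul, wp_root, wp_success]
    exact ⟨.inr ⟨_, rfl, ind_nul⟩, cost_const _ _ (by omega)⟩
  | conul Q =>
    refine Wp.computes ?_
    simp only [procedure, indefBody, wp_bind, data_conul, wp_root, wp_success]
    exact ⟨.inr ⟨_, rfl, ind_conul⟩, cost_const _ _ (by omega)⟩
  | leg i P₀ P₁ Q t ih =>
    refine Wp.computes ?_
    simp only [procedure, indefBody, wp_bind, data_leg, wp_root, wp_child]
    refine ih.callFn fun r n hr hn => ?_
    refine (wp_indefLeg hr).mono fun r' τ h => ⟨h.1, ?_⟩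
    exact (cost_leg hn (c := 17) (by omega) rfl).trans' (by omega)
  | coleg i P Q₀ Q₁ t ih =>
    refine Wp.computes ?_
    simp only [procedure, indefBody, wp_bind, data_coleg, wp_root, Bool.not_false, wp_child]
    refine ih.callFn fun r n hr hn => ?_
    refine (wp_indefLeg (p := true) (t := flip false t) hr.swap).mono fun r' τ h => ⟨h.1.swap, ?_⟩
    exact (cost_coleg hn (c := 17) (by omega) rfl).trans' (by omega)
  | tup P Q₀ Q₁ t u iht ihu =>
    refine Wp.computes ?_
    have hs := P.size_pos
    simp only [procedure, indefBody, wp_bind, data_tup, wp_root, wp_unCons, wp_child]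
    refine iht.callFn fun r n hr hn => ?_
    refine ihu.callFn fun r' m hr' hm => ?_
    refine (wp_indefTup hr hr').mono fun r' τ h => ⟨h.1, ?_⟩
    exact (cost_tup hn hm (c := 15 + 60 * P.size) (by omega) rfl).trans' (by omega)
  | cotup P₀ P₁ Q t u iht ihu =>
    refine Wp.computes ?_
    have hs := Q.size_pos
    simp only [procedure, indefBody, wp_bind, data_cotup, wp_root, wp_unCons, Bool.not_false,
      wp_child]
    refine iht.callFn fun r n hr hn => ?_
    refine ihu.callFn fun r' m hr' hm => ?_
    refine (wp_indefTup (p := true) (t := flip false t) (u := flip false u) hr.swap hr'.swap).mono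
      fun r' τ h => ⟨h.1.swap, ?_⟩
    exact (cost_cotup hn hm (c := 15 + 60 * Q.size) (by omega) rfl).trans' (by omega)

open Code O

theorem computes_indef {p : Bool} {P Q : Ty} (t : O p P Q) :
    Computes .indef (bif p then [P.ann, Q.ann, data p t] else [Q.ann, P.ann, data p t])
      (100 * (P.size * Q.size)) (IndAnswer P Q (ind p t)) := by
  cases p
  · exact computes_indef_tm t
  · obtain ⟨v, n, h₁, h₂, h₃⟩ := computes_indef_tm (P := Q) (Q := P) t
    exact ⟨v, n, h₁, h₂.swap, by rwa [Nat.mul_comm P.size]⟩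

/-! ### Factorization -/

/-- The answer of `factor p i` for the term `t`. -/
def FactorAnswer (p i : Bool) {P₀ P₁ Q : Ty} (t : O p (.node p P₀ P₁) Q) (u : Data) : Prop :=
  (u = .nullary .nil ∧ ¬ ∃ v, Conv p t (leg p i v)) ∨
    ∃ v, u = .tag .found (data p v) ∧ Conv p t (leg p i v)

/-- To be used when no factor is visible in the syntax: `hfac` says that then a factorization can
come only from a constant of `Q`, and such a constant indeed provides one. -/
theorem wp_viaIndef {p i : Bool} {P₀ P₁ Q : Ty} {t : O p (.node p P₀ P₁) Q} {r : Data}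
    (h : IndAnswer (.node p P₀ P₁) Q (ind p t) r)
    (hfac : (∃ v, Conv p t (leg p i v)) → ind p t ≠ none ∧ Q.ptd = p) {τ : ℕ} :
    (viaIndef p (Ty.node p P₀ P₁).ann Q.ann r).Wp τ fun u τ' =>
      FactorAnswer p i t u ∧ τ' ≤ τ + 13 := by
  rcases h with ⟨h, rfl⟩ | ⟨c, rfl, h⟩
  · simp only [viaIndef, wp_bind, wp_isFound_nil, wp_failure]
    exact ⟨.inl ⟨rfl, fun hv => (hfac hv).1 h⟩, by omega⟩
  · simp only [viaIndef, wp_bind, wp_isFound_found, wp_pointed, wp_ite, wp_success, wp_failure,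
      wp_canon]
    by_cases hQ : Q.ptd = p
    · obtain ⟨v, hv, hc⟩ := exists_conv_leg_of_ind i h hQ
      rw [if_pos hQ]
      by_cases hP : (Ty.node p P₀ P₁).ptd = p
      · rw [if_pos hP] at hv ⊢
        rw [Ty.norm, hP, hQ, if_pos rfl] at hv
        exact ⟨.inr ⟨v, by rw [hv], hc⟩, by omega⟩
      · rw [if_neg hP] at hv ⊢
        exact ⟨.inr ⟨v, by rw [hv], hc⟩, by omega⟩
    · rw [if_neg hQ]
      exact ⟨.inl ⟨rfl, fun hv => hQ (hfac hv).2⟩, by omega⟩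

/-- The indefiniteness answer is carried along with the factor, so it need not be recomputed at
every node. A separate `indef` pass is started only at a leg of the sought polarity, where the
recursion ends. -/
theorem computes_factor {p : Bool} (i : Bool) {P₀ P₁ Q : Ty} (t : O p (.node p P₀ P₁) Q) :
    Computes (.factor p i) [(Ty.node p P₀ P₁).ann, Q.ann, data p t]
      (200 * ((Ty.node p P₀ P₁).size * Q.size))
      (fun v => ∃ r u, v = .cons r u ∧ IndAnswer (.node p P₀ P₁) Q (ind p t) r ∧
        FactorAnswer p i t u) := by
  suffices h : ∀ {P Q : Ty} (t : O p P Q) {P₀ P₁} (h : P = .node p P₀ P₁),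
      Computes (.factor p i) [P.ann, Q.ann, data p t] (200 * (P.size * Q.size))
        (fun v => ∃ r u, v = .cons r u ∧ IndAnswer P Q (ind p t) r ∧ FactorAnswer p i (h ▸ t) u)
      from h t rfl
  clear t Q P₀ P₁
  intro P Q t
  induction t using O.induction with
  | nul P =>
    rintro P₀ P₁ rfl
    refine Wp.computes ?_
    simp only [procedure, factorBody, wp_bind, data_nul, wp_root, wp_success, wp_mkCons]
    refine ⟨⟨_, _, rfl, .inr ⟨_, rfl, ind_nul⟩, .inr ⟨nul p _, ?_, conv_unit _ _⟩⟩,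
      cost_const _ _ (by omega)⟩
    rw [data_nul]
  | conul Q => intro _ _ h; exact absurd h.symm Ty.node_ne_unit
  | leg k A₀ A₁ Q t ih =>
    intro P₀ P₁ h
    obtain ⟨-, rfl, rfl⟩ := Ty.node_inj h
    refine Wp.computes ?_
    have hs := cost_const (K := 1) (Ty.node p A₀ A₁) Q le_rfl
    have hc := computes_indef (leg p k t)
    rw [data_leg] at hc ⊢
    simp only [procedure, factorBody, wp_bind, wp_root, if_true]
    refine hc.callFn fun r n hr hn => ?_
    by_cases hk : k = i
    · subst hk
      simp only [if_true, wp_bind, wp_success, wp_mkCons]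
      exact ⟨⟨_, _, rfl, hr, .inr ⟨t, rfl, .refl _⟩⟩, by omega⟩
    · simp only [if_neg hk, wp_bind]
      refine (wp_viaIndef (i := i) hr ?_).mono fun u τ hu => ?_
      · rintro ⟨v, hv⟩
        have := indefinite_of_conv_leg hk hv
        exact ⟨this, ptd_of_conv_leg hk hv this⟩
      · simp only [wp_mkCons]
        exact ⟨⟨_, _, rfl, hr, hu.1⟩, by omega⟩
  | coleg j P Q₀ Q₁ t ih =>
    rintro P₀ P₁ rfl
    refine Wp.computes ?_
    have hp : (!p) ≠ p := by cases p <;> simp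
    simp only [procedure, factorBody, wp_bind, data_coleg, wp_root, if_neg hp, wp_child]
    refine (ih rfl).callFn ?_
    rintro _ n ⟨r, u, rfl, hr, hu⟩ hn
    simp only [wp_unCons]
    refine (wp_indefLeg (p := !p) (t := flip p t) (by rw [ind_flip]; exact hr.swap)).mono
      fun r' τ ⟨hr', hτ⟩ => ?_
    rw [← flip_coleg, ind_flip] at hr'
    rcases hu with ⟨rfl, hu⟩ | ⟨v, rfl, hv⟩
    · simp only [wp_isFound_nil, wp_bind]
      refine (wp_viaIndef (i := i) hr'.swap ?_).mono fun u τ' hu => ?_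
      · rintro ⟨v, hv⟩
        -- The subterm has no factor, so any factorization of the whole must come from
        -- indefiniteness.
        exact (exists_conv_leg_of_coleg hv).resolve_left hu
      · simp only [wp_mkCons]
        refine ⟨⟨_, _, rfl, hr'.swap, hu.1⟩, ?_⟩
        exact (cost_coleg hn (c := 100) (by omega) rfl).trans' (by omega)
    · simp only [wp_isFound_found, wp_bind, wp_mkTag, wp_success, wp_mkCons]
      refine ⟨⟨_, _, rfl, hr'.swap, .inr ⟨coleg p j v, ?_, ?_⟩⟩, ?_⟩
      · rw [data_coleg]
      · exact hv.coleg.trans (Conv.swap v).symm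
      · exact (cost_coleg hn (c := 100) (by omega) rfl).trans' (by omega)
  | tup P Q₀ Q₁ t u iht ihu =>
    rintro P₀ P₁ rfl
    refine Wp.computes ?_
    have hs := (Ty.node p P₀ P₁).size_pos
    simp only [procedure, factorBody, wp_bind, data_tup, wp_root, wp_unCons, wp_child]
    refine (iht rfl).callFn ?_
    rintro _ n ⟨r₀, u₀, rfl, hr₀, hu₀⟩ hn
    simp only [wp_unCons]
    refine (ihu rfl).callFn ?_
    rintro _ m ⟨r₁, u₁, rfl, hr₁, hu₁⟩ hm
    simp only [wp_unCons]
    refine (wp_indefTup hr₀ hr₁).mono fun r τ ⟨hr, hτ⟩ => ?_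
    have cost : ∀ {τ'}, τ' ≤ τ + 20 → τ' ≤ 200 * ((Ty.node p P₀ P₁).size * (Ty.node p Q₀ Q₁).size) :=
      fun h => (cost_tup hn hm (c := 100 + 60 * (Ty.node p P₀ P₁).size) (by omega) rfl).trans'
        (by omega)
    have none : (¬ (∃ v, Conv p t (leg p i v)) ∨ ¬ ∃ v, Conv p u (leg p i v)) →
        ¬ ∃ v, Conv p (tup p t u) (leg p i v) := by
      rintro h ⟨v, hv⟩
      rw [conv_node] at hv
      have h₀ := hv false
      have h₁ := hv true
      rw [res_tup, res_leg] at h₀ h₁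
      exact h.elim (fun h => h ⟨_, h₀⟩) (fun h => h ⟨_, h₁⟩)
    rcases hu₀ with ⟨rfl, hu₀⟩ | ⟨v₀, rfl, hv₀⟩
    · rcases hu₁ with ⟨rfl, hu₁⟩ | ⟨v₁, rfl, hv₁⟩ <;>
        simp only [wp_isFound_nil, wp_isFound_found, wp_bind, wp_failure, wp_mkCons] <;>
        exact ⟨⟨_, _, rfl, hr, .inl ⟨rfl, none (.inl hu₀)⟩⟩, cost (by omega)⟩
    · rcases hu₁ with ⟨rfl, hu₁⟩ | ⟨v₁, rfl, hv₁⟩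
      · simp only [wp_isFound_nil, wp_isFound_found, wp_bind, wp_failure, wp_mkCons]
        exact ⟨⟨_, _, rfl, hr, .inl ⟨rfl, none (.inr hu₁)⟩⟩, cost (by omega)⟩
      · simp only [wp_isFound_found, wp_bind, wp_mkTag₂, wp_success, wp_mkCons]
        refine ⟨⟨_, _, rfl, hr, .inr ⟨tup p v₀ v₁, ?_, ?_⟩⟩, cost (by omega)⟩
        · rw [data_tup]
        · rw [conv_node]
          rintro (_ | _) <;> rw [res_leg, res_tup, res_tup]
          · exact hv₀
          · exact hv₁
  | cotup => intro _ _ h; exact absurd (Ty.node_inj h).1 (by cases p <;> simp)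

/-! ### Comparison -/

/-- The domain of the terms between `P` and `Q`. -/
abbrev dom (p : Bool) (P Q : Ty) : Ty := bif p then P else Q

/-- The codomain of the terms between `P` and `Q`. -/
abbrev cod (p : Bool) (P Q : Ty) : Ty := bif p then Q else P

/-- The correct answer to the comparison of two terms. -/
def EqAnswer {p : Bool} {P Q : Ty} (f g : O p P Q) (v : Data) : Prop :=
  ∃ b, v = .leaf (.bit b) ∧ (b = true ↔ Conv p f g)

/-- A bound for the number of steps of a comparison. -/
def eqBound (P Q : Ty) : ℕ := 3000 * ((P.hgt + Q.hgt) * (P.size * Q.size))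

/-- `equivalent` compares `f` and `g` correctly and within the bound. -/
def EqSpec {p : Bool} {P Q : Ty} (f g : O p P Q) : Prop :=
  Computes .equivalent [(dom p P Q).ann, (cod p P Q).ann, data p f, data p g] (eqBound P Q)
    (EqAnswer f g)

theorem eqBound_comm (P Q : Ty) : eqBound P Q = eqBound Q P := by
  rw [eqBound, eqBound, Nat.add_comm, Nat.mul_comm P.size]

theorem eqAnswer_flip {p : Bool} {P Q : Ty} {f g : O p P Q} {v : Data} :
    EqAnswer (flip p f) (flip p g) v ↔ EqAnswer f g v := by
  simp only [EqAnswer, conv_flip]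

theorem eqSpec_flip {p : Bool} {P Q : Ty} {f g : O p P Q} :
    EqSpec (flip p f) (flip p g) ↔ EqSpec f g := by
  unfold EqSpec
  rw [eqBound_comm, data_flip, data_flip]
  simp only [Computes, eqAnswer_flip]
  cases p <;> rfl

theorem EqAnswer.of_iff {p q : Bool} {P Q P' Q' : Ty} {f g : O p P Q} {f' g' : O q P' Q'} {v : Data}
    (h : EqAnswer f' g' v) (hiff : Conv p f g ↔ Conv q f' g') : EqAnswer f g v := by
  obtain ⟨b, hv, hb⟩ := h
  exact ⟨b, hv, hb.trans hiff.symm⟩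

/-! ### Recursive time bound for comparisons -/

theorem Ty.hgt_sel (p i : Bool) (A B : Ty) : (sel i A B).hgt + 1 ≤ (Ty.node p A B).hgt := by
  cases p <;> cases i <;> simp [Ty.node, Ty.hgt] <;> omega

/-- Passing to a component lowers the height by at least one, which frees 3000 times the product of
the sizes for local work. -/
theorem eqBound_leg (p i : Bool) (P₀ P₁ Q : Ty) :
    eqBound (sel i P₀ P₁) Q + 3000 * ((Ty.node p P₀ P₁).size * Q.size) ≤
      eqBound (.node p P₀ P₁) Q := by
  have hs : (sel i P₀ P₁).size ≤ (Ty.node p P₀ P₁).size := by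
    rw [Ty.size_node]; have := Ty.size_sel i P₀ P₁; omega
  have hh := Ty.hgt_sel p i P₀ P₁
  calc _ ≤ 3000 * (((sel i P₀ P₁).hgt + Q.hgt) * ((Ty.node p P₀ P₁).size * Q.size)) +
        3000 * ((Ty.node p P₀ P₁).size * Q.size) := by unfold eqBound; gcongr
    _ = 3000 * (((sel i P₀ P₁).hgt + 1 + Q.hgt) * ((Ty.node p P₀ P₁).size * Q.size)) := by ring
    _ ≤ _ := by unfold eqBound; gcongr

theorem eqBound_coleg (p j : Bool) (P Q₀ Q₁ : Ty) :
    eqBound P (sel j Q₀ Q₁) + 3000 * (P.size * (Ty.node p Q₀ Q₁).size) ≤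
      eqBound P (.node p Q₀ Q₁) := by
  rw [eqBound_comm P, eqBound_comm P, Nat.mul_comm P.size]
  exact eqBound_leg p j Q₀ Q₁ P

/-- Two recursive calls are affordable because the sizes of the components add up to less than that
of the node; the drop in height still pays for the local work. -/
theorem eqBound_tup (p : Bool) (P Q₀ Q₁ : Ty) :
    eqBound P Q₀ + eqBound P Q₁ + 3000 * (P.size * (Ty.node p Q₀ Q₁).size) ≤
      eqBound P (.node p Q₀ Q₁) := by
  have h₀ := Ty.hgt_sel p false Q₀ Q₁
  have h₁ := Ty.hgt_sel p true Q₀ Q₁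
  change Q₀.hgt + 1 ≤ _ at h₀
  change Q₁.hgt + 1 ≤ _ at h₁
  obtain ⟨h, hh⟩ : ∃ h, (Ty.node p Q₀ Q₁).hgt = h + 1 := ⟨_, (Nat.sub_add_cancel (by omega)).symm⟩
  have k₀ : Q₀.hgt ≤ h := by omega
  have k₁ : Q₁.hgt ≤ h := by omega
  calc _ ≤ 3000 * ((P.hgt + h) * (P.size * Q₀.size)) + 3000 * ((P.hgt + h) * (P.size * Q₁.size)) +
        3000 * (P.size * (Ty.node p Q₀ Q₁).size) := by unfold eqBound; gcongr
    _ ≤ 3000 * ((P.hgt + h) * (P.size * (1 + Q₀.size + Q₁.size))) +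
        3000 * (P.size * (Ty.node p Q₀ Q₁).size) := by
      have : P.size * Q₀.size + P.size * Q₁.size ≤ P.size * (1 + Q₀.size + Q₁.size) := by
        rw [← Nat.mul_add]; exact Nat.mul_le_mul_left _ (by omega)
      rw [← Nat.mul_add, ← Nat.mul_add (P.hgt + h)]
      exact Nat.add_le_add_right (Nat.mul_le_mul_left _ (Nat.mul_le_mul_left _ this)) _
    _ = 3000 * ((P.hgt + (h + 1)) * (P.size * (Ty.node p Q₀ Q₁).size)) := by
      rw [Ty.size_node]; ring
    _ = _ := by rw [eqBound, hh]

theorem wp_compareUnder {p i q : Bool} {P₀ P₁ Q : Ty} {f g : O p (sel i P₀ P₁) Q}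
    (h : EqSpec f g) {τ : ℕ} :
    (compareUnder p i (dom p (.node q P₀ P₁) Q).ann (cod p (.node q P₀ P₁) Q).ann
      (data p f) (data p g)).Wp τ fun v τ' =>
        EqAnswer f g v ∧ τ' ≤ τ + 6 + eqBound (sel i P₀ P₁) Q := by
  cases p <;>
  · simp only [compareUnder, dom, cod, cond_true, cond_false, if_true, Bool.false_eq_true, if_false,
      wp_bind, wp_child]
    exact h.callFn fun v n hv hn => ⟨hv, by omega⟩

theorem wp_compareUnder_not {p i q : Bool} {P Q₀ Q₁ : Ty} {f g : O p P (sel i Q₀ Q₁)}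
    (h : EqSpec f g) {τ : ℕ} :
    (compareUnder (!p) i (dom p P (.node q Q₀ Q₁)).ann (cod p P (.node q Q₀ Q₁)).ann
      (data p f) (data p g)).Wp τ fun v τ' =>
        EqAnswer f g v ∧ τ' ≤ τ + 6 + eqBound P (sel i Q₀ Q₁) := by
  have := wp_compareUnder (q := q) (eqSpec_flip.2 h) (τ := τ)
  rw [data_flip, data_flip, eqBound_comm] at this
  simp only [eqAnswer_flip] at this
  cases p <;> exact this

/-- The clock starts at 4 because the two root labels of the types have been read. -/
theorem wp_split {p : Bool} {P Q₀ Q₁ : Ty} {f g : O p P (.node p Q₀ Q₁)}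
    (h : ∀ i (f g : O p P (sel i Q₀ Q₁)), EqSpec f g) :
    (equivalentBody.split p (dom p P (.node p Q₀ Q₁)).ann (cod p P (.node p Q₀ Q₁)).ann
      (data p f) (data p g)).Wp 4 fun v τ' =>
        EqAnswer f g v ∧ τ' ≤ eqBound P (.node p Q₀ Q₁) := by
  have hs := cost_const (K := 1) P (Ty.node p Q₀ Q₁) le_rfl
  have hb := eqBound_tup p P Q₀ Q₁
  simp only [equivalentBody.split, wp_bind]
  refine (computes_restrict false f).callFn ?_
  rintro _ n₁ rfl hn₁
  refine (computes_restrict false g).callFn ?_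
  rintro _ n₂ rfl hn₂
  refine (wp_compareUnder_not (h false _ _)).mono ?_
  rintro _ τ ⟨⟨b, rfl, hb₀⟩, hτ⟩
  simp only [wp_getLabel]
  change τ ≤ _ + eqBound P Q₀ at hτ
  cases b
  · refine ⟨⟨false, rfl, iff_of_false (by simp) fun hfg => ?_⟩, by omega⟩
    exact absurd (hb₀.2 (conv_node.1 hfg false)) (by simp)
  · simp only [wp_bind]
    refine (computes_restrict true f).callFn ?_
    rintro _ n₃ rfl hn₃
    refine (computes_restrict true g).callFn ?_
    rintro _ n₄ rfl hn₄
    refine (wp_compareUnder_not (h true _ _)).mono ?_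
    rintro v τ' ⟨hv, hτ'⟩
    change τ' ≤ _ + eqBound P Q₁ at hτ'
    refine ⟨hv.of_iff ⟨fun hfg => conv_node.1 hfg true, fun hfg => conv_node.2 ?_⟩, by omega⟩
    rintro (_ | _)
    · exact hb₀.1 rfl
    · exact hfg

/-! ### Cancellation and comparison of definite terms -/

theorem wp_cancellable {p i : Bool} {P₀ P₁ : Ty} {τ : ℕ} {Q : Bool → ℕ → Prop} :
    (cancellable p i (Ty.node p P₀ P₁).ann).Wp τ Q ↔
      Q (!((sel i P₀ P₁).ptd == p && (sel (!i) P₀ P₁).ptd == !p)) (τ + 14) := by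
  simp only [cancellable, wp_bind, wp_child, wp_pointed, wp_pure]

theorem wp_factorOf {p i : Bool} {P₀ P₁ Q : Ty} (t : O p (.node p P₀ P₁) Q) {τ : ℕ} :
    (factorOf p i (dom p (.node p P₀ P₁) Q).ann (cod p (.node p P₀ P₁) Q).ann (data p t)).Wp τ
      fun r τ' => ((r = none ∧ ¬ ∃ v, Conv p t (leg p i v)) ∨
        ∃ v, r = some (data p v) ∧ Conv p t (leg p i v)) ∧
        τ' ≤ τ + 5 + 200 * ((Ty.node p P₀ P₁).size * Q.size) := by
  have h₁ : actedOn p (dom p (.node p P₀ P₁) Q).ann (cod p (.node p P₀ P₁) Q).ann =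
      (Ty.node p P₀ P₁).ann := by cases p <;> rfl
  have h₂ : actedOn (!p) (dom p (.node p P₀ P₁) Q).ann (cod p (.node p P₀ P₁) Q).ann =
      Q.ann := by cases p <;> rfl
  simp only [factorOf, wp_bind, h₁, h₂]
  refine (computes_factor i t).callFn ?_
  rintro _ n ⟨r, u, rfl, -, hu⟩ hn
  simp only [wp_unCons]
  rcases hu with ⟨rfl, hu⟩ | ⟨v, rfl, hv⟩
  · rw [wp_isFound_nil]
    exact ⟨.inl ⟨rfl, hu⟩, by omega⟩
  · rw [wp_isFound_found]
    exact ⟨.inr ⟨v, rfl, hv⟩, by omega⟩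

theorem wp_factorOf_not {p i : Bool} {P Q₀ Q₁ : Ty} (t : O p P (.node (!p) Q₀ Q₁)) {τ : ℕ} :
    (factorOf (!p) i (dom p P (.node (!p) Q₀ Q₁)).ann (cod p P (.node (!p) Q₀ Q₁)).ann
      (data p t)).Wp τ
      fun r τ' => ((r = none ∧ ¬ ∃ v, Conv p t (coleg p i v)) ∨
        ∃ v, r = some (data p v) ∧ Conv p t (coleg p i v)) ∧
        τ' ≤ τ + 5 + 200 * (P.size * (Ty.node (!p) Q₀ Q₁).size) := by
  have := wp_factorOf (i := i) (flip p t) (τ := τ)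
  rw [Nat.mul_comm P.size]
  have hdom : dom (!p) (.node (!p) Q₀ Q₁) P = dom p P (.node (!p) Q₀ Q₁) := by cases p <;> rfl
  have hcod : cod (!p) (.node (!p) Q₀ Q₁) P = cod p P (.node (!p) Q₀ Q₁) := by cases p <;> rfl
  rw [data_flip, hdom, hcod] at this
  refine this.mono ?_
  rintro r τ' ⟨h, hτ⟩
  refine ⟨?_, hτ⟩
  rcases h with ⟨h, hn⟩ | ⟨v, h, hv⟩
  · exact .inl ⟨h, fun ⟨v, hv⟩ => hn ⟨flip p v, by rwa [← flip_coleg, conv_flip]⟩⟩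
  · obtain ⟨v, rfl⟩ := flip_surjective v
    exact .inr ⟨v, by rwa [← data_flip], by rwa [← flip_coleg, conv_flip] at hv⟩

theorem conv_of_conv_coleg {p j : Bool} {P Q₀ Q₁ : Ty}
    (hc : ¬ ((sel j Q₀ Q₁).ptd = (!p) ∧ (sel (!j) Q₀ Q₁).ptd = p)) {f g : O p P (sel j Q₀ Q₁)}
    (h : Conv p (coleg p j f) (coleg p j g)) : Conv p f g := by
  rw [← conv_flip] at h ⊢
  rw [flip_coleg, flip_coleg] at h
  exact conv_of_conv_leg (by rwa [Bool.not_not]) h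

/-- A definite term that does not factor through any coleg is convertible only to terms with
convertible factors. -/
theorem conv_of_conv_leg_of_not_coleg {p i : Bool} {P₀ P₁ Q₀ Q₁ : Ty}
    {f g : O p (sel i P₀ P₁) (.node (!p) Q₀ Q₁)} (h : Conv p (leg p i f) (leg p i g))
    (hf : ∀ j v, ¬ Conv p (leg p i f) (coleg p j v)) : Conv p f g := by
  -- The predicate is false on every term that starts with a coleg. A permutation step could violate
  -- its constancy only at a term convertible to `leg p i f`, and `hf` excludes that.
  let φ (t : O p (.node p P₀ P₁) (.node (!p) Q₀ Q₁)) : Prop := match view p t with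
    | .inl s => ∃ g, s = ⟨i, g⟩ ∧ Conv p g f
    | .inr _ => False
  have hself : ∀ g, φ (leg p i g) ↔ Conv p g f := by
    intro g
    simp only [φ, view_leg]
    exact ⟨fun ⟨g', e, h⟩ => by cases e; exact h, fun h => ⟨g, rfl, h⟩⟩
  have hother : ∀ {k} (g : O p (sel k P₀ P₁) _), k ≠ i → ¬ φ (leg p k g) := by
    intro k g hk
    simp only [φ, view_leg]
    rintro ⟨g', e, -⟩
    exact hk (congrArg Sigma.fst e)
  have hco : ∀ {j} (w : O p _ (sel j Q₀ Q₁)), ¬ φ (coleg p j w) := by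
    intro j w; simp only [φ, view_coleg, not_false_eq_true]
  have key := h.core_eq φ ?_ ?_ ?_
  · rw [eq_iff_iff, hself, hself] at key
    exact (key.1 (.refl _)).symm
  · intro k g g' hg
    rw [eq_iff_iff]
    by_cases hk : k = i
    · subst hk
      rw [hself, hself]
      exact ⟨fun h => hg.symm.trans h, fun h => hg.trans h⟩
    · exact iff_of_false (hother _ hk) (hother _ hk)
  · intro j w w' _
    exact propext (iff_of_false (hco _) (hco _))
  · intro k j w
    refine propext (iff_of_false ?_ (hco _))
    by_cases hk : k = i
    · subst hk
      rw [hself]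
      exact fun h => hf j (leg p k w) (h.symm.leg.trans (Conv.swap w))
    · exact hother _ hk

/-- At most four factorizations are tried, each within 200 times the product of the sizes. The
unused 2000 times that product is kept for the two indefiniteness tests that come before. -/
theorem wp_compareDefinite_leg {p i : Bool} {P₀ P₁ Q₀ Q₁ : Ty}
    (f' : O p (sel i P₀ P₁) (.node (!p) Q₀ Q₁)) (g : O p (.node p P₀ P₁) (.node (!p) Q₀ Q₁))
    (hf : ind p (leg p i f') = none) (hg : ind p g = none)
    (hleg : ∀ i (f g : O p (sel i P₀ P₁) (.node (!p) Q₀ Q₁)), EqSpec f g)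
    (hcoleg : ∀ j (f g : O p (.node p P₀ P₁) (sel j Q₀ Q₁)), EqSpec f g) {τ : ℕ} :
    (compareDefinite (dom p (.node p P₀ P₁) (.node (!p) Q₀ Q₁)).ann
      (cod p (.node p P₀ P₁) (.node (!p) Q₀ Q₁)).ann (data p (leg p i f')) (data p g)).Wp τ
      fun v τ' => EqAnswer (leg p i f') g v ∧
        τ' + 2000 * ((Ty.node p P₀ P₁).size * (Ty.node (!p) Q₀ Q₁).size) ≤
          τ + eqBound (.node p P₀ P₁) (.node (!p) Q₀ Q₁) := by
  have hs := cost_const (K := 1) (Ty.node p P₀ P₁) (Ty.node (!p) Q₀ Q₁) le_rfl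
  have bleg := fun i => eqBound_leg p i P₀ P₁ (.node (!p) Q₀ Q₁)
  have bcoleg := fun j => eqBound_coleg (!p) j (.node p P₀ P₁) Q₀ Q₁
  have fac := fun i t τ => wp_factorOf (p := p) (i := i) (P₀ := P₀) (P₁ := P₁)
    (Q := .node (!p) Q₀ Q₁) t (τ := τ)
  have cofac := fun j t τ => wp_factorOf_not (p := p) (i := j) (P := .node p P₀ P₁)
    (Q₀ := Q₀) (Q₁ := Q₁) t (τ := τ)
  -- As an atom, the product of the sizes leaves only linear bounds.
  generalize (Ty.node p P₀ P₁).size * (Ty.node (!p) Q₀ Q₁).size = S at hs bleg bcoleg fac cofac ⊢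
  have hp : p ≠ !p := by cases p <;> simp
  have acted : actedOn p (dom p (.node p P₀ P₁) (.node (!p) Q₀ Q₁)).ann
      (cod p (.node p P₀ P₁) (.node (!p) Q₀ Q₁)).ann = (Ty.node p P₀ P₁).ann := by
    cases p <;> rfl
  have acted' : actedOn (!p) (dom p (.node p P₀ P₁) (.node (!p) Q₀ Q₁)).ann
      (cod p (.node p P₀ P₁) (.node (!p) Q₀ Q₁)).ann = (Ty.node (!p) Q₀ Q₁).ann := by
    cases p <;> rfl
  have canc : ∀ {q : Bool} (a b : Bool), (!(a == q && b == !q)) = true ↔ ¬ (a = q ∧ b = !q) := by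
    decide
  -- A definite term that is both a leg and a coleg has a factor common to both. Its mere existence
  -- restricts the polarities of the two components.
  have common : ∀ {j w}, Conv p (leg p i f') (coleg p j w) →
      ∃ u : O p (sel i P₀ P₁) (sel j Q₀ Q₁), Conv p w (leg p i u) := by
    intro j w h
    refine (exists_conv_leg_of_coleg h.symm).resolve_right fun h' => h'.1 ?_
    rw [← h.ind_eq, hf]
  simp only [compareDefinite, wp_bind, data_leg, wp_root]
  rcases core_cases p g with ⟨k, g', rfl⟩ | ⟨j, g', rfl⟩
  · simp only [data_leg, wp_root, if_true]
    by_cases hik : i = k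
    swap
    · simp only [if_neg hik, wp_answer]
      have := bleg i
      exact ⟨⟨false, rfl, iff_of_false (by simp) fun h => indefinite_of_conv_leg hik h hf⟩,
        by omega⟩
    subst hik
    simp only [if_true, wp_bind, acted, wp_cancellable, wp_ite]
    by_cases hc : (sel i P₀ P₁).ptd = p ∧ (sel (!i) P₀ P₁).ptd = !p
    swap
    · rw [if_pos ((canc _ _).2 hc)]
      refine (wp_compareUnder (hleg i f' g')).mono fun v τ' hv => ?_
      have := bleg i
      exact ⟨hv.1.of_iff ⟨conv_of_conv_leg hc, .leg⟩, by omega⟩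
    rw [if_neg fun h => (canc _ _).1 h hc]
    -- Here the `i`-th component of `P` has polarity `p`. The common factor forces the same on the
    -- `j`-th component of `Q`, which makes this coleg cancellable.
    have under : ∀ {j f₁ g₁}, Conv p (leg p i f') (coleg p j f₁) →
        Conv p (leg p i g') (coleg p j g₁) →
        (Conv p (leg p i f') (leg p i g') ↔ Conv p f₁ g₁) := by
      intro j f₁ g₁ h₁ h₂
      refine ⟨fun h => conv_of_conv_coleg ?_ (h₁.symm.trans (h.trans h₂)),
        fun h => h₁.trans (h.coleg.trans h₂.symm)⟩
      rintro ⟨hj, -⟩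
      obtain ⟨u, -⟩ := common h₁
      exact hp (hc.1.symm.trans (ptd_of_ptd u hj))
    -- One argument for both searches, with the continuation `k` abstracted. When the search fails,
    -- the continuation learns that if the terms are convertible, then the first has no
    -- factorization through coleg `j`.
    have cofactors : ∀ (j : Bool) {τ₁ : ℕ} {k : Option Data → Option Data → Code Data Data},
        τ₁ ≤ τ + 100 + 400 * S →
        (∀ f₁ g₁, k (some f₁) (some g₁) =
          compareUnder (!p) j (dom p (.node p P₀ P₁) (.node (!p) Q₀ Q₁)).ann
            (cod p (.node p P₀ P₁) (.node (!p) Q₀ Q₁)).ann f₁ g₁) →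
        (∀ b, k none b = k none none) → (∀ a, k (some a) none = k none none) →
        (∀ τ₂, τ₂ ≤ τ₁ + 10 + 400 * S →
          (Conv p (leg p i f') (leg p i g') → ∀ v, ¬ Conv p (leg p i f') (coleg p j v)) →
          (k none none).Wp τ₂ fun v τ' => EqAnswer (leg p i f') (leg p i g') v ∧
            τ' + 2000 * S ≤ τ + eqBound (.node p P₀ P₁) (.node (!p) Q₀ Q₁)) →
        (factorOf (!p) j (dom p (.node p P₀ P₁) (.node (!p) Q₀ Q₁)).ann
            (cod p (.node p P₀ P₁) (.node (!p) Q₀ Q₁)).ann (data p (leg p i f'))).Wp τ₁ fun a τ' =>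
          (factorOf (!p) j (dom p (.node p P₀ P₁) (.node (!p) Q₀ Q₁)).ann
            (cod p (.node p P₀ P₁) (.node (!p) Q₀ Q₁)).ann (data p (leg p i g'))).Wp τ' fun b τ' =>
            (k a b).Wp τ' fun v τ' => EqAnswer (leg p i f') (leg p i g') v ∧
              τ' + 2000 * S ≤ τ + eqBound (.node p P₀ P₁) (.node (!p) Q₀ Q₁) := by
      intro j τ₁ k hτ₁ hk hk₀ hk₁ hc
      refine (cofac _ _ _).mono ?_
      rintro r τ₂ ⟨hr, hτ₂⟩
      refine (cofac _ _ _).mono ?_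
      rintro r' τ₃ ⟨hr', hτ₃⟩
      rcases hr with ⟨rfl, hr⟩ | ⟨f₁, rfl, hf₁⟩
      · rw [hk₀]
        exact hc _ (by omega) fun _ v hv => hr ⟨v, hv⟩
      rcases hr' with ⟨rfl, hr'⟩ | ⟨g₁, rfl, hg₁⟩
      · rw [hk₁]
        exact hc _ (by omega) fun h v hv => hr' ⟨v, h.symm.trans hv⟩
      rw [hk]
      refine (wp_compareUnder_not (hcoleg j f₁ g₁)).mono fun v τ' hv => ?_
      have := bcoleg j
      exact ⟨hv.1.of_iff (under hf₁ hg₁), by omega⟩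
    rw [← data_leg, ← data_leg]
    refine cofactors false ?_ (fun _ _ => rfl) (fun _ => rfl) (fun _ => rfl) fun τ₁ hτ₁ h₀ => ?_
    · omega
    simp only [wp_bind]
    refine cofactors true ?_ (fun _ _ => rfl) (fun _ => rfl) (fun _ => rfl) fun τ₂ hτ₂ h₁ => ?_
    · omega
    refine (wp_compareUnder (hleg i f' g')).mono fun v τ' hv => ?_
    have := bleg i
    refine ⟨hv.1.of_iff ⟨fun h => conv_of_conv_leg_of_not_coleg h ?_, .leg⟩, by omega⟩
    rintro (_ | _)
    exacts [h₀ h, h₁ h]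
  · simp only [data_coleg, wp_root, if_neg hp, wp_bind, acted, acted', wp_cancellable, wp_ite]
    rw [← data_leg, ← data_coleg]
    by_cases hj : (sel j Q₀ Q₁).ptd = (!p) ∧ (sel (!j) Q₀ Q₁).ptd = !!p
    swap
    · rw [if_pos ((canc _ _).2 hj)]
      simp only [compareMixed, wp_bind]
      refine (cofac _ _ _).mono ?_
      rintro r τ₁ ⟨⟨rfl, hr⟩ | ⟨f₁, rfl, hf₁⟩, hτ₁⟩
      · have := bleg i
        exact ⟨⟨false, rfl, iff_of_false (by simp) fun h => hr ⟨_, h⟩⟩, by omega⟩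
      · refine (wp_compareUnder_not (hcoleg j g' f₁)).mono fun v τ' hv => ?_
        have := bcoleg j
        rw [Bool.not_not] at hj
        exact ⟨hv.1.of_iff ⟨fun h => conv_of_conv_coleg hj (h.symm.trans hf₁),
          fun h => hf₁.trans h.symm.coleg⟩, by omega⟩
    rw [if_neg fun h => (canc _ _).1 h hj]
    by_cases hi : (sel i P₀ P₁).ptd = p ∧ (sel (!i) P₀ P₁).ptd = !p
    swap
    · rw [if_pos ((canc _ _).2 hi)]
      simp only [compareMixed, wp_bind]
      refine (fac _ _ _).mono ?_
      rintro r τ₁ ⟨⟨rfl, hr⟩ | ⟨g₁, rfl, hg₁⟩, hτ₁⟩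
      · have := bleg i
        exact ⟨⟨false, rfl, iff_of_false (by simp) fun h => hr ⟨_, h.symm⟩⟩, by omega⟩
      · refine (wp_compareUnder (hleg i f' g₁)).mono fun v τ' hv => ?_
        have := bleg i
        exact ⟨hv.1.of_iff ⟨fun h => conv_of_conv_leg hi (h.trans hg₁),
          fun h => h.leg.trans hg₁.symm⟩, by omega⟩
    rw [if_neg fun h => (canc _ _).1 h hi]
    rw [wp_answer]
    have := bleg i
    refine ⟨⟨false, rfl, iff_of_false (by simp) fun h => ?_⟩, by omega⟩
    -- Neither leg being cancellable, the common factor would join components of polarities `p` and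
    -- `!p` in the impossible direction.
    obtain ⟨u, -⟩ := common h
    exact hp (hi.1.symm.trans (ptd_of_ptd u hj.1))

/-- The preceding lemma covers a first term that starts with a leg; one that starts with a coleg is
covered by its dual. -/
theorem wp_compareDefinite {P₀ P₁ Q₀ Q₁ : Ty}
    {f g : O false (.node false P₀ P₁) (.node true Q₀ Q₁)}
    (hf : ind false f = none) (hg : ind false g = none)
    (hleg : ∀ i (f g : O false (sel i P₀ P₁) (.node true Q₀ Q₁)), EqSpec f g)
    (hcoleg : ∀ j (f g : O false (.node false P₀ P₁) (sel j Q₀ Q₁)), EqSpec f g) {τ : ℕ} :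
    (compareDefinite (Ty.node true Q₀ Q₁).ann (Ty.node false P₀ P₁).ann
      (data false f) (data false g)).Wp τ fun v τ' => EqAnswer f g v ∧
        τ' + 2000 * ((Ty.node false P₀ P₁).size * (Ty.node true Q₀ Q₁).size) ≤
          τ + eqBound (.node false P₀ P₁) (.node true Q₀ Q₁) := by
  rcases core_cases false f with ⟨i, f', rfl⟩ | ⟨j, f', rfl⟩
  · exact wp_compareDefinite_leg f' g hf hg hleg hcoleg
  · have h := wp_compareDefinite_leg (p := true) (P₀ := Q₀) (P₁ := Q₁) (Q₀ := P₀) (Q₁ := P₁)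
      (flip false f') (flip false g) ((ind_flip (coleg false j f')).trans hf)
      ((ind_flip g).trans hg)
      (fun j f g => eqSpec_flip.2 (hcoleg j f g)) (fun i f g => eqSpec_flip.2 (hleg i f g)) (τ := τ)
    rw [Nat.mul_comm (Ty.size _), eqBound_comm] at h
    exact h.mono fun v τ' hv => ⟨(eqAnswer_flip (f := coleg false j f')).1 hv.1, hv.2⟩

theorem wp_compareCore {P Q : Ty} {f g : O false P Q}
    (h : ∀ {τ}, ind false f = none → ind false g = none →
      (compareDefinite Q.ann P.ann (data false f) (data false g)).Wp τ fun v τ' =>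
        EqAnswer f g v ∧ τ' + 2000 * (P.size * Q.size) ≤ τ + eqBound P Q) :
    (compareCore Q.ann P.ann (data false f) (data false g)).Wp 4 fun v τ' =>
      EqAnswer f g v ∧ τ' ≤ eqBound P Q := by
  -- Brings the linear cost of the syntactic comparison under the product bound.
  have hS : P.size + Q.size ≤ 2 * (P.size * Q.size) := by
    have := P.size_pos
    have := Q.size_pos
    nlinarith
  have hbound : 3000 * (P.size * Q.size) ≤ eqBound P Q := by
    have : 0 < P.hgt := by cases P <;> simp [Ty.hgt]
    exact Nat.mul_le_mul_left _ (Nat.le_mul_of_pos_left _ (by omega))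
  have hP := P.size_pos
  simp only [compareCore, wp_bind]
  refine (computes_indef f).callFn fun r n hr hn => ?_
  refine (computes_indef g).callFn fun s m hs hm => ?_
  rcases hr with ⟨hf, rfl⟩ | ⟨c, rfl, hf⟩ <;> rcases hs with ⟨hg, rfl⟩ | ⟨d, rfl, hg⟩ <;>
    simp only [wp_isFound_nil, wp_isFound_found]
  · exact (h hf hg).mono fun v τ' hv => ⟨hv.1, by omega⟩
  · rw [wp_answer]
    refine ⟨⟨false, rfl, iff_of_false (by simp) fun hfg => ?_⟩, by omega⟩
    have := hfg.ind_eq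
    simp [hf, hg] at this
  · rw [wp_answer]
    refine ⟨⟨false, rfl, iff_of_false (by simp) fun hfg => ?_⟩, by omega⟩
    have := hfg.ind_eq
    simp [hf, hg] at this
  · have hcd : Conv false f g ↔ P.norm Q c = P.norm Q d :=
      ⟨fun hfg => Option.some.inj (hf.symm.trans (hfg.ind_eq.trans hg)),
        fun h => conv_of_ind_eq hf (by rw [hg, h])⟩
    simp only [wp_bind, wp_pointed, wp_ite]
    split
    · rename_i e
      have hnorm : ∀ x, P.norm Q x = x := fun x => if_pos e.symm
      rw [hnorm, hnorm] at hcd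
      rw [hnorm] at hf hg
      have same : ∀ {b A}, Pt b A c → Pt b A d → A.size ≤ P.size + Q.size → ∀ {τ},
          τ ≤ 50 + n + m → (callFn .same [c, d]).Wp τ fun v τ' =>
            EqAnswer f g v ∧ τ' ≤ eqBound P Q := by
        intro b A hc hd hA τ hτ
        refine (computes_same hc hd).callFn ?_
        rintro _ k rfl hk
        exact ⟨⟨_, rfl, by simp [hcd]⟩, by omega⟩
      obtain ⟨u, -, hu, rfl⟩ := indSpec f c hf
      obtain ⟨v, -, hv, rfl⟩ := indSpec g d hg
      rw [hnorm, hnorm] at same ⊢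
      -- As the types have equal polarity, both trees are constants of the same type; the mixed
      -- cases would contradict the polarities.
      rcases hu with hu | hu <;> rcases hv with hv | hv
      · exact same hu hv (by omega) (by omega)
      · have := hu.ptd_eq.symm.trans (e.trans hv.ptd_eq)
        simp at this
      · have := hv.ptd_eq.symm.trans (e.trans hu.ptd_eq)
        simp at this
      · exact same hu hv (by omega) (by omega)
    · rename_i e
      rw [wp_answer]
      refine ⟨⟨true, rfl, iff_of_true rfl (hcd.2 ?_)⟩, by omega⟩
      rw [Ty.norm, Ty.norm, if_neg (Ne.symm e), if_neg (Ne.symm e)]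

/-- Induction on total size, since cancelling may shrink either type. Terms out of 1 or into 0 are
indefinite, so the comparison of definite terms is reached only from a product to a sum. -/
theorem computes_equivalent {P Q : Ty} (f g : O false P Q) : EqSpec f g := by
  induction hn : P.size + Q.size using Nat.strong_induction_on generalizing P Q with
  | _ n ih =>
  subst hn
  have ihP : ∀ {q P₀ P₁}, P = .node q P₀ P₁ → ∀ i (f g : O false (sel i P₀ P₁) Q), EqSpec f g := by
    rintro q P₀ P₁ rfl i f g
    refine ih _ ?_ f g rfl
    have := Ty.size_sel i P₀ P₁
    rw [Ty.size_node]; omega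
  have ihQ : ∀ {q Q₀ Q₁}, Q = .node q Q₀ Q₁ → ∀ j (f g : O false P (sel j Q₀ Q₁)), EqSpec f g := by
    rintro q Q₀ Q₁ rfl j f g
    refine ih _ ?_ f g rfl
    have := Ty.size_sel j Q₀ Q₁
    rw [Ty.size_node]; omega
  clear ih
  have yes : Conv false f g → EqAnswer f g (.leaf (.bit true)) ∧ 5 ≤ eqBound P Q := by
    intro h
    refine ⟨⟨true, rfl, iff_of_true rfl h⟩, ?_⟩
    have hs := Nat.mul_pos P.size_pos Q.size_pos
    have : 0 < P.hgt := by cases P <;> simp [Ty.hgt]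
    have := Nat.mul_pos (Nat.add_pos_left this Q.hgt) hs
    unfold eqBound; omega
  refine Wp.computes ?_
  rcases Q with _ | _ | ⟨Q₀, Q₁⟩ | ⟨Q₀, Q₁⟩
  · have h := yes (conv_unit (p := false) f g)
    cases P <;> exact h
  · rcases P with _ | _ | ⟨P₀, P₁⟩ | ⟨P₀, P₁⟩
    · exact wp_compareCore fun hf => absurd hf (ind_of_counit (p := false) f)
    · exact yes (conv_flip.1 (conv_unit (p := true) (flip false f) (flip false g)))
    · exact wp_compareCore fun hf => absurd hf (ind_of_counit (p := false) f)
    · have h := wp_split (p := true) (f := flip false f) (g := flip false g)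
        (fun i f g => eqSpec_flip.2 (ihP (q := true) rfl i f g))
      rw [eqBound_comm] at h
      exact h.mono fun v τ' hv => ⟨eqAnswer_flip.1 hv.1, hv.2⟩
  · have h := wp_split (p := false) (f := f) (g := g) (ihQ (q := false) rfl)
    cases P
    case one => exact yes (conv_flip.1 (conv_unit (p := true) (flip false f) (flip false g)))
    all_goals exact h
  · rcases P with _ | _ | ⟨P₀, P₁⟩ | ⟨P₀, P₁⟩
    · refine wp_compareCore fun hf => ?_
      exact absurd ((ind_flip f).trans hf) (ind_of_counit (p := true) (flip false f))
    · exact yes (conv_flip.1 (conv_unit (p := true) (flip false f) (flip false g)))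
    · exact wp_compareCore fun hf hg => wp_compareDefinite hf hg (ihP (q := false) rfl)
        (ihQ (q := true) rfl)
    · have h := wp_split (p := true) (f := flip false f) (g := flip false g)
        (fun i f g => eqSpec_flip.2 (ihP (q := true) rfl i f g))
      rw [eqBound_comm] at h
      exact h.mono fun v τ' hv => ⟨eqAnswer_flip.1 hv.1, hv.2⟩

/-! ### Halting and the total running time -/

theorem Code.Runs.haltsWithin {f : Fn} {xs : List Data} {n N : ℕ} {v : Data}
    (h : (procedure f xs).Runs n v) (hN : n ≤ N) : HaltsWithin procedure f xs N v := by
  have h := h .ret []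
  rw [bind_ret] at h
  obtain ⟨k, rfl⟩ := Nat.exists_eq_add_of_le' hN
  rw [HaltsWithin, Function.iterate_add_apply, h]
  exact Function.iterate_fixed rfl k

theorem computes_main {A B : Ty} (t₁ t₂ : Tm A B) :
    Computes .main [A.data, B.data, t₁.data, t₂.data]
      (60 * A.size + 60 * B.size + eqBound B A + 6)
      (EqAnswer (p := false) (P := B) (Q := A) t₁ t₂) := by
  refine Wp.computes ?_
  simp only [procedure, mainBody, wp_bind]
  refine (computes_annot A).callFn ?_
  rintro _ n rfl hn
  refine (computes_annot B).callFn ?_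
  rintro _ m rfl hm
  exact (computes_equivalent (P := B) (Q := A) t₁ t₂).callFn fun v k hv hk => ⟨hv, by omega⟩

end SP

theorem mainTheorem1 :
    ∃ C : ℕ, ∀ (A B : SP.Ty) (t₁ t₂ : SP.Tm A B), ∃ b : Bool,
      SP.HaltsWithin SP.procedure .main [A.data, B.data, t₁.data, t₂.data]
        (C * ((A.hgt + B.hgt) * A.size * B.size)) (.leaf (.bit b)) ∧
      (b = true ↔ t₁.hom = t₂.hom) := by
  -- The comparison takes 3000 times the height-size product; the annotation is linear in the two
  -- sizes and fits with its overhead into the remaining 1000.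
  refine ⟨4000, fun A B t₁ t₂ => ?_⟩
  obtain ⟨_, n, hrun, ⟨b, rfl, hb⟩, hn⟩ := SP.computes_main t₁ t₂
  refine ⟨b, hrun.haltsWithin (hn.trans ?_), hb.trans SP.Tm.hom_eq_iff.symm⟩
  have hA := A.size_pos
  have hB := B.size_pos
  have hh : 0 < A.hgt := by cases A <;> simp [SP.Ty.hgt]
  have hS : A.size + B.size ≤ 2 * (A.size * B.size) := by nlinarith
  have hS' := Nat.mul_pos hA hB
  have hT : A.size * B.size ≤ (A.hgt + B.hgt) * (A.size * B.size) :=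
    Nat.le_mul_of_pos_left _ (by omega)
  rw [SP.eqBound_comm, SP.eqBound, Nat.mul_assoc (A.hgt + B.hgt)]
  omega
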